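/- Let $m,p,n\ge 1$ be integers with $p\mid m$, let $\mathbb F$ be a field of characteristic zero containing a primitive $m$-th root of unity, let $q\in\mathbb F\setminus\{0\}$ not be a root of unity, and let $\boldsymbol r=(r_1,\dots,r_n)$ be a tuple of positive integers. Notation. Let $\Lambda=\mathbb F[x_{ki}^{\pm1}\mid 1\le k\le n,\ 1\le i\le r_k]$ and $L=\operatorname{Frac}\Lambda$. Let $A(m,p,s)$ be the group of $s$-tuples $\alpha$ of $m$-th roots of unity in $\mathbb F$ with $(\alpha_1\cdots\alpha_s)^{m/p}=1$, let $G(m,p,s)=S_s\ltimes A(m,p,s)$, and let $G=\prod_k G(m,p,r_k)$ act on $L$ by $x_{ki}\mapsto\alpha_{ki}x_{k,\sigma_k(i)}$; put $\Gamma=\Lambda^G$. Let $\mathscr V=L*\hat{\mathcal M}$ be the skew group algebra of the free abelian group $\hat{\mathcal M}$ on $\{\delta^{ki}\mid 1\le k\le n,\ 1\le i\le r_k\}$, with $\delta^{ki}x_{lj}=q^{-\delta_{kl}\delta_{ij}}x_{lj}\delta^{ki}$. Put $[u]=u^{-m/p}(u^m-1)/\bigl(q^{-m/p}(q^m-1)\bigr)$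 and $r_0=0$, and for $1\le k\le n-1$ $$X_k^{\pm}=\sum_{i=1}^{r_k}(\delta^{ki})^{\pm1}A_{ki}^{\pm},\qquad A_{ki}^{\pm}=\mp\, x_{ki}^{-\frac mp(r_{k\pm1}-r_k)}\,\frac{\prod_{j=1}^{r_{k\pm1}}[x_{k\pm1,j}x_{ki}^{-1}]}{\prod_{j\ne i}[x_{kj}x_{ki}^{-1}]}.$$ The quantum OGZ algebra $U_q^{m,p}(\boldsymbol r)$ is the $\mathbb F$-subalgebra of $\operatorname{End}_{\mathbb F}(\mathscr V)$ generated by the left multiplications by the elements of $\Gamma$ and by $X_k^{\pm}$, $1\le k\le n-1$. For a field $\Bbbk$ and $\bar q=(q_1,\dots,q_s)\in(\Bbbk^\times)^s$, $s\ge 0$, let $\Bbbk_{\bar q}[\underline x,\underline y]$ be the $\Bbbk$-algebra with generators $x_i,y_i$ ($1\le i\le s$) and relations $x_ix_j=x_jx_i$, $y_iy_j=y_jy_i$, $y_ix_j=q_i^{\delta_{ij}}x_jy_i$, and let $\Bbbk_{\bar q}(\underline x,\underline y)$ be its division ring of fractions. Theorem. $U_q^{m,p}(\boldsymbol r)$ satisfies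 the quantum Gelfand–Kirillov conjecture: it is an Ore domain, and its division ring of fractions is isomorphic, as an $\mathbb F$-algebra, to $\Bbbk_{\bar q}(\underline x,\underline y)$ for some purely transcendental field extension $\Bbbk$ of $\mathbb F$ and some $\bar q$ whose entries are integral powers of $q$. Explicitly, there are a purely transcendental field extension $\Bbbk$ of $\mathbb F$ of degree $r_n$ and an isomorphism of $\mathbb F$-algebras $$\operatorname{Frac}\bigl(U_q^{m,p}(\boldsymbol r)\bigr)\simeq\Bbbk_{\bar q}(\underline x,\underline y),\qquad \bar q=(q^{m/p},\dots,q^{m/p},q^m,\dots,q^m),$$ where $q^{m/p}$ appears $n-1$ times and $q^m$ appears $r_1+\dots+r_{n-1}-(n-1)$ times. -/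

import Mathlib

universe u v

namespace QuantumOGZ

open scoped nonZeroDivisors

noncomputable section

/-! ### Ore domains and their division rings of fractions -/

/-- A (two-sided) Ore domain: a domain in which any two nonzero elements have a nonzero common
left multiple and a nonzero common right multiple. -/
class IsOreDomain (A : Type u) [Ring A] : Prop extends IsDomain A where
  left_ore : ∀ a b : A, a ≠ 0 → b ≠ 0 → ∃ c d : A, c * a = d * b ∧ c * a ≠ 0
  right_ore : ∀ a b : A, a ≠ 0 → b ≠ 0 → ∃ c d : A, a * c = b * d ∧ a * c ≠ 0

theorem IsOreDomain.nonempty_oreSet (A : Type u) [Ring A] [IsOreDomain A] :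
    Nonempty (OreLocalization.OreSet A⁰) := by
  rw [OreLocalization.nonempty_oreSet_iff_of_noZeroDivisors]
  intro a s
  by_cases ha : a = 0
  · exact ⟨0, 1, by simp [ha]⟩
  · obtain ⟨c, d, h, h0⟩ := IsOreDomain.left_ore a (s : A) ha (nonZeroDivisors.ne_zero s.2)
    exact ⟨d, ⟨c, mem_nonZeroDivisors_of_ne_zero (left_ne_zero_of_mul h0)⟩, h⟩

instance (priority := 50) IsOreDomain.oreSet (A : Type u) [Ring A] [IsOreDomain A] :
    OreLocalization.OreSet A⁰ :=
  Classical.choice (IsOreDomain.nonempty_oreSet A)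

/-- The division ring of fractions of an Ore domain: its Ore localization at the set of all
nonzero elements. -/
abbrev Frac (A : Type u) [Ring A] [IsOreDomain A] : Type u :=
  OreLocalization A⁰ A

/-! ### Quantum Weyl fields -/

section QuantumAffine

variable {k : Type u} [Field k] {ι : Type v}

/-- The defining relations
`x i * x j = x j * x i`, `y i * y j = y j * y i`, `y i * x j = (c i) ^ δ_ij • x j * y i`,
where `x i` is the generator `Sum.inl i` and `y i` the generator `Sum.inr i`. -/
inductive AffineRel (c : ι → k) : FreeAlgebra k (ι ⊕ ι) → FreeAlgebra k (ι ⊕ ι) → Prop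
  | xx (i j : ι) : AffineRel c
      (FreeAlgebra.ι k (Sum.inl i) * FreeAlgebra.ι k (Sum.inl j))
      (FreeAlgebra.ι k (Sum.inl j) * FreeAlgebra.ι k (Sum.inl i))
  | yy (i j : ι) : AffineRel c
      (FreeAlgebra.ι k (Sum.inr i) * FreeAlgebra.ι k (Sum.inr j))
      (FreeAlgebra.ι k (Sum.inr j) * FreeAlgebra.ι k (Sum.inr i))
  | yx_same (i : ι) : AffineRel c
      (FreeAlgebra.ι k (Sum.inr i) * FreeAlgebra.ι k (Sum.inl i))
      (c i • (FreeAlgebra.ι k (Sum.inl i) * FreeAlgebra.ι k (Sum.inr i)))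
  | yx_ne (i j : ι) (h : i ≠ j) : AffineRel c
      (FreeAlgebra.ι k (Sum.inr i) * FreeAlgebra.ι k (Sum.inl j))
      (FreeAlgebra.ι k (Sum.inl j) * FreeAlgebra.ι k (Sum.inr i))

/-- The algebra `k_c[x, y]`: the tensor product over `k` of the quantum planes with
parameters `c i`, given by generators and relations. -/
abbrev QuantumAffine (c : ι → k) : Type (max u v) := RingQuot (AffineRel c)

end QuantumAffine

/-- `K` is generated, as a field extension of `F`, by the algebraically independent subset `S`. -/
def IsPurelyTranscendentalOn (F : Type u) (K : Type v) [Field F] [Field K] [Algebra F K]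
    (S : Set K) : Prop :=
  AlgebraicIndependent F ((↑) : S → K) ∧ IntermediateField.adjoin F S = ⊤

/-- The quantum Gelfand-Kirillov conjecture for an `F`-algebra `A`: it is an Ore domain, and its
division ring of fractions is isomorphic, as an `F`-algebra, to a quantum Weyl field
`K_c(x, y)` over a purely transcendental extension `K` of `F`, with parameters `c i` that are
integral powers of `q`. -/
def SatisfiesQuantumGK {F : Type u} [Field F] (q : Fˣ) (A : Type u) [Ring A] [Algebra F A] :
    Prop :=
  ∃ (K : Type u) (_ : Field K) (_ : Algebra F K) (S : Set K) (s : ℕ) (e : Fin s → ℤ),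
    IsPurelyTranscendentalOn F K S ∧
    ∃ (_ : IsOreDomain A)
      (_ : IsOreDomain (QuantumAffine fun i => algebraMap F K ((q ^ e i : Fˣ) : F))),
      Nonempty (Frac A ≃ₐ[F]
        Frac (QuantumAffine fun i => algebraMap F K ((q ^ e i : Fˣ) : F)))

/-! ### Monomial automorphisms of rational function fields -/

section Monomial

variable (F : Type u) [Field F] (I : Type)

/-- The field `F(x_i : i ∈ I)` of rational functions. -/
abbrev RatFun : Type u := FractionRing (MvPolynomial I F)

variable {I}

/-- The variable `x_i` of `F(x_i : i ∈ I)`. -/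
def xvar (i : I) : RatFun F I :=
  algebraMap (MvPolynomial I F) (RatFun F I) (MvPolynomial.X i)

/-- The extension of automorphisms of the polynomial ring to the field of fractions. -/
def extendHom : (MvPolynomial I F ≃ₐ[F] MvPolynomial I F) →* (RatFun F I ≃ₐ[F] RatFun F I) :=
  IsFractionRing.fieldEquivOfAlgEquivHom F (RatFun F I)

variable {F}

/-- The endomorphism `x_i ↦ c_i x_i` of the polynomial ring. -/
def scaleEnd (c : I → Fˣ) : MvPolynomial I F →ₐ[F] MvPolynomial I F :=
  MvPolynomial.aeval fun i => MvPolynomial.C (c i : F) * MvPolynomial.X i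

theorem scaleEnd_comp (c d : I → Fˣ) : (scaleEnd c).comp (scaleEnd d) = scaleEnd (c * d) := by
  refine MvPolynomial.algHom_ext fun i => ?_
  simp [scaleEnd, MvPolynomial.algHom_C]
  ring

theorem scaleEnd_one : scaleEnd (1 : I → Fˣ) = AlgHom.id F _ := by
  refine MvPolynomial.algHom_ext fun i => ?_
  simp [scaleEnd]

/-- The torus action `x_i ↦ c_i x_i` on the polynomial ring. -/
def scaleHom : (I → Fˣ) →* (MvPolynomial I F ≃ₐ[F] MvPolynomial I F) where
  toFun c := AlgEquiv.ofAlgHom (scaleEnd c) (scaleEnd c⁻¹)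
    (by rw [scaleEnd_comp, mul_inv_cancel, scaleEnd_one])
    (by rw [scaleEnd_comp, inv_mul_cancel, scaleEnd_one])
  map_one' := by
    refine AlgEquiv.ext fun x => ?_
    exact DFunLike.congr_fun scaleEnd_one x
  map_mul' c d := by
    refine AlgEquiv.ext fun x => ?_
    exact (DFunLike.congr_fun (scaleEnd_comp c d) x).symm

/-- The automorphism `x_i ↦ c_i x_{σ(i)}` of `F(x_i : i ∈ I)`. -/
def monomialAut (σ : Equiv.Perm I) (c : I → Fˣ) : RatFun F I ≃ₐ[F] RatFun F I :=
  extendHom F ((scaleHom c).trans (MvPolynomial.renameEquiv F σ))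

/-- The free abelian group on `δ^i`, `i ∈ I` (for finite `I`), written multiplicatively. The
parameter `q` only records how it acts on rational functions. -/
def ShiftGroup (I : Type) (_q : Fˣ) : Type := Multiplicative (I → ℤ)

instance (q : Fˣ) : CommGroup (ShiftGroup I q) :=
  inferInstanceAs (CommGroup (Multiplicative (I → ℤ)))

/-- The group element `∏ i, (δ^i) ^ (a i)`. -/
def ShiftGroup.of (q : Fˣ) (a : I → ℤ) : ShiftGroup I q := Multiplicative.ofAdd a

/-- `∏ i, (δ^i) ^ (a i)` acts by `x_i ↦ q ^ (- a i) x_i`. -/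
def shiftHom (q : Fˣ) : ShiftGroup I q →* (RatFun F I ≃ₐ[F] RatFun F I) :=
  (extendHom F).comp (scaleHom.comp
    { toFun := fun a i => q ^ (-(Multiplicative.toAdd a i))
      map_one' := by
        ext i
        exact congrArg Units.val (show q ^ (-(0 : ℤ)) = 1 by simp)
      map_mul' := fun a b => by
        funext i
        exact (show q ^ (-(Multiplicative.toAdd a i + Multiplicative.toAdd b i))
          = q ^ (-(Multiplicative.toAdd a i)) * q ^ (-(Multiplicative.toAdd b i)) by
            rw [neg_add, zpow_add]) })

instance (q : Fˣ) : MulSemiringAction (ShiftGroup I q) (RatFun F I) :=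
  MulSemiringAction.compHom (RatFun F I) (shiftHom (I := I) q)

theorem shift_smul_def (q : Fˣ) (g : ShiftGroup I q) (f : RatFun F I) :
    g • f = shiftHom q g f := rfl

instance (q : Fˣ) : SMulCommClass (ShiftGroup I q) F (RatFun F I) where
  smul_comm g a f := by rw [shift_smul_def, shift_smul_def, map_smul]

/-- The skew group algebra of `ShiftGroup I q` over `F(x_i : i ∈ I)`, in which
`δ^i x_j = q ^ (-δ_ij) x_j δ^i`. -/
def SkewAlg (I : Type) (q : Fˣ) : Type u :=
  SkewMonoidAlgebra (RatFun F I) (ShiftGroup I q)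

instance (q : Fˣ) : Ring (SkewAlg I q) :=
  inferInstanceAs (Ring (SkewMonoidAlgebra (RatFun F I) (ShiftGroup I q)))

instance (q : Fˣ) : Algebra F (SkewAlg I q) :=
  inferInstanceAs (Algebra F (SkewMonoidAlgebra (RatFun F I) (ShiftGroup I q)))

/-- The element `f · g` of the skew group algebra, for a rational function `f` and a group
element `g`. -/
def SkewAlg.mono (q : Fˣ) (f : RatFun F I) (g : ShiftGroup I q) : SkewAlg I q :=
  SkewMonoidAlgebra.single g f

end Monomial

/-! ### The quantum OGZ algebra -/

section OGZ

variable {F : Type u} [Field F] {n : ℕ}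

/-- The index set of the variables `x_{ki}`: the rows `k` are indexed by `Fin n`, and row `k` has
`r k` entries. -/
abbrev Idx (r : Fin n → ℕ) : Type := Σ k : Fin n, Fin (r k)

/-- The group `A(m, p, s)`: tuples of `m`-th roots of unity with `(∏ α_i) ^ (m / p) = 1`. -/
def groupA (F : Type u) [Field F] (m p s : ℕ) : Subgroup (Fin s → Fˣ) where
  carrier := {α | (∀ i, α i ^ m = 1) ∧ (∏ i, α i) ^ (m / p) = 1}
  one_mem' := by simp
  mul_mem' := by
    rintro α β ⟨h1, h2⟩ ⟨h3, h4⟩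
    refine ⟨fun i => ?_, ?_⟩
    · rw [Pi.mul_apply, mul_pow, h1, h3, one_mul]
    · simp only [Pi.mul_apply]
      rw [Finset.prod_mul_distrib, mul_pow, h2, h4, one_mul]
  inv_mem' := by
    rintro α ⟨h1, h2⟩
    refine ⟨fun i => ?_, ?_⟩
    · rw [Pi.inv_apply, inv_pow, h1, inv_one]
    · simp only [Pi.inv_apply]
      rw [Finset.prod_inv_distrib, inv_pow, h2, inv_one]

/-- The action on `F(x_{ki})` of the element of `∏_k G(m, p, r_k)` given by the permutations
`σ_k` and the tuples `α_k`: it sends `x_{ki}` to `α_{ki} x_{k, σ_k(i)}`. -/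
def reflAut (r : Fin n → ℕ) (σ : ∀ k, Equiv.Perm (Fin (r k))) (α : ∀ k, Fin (r k) → Fˣ) :
    RatFun F (Idx r) ≃ₐ[F] RatFun F (Idx r) :=
  monomialAut (Equiv.sigmaCongrRight σ) fun t => α t.1 t.2

/-- The Laurent polynomial algebra `Λ`, inside its field of fractions. -/
def laurent (F : Type u) [Field F] (r : Fin n → ℕ) : Subalgebra F (RatFun F (Idx r)) :=
  Algebra.adjoin F (Set.range (xvar F) ∪ Set.range fun t => (xvar F t)⁻¹)

/-- `Γ`, the algebra of Laurent polynomials invariant under `∏_k G(m, p, r_k)`. -/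
def invariants (F : Type u) [Field F] (m p : ℕ) (r : Fin n → ℕ) :
    Subalgebra F (RatFun F (Idx r)) where
  carrier := {f | f ∈ laurent F r ∧ ∀ (σ : ∀ k, Equiv.Perm (Fin (r k)))
    (α : ∀ k, Fin (r k) → Fˣ), (∀ k, α k ∈ groupA F m p (r k)) → reflAut r σ α f = f}
  mul_mem' := by
    rintro f g ⟨hf, hf'⟩ ⟨hg, hg'⟩
    exact ⟨mul_mem hf hg, fun σ α h => by rw [map_mul, hf' σ α h, hg' σ α h]⟩
  add_mem' := by
    rintro f g ⟨hf, hf'⟩ ⟨hg, hg'⟩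
    exact ⟨add_mem hf hg, fun σ α h => by rw [map_add, hf' σ α h, hg' σ α h]⟩
  algebraMap_mem' := fun a => ⟨algebraMap_mem _ a, fun σ α _ => AlgEquiv.commutes _ a⟩

/-- `u ^ (-m/p) (u ^ m - 1) / (q ^ (-m/p) (q ^ m - 1))`. -/
def qBracket (q : Fˣ) (m p : ℕ) {I : Type} (t : RatFun F I) : RatFun F I :=
  t ^ (-((m / p : ℕ) : ℤ)) * (t ^ m - 1) /
    algebraMap F (RatFun F I) ((q : F) ^ (-((m / p : ℕ) : ℤ)) * ((q : F) ^ m - 1))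

/-- The expression
`x_{ki} ^ (-(m/p) (#T - r_k)) ∏_{t ∈ T} [x_t / x_{ki}] / ∏_{j ≠ i} [x_{kj} / x_{ki}]`,
where `T` is an adjacent row. -/
def coeffA (q : Fˣ) (m p : ℕ) (r : Fin n → ℕ) (T : Finset (Idx r)) (k : Fin n) (i : Fin (r k)) :
    RatFun F (Idx r) :=
  xvar F ⟨k, i⟩ ^ (-((m / p : ℕ) : ℤ) * ((T.card : ℤ) - (r k : ℤ))) *
    ((∏ t ∈ T, qBracket q m p (xvar F t * (xvar F ⟨k, i⟩)⁻¹)) /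
      ∏ j ∈ Finset.univ.erase i, qBracket q m p (xvar F ⟨k, j⟩ * (xvar F ⟨k, i⟩)⁻¹))

/-- The entries of row `k + 1`. -/
def nextRow (r : Fin n → ℕ) (k : Fin n) : Finset (Idx r) :=
  Finset.univ.filter fun t => (t.1 : ℕ) = (k : ℕ) + 1

/-- The entries of row `k - 1`; there are none if `k` is the first row. -/
def prevRow (r : Fin n → ℕ) (k : Fin n) : Finset (Idx r) :=
  Finset.univ.filter fun t => (t.1 : ℕ) + 1 = (k : ℕ)

/-- `X_k^+ = ∑_i δ^{ki} A_{ki}^+`, where `A_{ki}^+` carries the sign `-`. -/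
def Xplus (q : Fˣ) (m p : ℕ) (r : Fin n → ℕ) (k : Fin n) : SkewAlg (Idx r) q :=
  ∑ i : Fin (r k),
    SkewAlg.mono q 1 (ShiftGroup.of q (Pi.single ⟨k, i⟩ 1)) *
      SkewAlg.mono q (-coeffA q m p r (nextRow r k) k i) 1

/-- `X_k^- = ∑_i (δ^{ki})⁻¹ A_{ki}^-`, where `A_{ki}^-` carries the sign `+`. -/
def Xminus (q : Fˣ) (m p : ℕ) (r : Fin n → ℕ) (k : Fin n) : SkewAlg (Idx r) q :=
  ∑ i : Fin (r k),
    SkewAlg.mono q 1 (ShiftGroup.of q (-Pi.single ⟨k, i⟩ 1)) *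
      SkewAlg.mono q (coeffA q m p r (prevRow r k) k i) 1

/-- The quantum OGZ algebra `U_q^{m,p}(r)`: the `F`-subalgebra of `End_F` of the skew group
algebra generated by the left multiplications by the elements of `Γ` and by `X_k^+` and `X_k^-`,
for all rows `k` but the last one. -/
def quantumOGZ (q : Fˣ) (m p : ℕ) (r : Fin n → ℕ) :
    Subalgebra F (Module.End F (SkewAlg (Idx r) q)) :=
  Algebra.adjoin F
    ({φ | ∃ f ∈ invariants F m p r, φ = LinearMap.mulLeft F (SkewAlg.mono q f 1)} ∪
      {φ | ∃ k : Fin n, (k : ℕ) + 1 < n ∧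
        (φ = LinearMap.mulLeft F (Xplus q m p r k) ∨
          φ = LinearMap.mulLeft F (Xminus q m p r k))})

end OGZ

end

end QuantumOGZ

set_option linter.unusedSectionVars false

/-! Evaluation at 1 embeds the quantum OGZ algebra U in the skew group algebra, which is an Ore
domain; let D be the division ring of fractions of the latter. Both U and the quantum affine algebra
are Ore because an algebra of polynomial growth contains no free algebra on two letters
(`left_ore_of_growth`). The fraction ring of each is then the division subring of D that its image
generates, so it suffices to find in D a family satisfying the quantum affine relations and
generating the same division subring as U (`nonempty_frac_equiv`).

Put z_i = x_{ki}^m for a row k, A_k(u) = ∏ (u - z_i) and C_k(u) = ∑ δ^{ki} ℓ_i(u), where ℓ_i is the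
Lagrange basis at the nodes z_i. Galois theory identifies the fixed field of the reflection group
with the field generated by the coefficients of all A_k and by the (m/p)-th powers w_k of the row
products (`mem_invField_of_fixed`). Commutators with ∑ z_i, followed by interpolation, turn X_k^+
into the coefficients of C_k, and X_k^- comes for free because inverses of the shifts can be
interpolated too (`map_Xminus_mem`). So U generates the same division ring as the invariants and the
coefficients of C_k for the rows before the last (`map_ogzHom_mem_iff`).

The pair (A_k, C_k) satisfies the relations of a column of the monodromy matrix of the open q-Toda
chain with Q = q^{-m} (`todaPair_of_nodes`). Such a matrix factors into one-particle Lax matrices.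
Here the factorisation is a noncommutative Euclidean algorithm: each division step lowers the degree
by one and splits off a pair c, e with c e = Q e c that commutes with everything remaining
(`TodaPair.exists_step`, `TodaPair.exists_generators`). A row thus yields r_k pairs with parameter
q^m. The first e is A_k(0) = ± w_k^p; replacing it by w_k, which scales the first c by q^{m/p} and
commutes with all other generators, accounts for the missing invariant and for the one exceptional
parameter of each row. Different rows commute. The last row has no shifts in U, so its r_n
algebraically independent invariants commute with all these pairs and form the purely transcendental
ground field. -/

namespace QuantumOGZ
open Polynomial

noncomputable section

/-! ### Polynomials over a division ring, evaluated at central scalars. -/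

section CentralEval

variable {F : Type*} {D : Type*} [Field F] [DivisionRing D] [Algebra F D]

/-- Evaluation of a polynomial over a division ring at a central scalar. -/
def evalC (u : F) : D[X] →+* D :=
  Polynomial.eval₂RingHom' (RingHom.id D) (algebraMap F D u) fun a => (Algebra.commutes u a).symm

theorem evalC_C (u : F) (a : D) : evalC u (C a) = a := by
  simp [evalC, Polynomial.eval₂RingHom']

theorem evalC_X (u : F) : evalC u (X : D[X]) = algebraMap F D u := by
  simp [evalC, Polynomial.eval₂RingHom']

theorem evalC_eq_sum (u : F) (f : D[X]) {n : ℕ} (hn : f.natDegree < n) :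
    evalC u f = ∑ i ∈ Finset.range n, u ^ i • f.coeff i := by
  have : evalC u f = f.eval₂ (RingHom.id D) (algebraMap F D u) := rfl
  rw [this, Polynomial.eval₂_eq_sum_range' _ hn]
  refine Finset.sum_congr rfl fun i _ => ?_
  rw [Algebra.smul_def, ← map_pow, Algebra.commutes]; rfl

theorem evalC_zero (f : D[X]) : evalC (0 : F) f = f.coeff 0 := by
  rw [evalC_eq_sum 0 f (Nat.lt_succ_self _), Finset.sum_eq_single 0]
  · simp
  · intro i _ hi; simp [hi]
  · simp

/-- An F-linear functional on D, applied to the coefficients, gives a polynomial over F with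
infinitely many roots, and functionals separate the points of D. Excluding u = 0 costs nothing and
allows relations that were obtained after division by the spectral parameter. -/
theorem eq_zero_of_evalC_eq_zero [Infinite F] (f : D[X]) (h : ∀ u : F, u ≠ 0 → evalC u f = 0) :
    f = 0 := by
  ext n
  rw [coeff_zero, ← Module.forall_dual_apply_eq_zero_iff F]
  intro l
  set g : F[X] := ∑ i ∈ Finset.range (f.natDegree + 1), monomial i (l (f.coeff i)) with hg
  have hgz : g = 0 := by
    refine Polynomial.eq_zero_of_infinite_isRoot g (Set.Infinite.mono (s := {0}ᶜ) ?_ ?_)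
    · intro u hu
      have h1 : evalC u f = 0 := h u hu
      rw [evalC_eq_sum u f (Nat.lt_succ_self _)] at h1
      have h2 := congrArg l h1
      rw [map_sum, map_zero] at h2
      rw [Set.mem_ofPred_eq, Polynomial.IsRoot, hg, Polynomial.eval_finsetSum, ← h2]
      refine Finset.sum_congr rfl fun i _ => ?_
      rw [eval_monomial, map_smul, smul_eq_mul, mul_comm]
    · exact (Set.finite_singleton (0 : F)).infinite_compl
  by_cases hn : n ≤ f.natDegree
  · have := congrArg (fun p => coeff p n) hgz
    simpa [hg, coeff_monomial, hn] using this
  · rw [coeff_eq_zero_of_natDegree_lt (not_le.mp hn), map_zero]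

theorem eq_of_evalC_eq [Infinite F] (f g : D[X])
    (h : ∀ u : F, u ≠ 0 → evalC u f = evalC u g) : f = g :=
  sub_eq_zero.mp <| eq_zero_of_evalC_eq_zero (F := F) _ fun u hu => by
    rw [map_sub, h u hu, sub_self]

theorem evalC_commute_of_coeff {a : D} (u : F) (f : D[X]) (h : ∀ n, Commute a (f.coeff n)) :
    Commute a (evalC u f) := by
  rw [evalC_eq_sum u f (Nat.lt_succ_self _)]
  exact Commute.sum_right _ _ _ fun i _ => (h i).smul_right _

/-- The two spectral parameters are removed one at a time: for fixed v the values in u determine a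
polynomial identity, and then v is varied. -/
theorem coeff_commute_of_evalC [Infinite F] (f g : D[X])
    (h : ∀ u v : F, u ≠ 0 → v ≠ 0 → evalC u f * evalC v g = evalC v g * evalC u f) (n m : ℕ) :
    Commute (f.coeff n) (g.coeff m) := by
  have h1 : ∀ v : F, v ≠ 0 → f * C (evalC v g) = C (evalC v g) * f := fun v hv =>
    eq_of_evalC_eq (F := F) _ _ fun u hu => by
      simp only [map_mul, evalC_C, h u v hu hv]
  have h2 : C (f.coeff n) * g = g * C (f.coeff n) :=
    eq_of_evalC_eq (F := F) _ _ fun v hv => by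
      have := congrArg (fun p => coeff p n) (h1 v hv)
      simpa [evalC_C] using this
  have := congrArg (fun p => coeff p m) h2
  simpa [Commute, SemiconjBy] using this

end CentralEval

/-! ### Toda pairs and the noncommutative Euclidean algorithm. -/

section Toda

variable {F : Type*} {D : Type*} [Field F] [DivisionRing D] [Algebra F D]

/-- A pair of polynomials over a division ring that satisfies the commutation relations of a
column of the monodromy matrix of the open `q`-Toda chain with `k` particles. -/
structure TodaPair (Q : F) (k : ℕ) (A C : D[X]) : Prop where
  monic : A.Monic
  natDegree : A.natDegree = k
  coeff_eq_zero : ∀ n, k ≤ n → C.coeff n = 0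
  commA : ∀ n m, Commute (A.coeff n) (A.coeff m)
  commC : ∀ n m, Commute (C.coeff n) (C.coeff m)
  rel : ∀ u v : F, (Q * (v - u)) • (evalC u A * evalC v C) =
    (v - Q * u) • (evalC v C * evalC u A) - ((1 - Q) * u) • (evalC u C * evalC v A)
  ne_zero : A.coeff 0 ≠ 0
  coprime : ∃ S T : D[X], S * A + T * C = 1

namespace TodaPair

variable {Q : F} {k : ℕ} {A C : D[X]}

/-- A combination of `rel` at (u, v) and at (v, u), divided by Q(v - u); at u = v both sides are
zero. -/
theorem rel' (hQ : Q ≠ 0) (h : TodaPair Q k A C) (u v : F) :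
    (v - u) • (evalC u C * evalC v A) =
      (v - Q * u) • (evalC v A * evalC u C) - ((1 - Q) * v) • (evalC u A * evalC v C) := by
  by_cases huv : v = u
  · subst huv; module
  have h1 := h.rel u v
  have h2 := h.rel v u
  apply smul_right_injective D (mul_ne_zero hQ (sub_ne_zero.mpr huv))
  simp only
  linear_combination (norm := module) ((1 - Q) * v) • h1 + (v - Q * u) • h2

/-- Coprimality is needed exactly here: with C = 0 a monic polynomial of positive degree would have
a left inverse. -/
theorem C_ne_zero (h : TodaPair Q (k + 1) A C) : C ≠ 0 := by
  rintro rfl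
  obtain ⟨S, T, hST⟩ := h.coprime
  rw [mul_zero, add_zero] at hST
  have := congrArg Polynomial.natDegree hST
  have hS : S ≠ 0 := by rintro rfl; simp at hST
  rw [natDegree_mul hS h.monic.ne_zero, h.natDegree, natDegree_one] at this
  omega

variable [Infinite F]

theorem rel_zero (h : TodaPair Q k A C) (n : ℕ) :
    C.coeff n * A.coeff 0 = Q • (A.coeff 0 * C.coeff n) := by
  have : C * Polynomial.C (A.coeff 0) = Polynomial.C (algebraMap F D Q) *
      (Polynomial.C (A.coeff 0) * C) := eq_of_evalC_eq (F := F) _ _ fun v hv => by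
    have := h.rel 0 v
    simp only [evalC_zero, sub_zero, mul_zero, zero_smul] at this
    simp only [map_mul, evalC_C, ← Algebra.smul_def]
    apply smul_right_injective D hv
    simp only [smul_smul, mul_comm v Q, this]
  simpa [← Algebra.smul_def] using congrArg (fun p => coeff p n) this

/-- Both sides of `rel` are polynomials in v; this is the coefficient of v^(k+1), where A
contributes its leading coefficient 1. -/
theorem rel_top (h : TodaPair Q (k + 1) A C) (u : F) :
    C.coeff k * evalC u A = Q • (evalC u A * C.coeff k) + ((1 - Q) * u) • evalC u C := by
  have : Polynomial.C (algebraMap F D Q) * ((X - Polynomial.C (algebraMap F D u)) *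
      (Polynomial.C (evalC u A) * C)) =
      (X - Polynomial.C (algebraMap F D (Q * u))) * (C * Polynomial.C (evalC u A)) -
        Polynomial.C (algebraMap F D ((1 - Q) * u)) * (Polynomial.C (evalC u C) * A) :=
    eq_of_evalC_eq (F := F) _ _ fun v _ => by
      have := h.rel u v
      simp only [Algebra.smul_def] at this
      simpa [evalC_C, evalC_X, mul_assoc] using this
  have h1 := congrArg (fun p => coeff p (k + 1)) this
  have hA : A.coeff (k + 1) = 1 := by rw [← h.natDegree]; exact h.monic
  simp only [sub_mul, mul_sub, coeff_sub, coeff_C_mul, coeff_X_mul, coeff_mul_C, hA,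
    h.coeff_eq_zero _ le_rfl, mul_zero, zero_mul, sub_zero, mul_one, ← Algebra.smul_def] at h1
  linear_combination (norm := module) -h1

theorem coeff_top_ne_zero (hQ1 : Q ≠ 1) (h : TodaPair Q (k + 1) A C) : C.coeff k ≠ 0 := by
  intro h0
  refine h.C_ne_zero (eq_zero_of_evalC_eq_zero (F := F) _ fun u hu => ?_)
  have := h.rel_top u
  rw [h0, zero_mul, mul_zero, smul_zero, zero_add] at this
  exact (smul_eq_zero.mp this.symm).resolve_left (mul_ne_zero (sub_ne_zero.mpr (Ne.symm hQ1)) hu)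

theorem coeff_zero_ne_zero (hQ1 : Q ≠ 1) (h : TodaPair Q (k + 1) A C) : C.coeff 0 ≠ 0 := by
  intro h0
  refine h.C_ne_zero (eq_zero_of_evalC_eq_zero (F := F) _ fun u hu => ?_)
  have := h.rel u 0
  rw [evalC_zero, evalC_zero, h0, zero_mul, mul_zero, smul_zero, smul_zero, zero_sub,
    eq_comm, neg_eq_zero] at this
  have := (smul_eq_zero.mp this).resolve_left
    (mul_ne_zero (sub_ne_zero.mpr (Ne.symm hQ1)) hu)
  exact (mul_eq_zero.mp this).resolve_right h.ne_zero

theorem rel_top_coeff (h : TodaPair Q (k + 1) A C) (n : ℕ) :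
    C.coeff k * A.coeff (n + 1) =
      Q • (A.coeff (n + 1) * C.coeff k) + (1 - Q) • C.coeff n := by
  have : Polynomial.C (C.coeff k) * A = Polynomial.C (algebraMap F D Q) *
      (A * Polynomial.C (C.coeff k)) + Polynomial.C (algebraMap F D (1 - Q)) * (X * C) :=
    eq_of_evalC_eq (F := F) _ _ fun u _ => by
      have := h.rel_top u
      rw [mul_smul] at this
      simp only [Algebra.smul_def] at this
      simpa [evalC_C, evalC_X] using this
  simpa only [coeff_add, coeff_C_mul, coeff_X_mul, coeff_mul_C, ← Algebra.smul_def] using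
    congrArg (fun p => coeff p (n + 1)) this

/-- One step of the noncommutative Euclidean algorithm: a Toda pair of degree `k + 1` is a Toda
pair of degree `k` together with two elements which commute with it. -/
theorem exists_step (hQ : Q ≠ 0) (hQ1 : Q ≠ 1) (h : TodaPair Q (k + 1) A C) :
    ∃ A' C' : D[X], TodaPair Q k A' C' ∧
      (∀ n, C.coeff n = C.coeff k * A'.coeff n) ∧
      (∀ n, A.coeff (n + 1) = A'.coeff n + A.coeff 0 * (A'.coeff 0)⁻¹ * A'.coeff (n + 1) -
        C'.coeff n * A.coeff 0) ∧
      (∀ n, Commute (C.coeff k) (A'.coeff n)) ∧ (∀ n, Commute (C.coeff k) (C'.coeff n)) ∧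
      (∀ n, Commute (A.coeff 0) (A'.coeff n)) ∧ (∀ n, Commute (A.coeff 0) (C'.coeff n)) := by
  have hce := h.rel_zero k
  have hc0 := h.coeff_top_ne_zero hQ1
  have he0 := h.ne_zero
  have hC0 := h.coeff_zero_ne_zero hQ1
  have hrz := h.rel_zero
  have hrt := h.rel_top_coeff
  have hrte := h.rel_top
  have hcC : ∀ n, Commute (C.coeff k) (C.coeff n) := h.commC k
  have hA1 : A.coeff (k + 1) = 1 := by rw [← h.natDegree]; exact h.monic
  have heA := h.commA 0
  set c := C.coeff k with hc
  set e := A.coeff 0 with he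
  set P : D[X] := Polynomial.C c⁻¹ * C with hP
  have hPn : ∀ n, P.coeff n = c⁻¹ * C.coeff n := fun n => coeff_C_mul _
  clear_value P
  have hCn : ∀ n, C.coeff n = c * P.coeff n := fun n => by rw [hPn, mul_inv_cancel_left₀ hc0]
  have hcP : ∀ n, Commute c (P.coeff n) := fun n => by
    rw [hPn]; exact ((Commute.refl c).inv_right₀).mul_right (hcC n)
  have hPP : ∀ n m, Commute (P.coeff n) (P.coeff m) := fun n m => by
    rw [hPn n]; exact ((hcP m).inv_left₀).mul_left <| by
      rw [hPn]; exact ((hcC n).symm.inv_right₀).mul_right (h.commC n m)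
  -- Moving past `e` costs the same factor Q for `c` and for every coefficient of C, so the factor
  -- cancels in the quotients c⁻¹ Cₙ.
  have heP : ∀ n, Commute e (P.coeff n) := fun n => by
    apply mul_left_cancel₀ hc0
    calc c * (e * P.coeff n) = c * e * c⁻¹ * C.coeff n := by rw [hPn]; simp only [mul_assoc]
      _ = c * (P.coeff n * e) := by
        rw [hce, smul_mul_assoc, mul_inv_cancel_right₀ hc0, smul_mul_assoc, ← hrz n, hCn,
          mul_assoc]
  set p := P.coeff 0 with hp
  have hp0 : p ≠ 0 := by rw [hp, hPn]; exact mul_ne_zero (inv_ne_zero hc0) hC0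
  -- `t` makes the constant terms of (X + t) P and A agree, so that X divides the difference `G`;
  -- the quotient `Y` is the remainder of the division of A by P, up to the factor X.
  set t := e * p⁻¹ with ht
  have htP : ∀ n, Commute t (P.coeff n) := fun n =>
    (heP n).mul_left ((hPP 0 n).inv_left₀)
  have het : Commute e t := (Commute.refl e).mul_right (heP 0).inv_right₀
  clear_value t
  have hct : c * t = Q • (t * c) := by
    rw [ht, ← mul_assoc, hce, smul_mul_assoc, mul_assoc, ((hcP 0).inv_right₀).eq, mul_assoc]
  set G : D[X] := X * P + Polynomial.C t * P - A with hG
  set Y : D[X] := divX G with hY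
  have hYn : ∀ n, Y.coeff n = P.coeff n + t * P.coeff (n + 1) - A.coeff (n + 1) := fun n => by
    rw [hY, coeff_divX, hG, coeff_sub, coeff_add, coeff_X_mul, coeff_C_mul]
  have hXY : X * Y = G := by
    have h0 : G.coeff 0 = 0 := by
      rw [hG, coeff_sub, coeff_add, coeff_C_mul, mul_coeff_zero, coeff_X_zero, zero_mul,
        zero_add, ← hp, ht, inv_mul_cancel_right₀ hp0, sub_self]
    have := X_mul_divX_add G
    rwa [h0, map_zero, add_zero] at this
  have hAe : ∀ u : F, evalC u A = u • evalC u P + t * evalC u P - u • evalC u Y := fun u => by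
    have := congrArg (evalC u) hXY
    simp only [hG, map_mul, map_sub, map_add, evalC_X, evalC_C, ← Algebra.smul_def] at this
    rw [this]; abel
  have hCe : ∀ u : F, evalC u C = c * evalC u P := fun u => by
    rw [hP, map_mul, evalC_C, mul_inv_cancel_left₀ hc0]
  have hcY : ∀ n, c * Y.coeff n = Q • (Y.coeff n * c) := fun n => by
    have h1 := hrt n
    have h2 : c * (t * P.coeff (n + 1)) = Q • (t * P.coeff (n + 1) * c) := by
      rw [← mul_assoc, hct, smul_mul_assoc, mul_assoc, (hcP _).eq, mul_assoc]
    rw [hYn, mul_sub, mul_add, h1, h2, (hcP n).eq, hCn, (hcP n).eq, sub_mul, add_mul]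
    module
  have heY : ∀ n, Commute e (Y.coeff n) := fun n => by
    rw [hYn]; exact ((heP n).add_right (het.mul_right (heP _))).sub_right (heA _)
  have hPu : ∀ u v : F, evalC u P * evalC v P = evalC v P * evalC u P := fun u v =>
    (evalC_commute_of_coeff v P fun n => (evalC_commute_of_coeff u P fun m => hPP n m).symm)
  have htu : ∀ u : F, evalC u P * t = t * evalC u P := fun u =>
    (evalC_commute_of_coeff u P htP).eq.symm
  -- The pair (P, Y) inherits the Toda relation. Cancel `c` on the left of `rel'` and substitute A =
  -- (X + t) P - X Y: the terms without Y cancel because P and `t` commute, and a factor v is left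
  -- to be divided out. Comparing polynomials in v then recovers v = 0.
  have hrelY : ∀ u v : F, (Q * (v - u)) • (evalC u P * evalC v Y) =
      (v - Q * u) • (evalC v Y * evalC u P) - ((1 - Q) * u) • (evalC u Y * evalC v P) := by
    intro u
    have key : ∀ v : F, v ≠ 0 → (Q * (v - u)) • (evalC u P * evalC v Y) =
      (v - Q * u) • (evalC v Y * evalC u P) - ((1 - Q) * u) • (evalC u Y * evalC v P) := by
      intro v hv
      have hAc : ∀ u : F, Q • (evalC u A * c) =
          c * (evalC u A - ((1 - Q) * u) • evalC u P) := fun u => by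
        rw [mul_sub, hrte, mul_smul_comm, ← hCe]; abel
      have h1 := congrArg (Q • ·) (h.rel' hQ u v)
      have h2 : c * ((Q * (v - u)) • (evalC u P * evalC v A)) =
          c * ((v - Q * u) • ((evalC v A - ((1 - Q) * v) • evalC v P) * evalC u P) -
          ((1 - Q) * v) • ((evalC u A - ((1 - Q) * u) • evalC u P) * evalC v P)) := by
        simp only [hCe, smul_sub, smul_comm Q, ← mul_assoc] at h1
        rw [← smul_mul_assoc Q (evalC v A * c), ← smul_mul_assoc Q (evalC u A * c), hAc, hAc]
          at h1
        rw [mul_sub c, mul_smul_comm, mul_smul_comm, mul_smul_comm, ← mul_assoc, ← mul_assoc,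
          ← mul_assoc, ← h1, mul_smul, smul_comm]
      have h3 := mul_left_cancel₀ hc0 h2
      rw [hAe u, hAe v] at h3
      apply smul_right_injective D hv
      simp only [mul_add, mul_sub, add_mul, sub_mul, mul_smul_comm, smul_mul_assoc, mul_assoc]
        at h3 ⊢
      rw [← mul_assoc (evalC u P) t, htu u, mul_assoc, hPu u v] at h3
      linear_combination (norm := module) -h3
    intro v
    have : Polynomial.C (algebraMap F D Q) * ((X - Polynomial.C (algebraMap F D u)) *
      (Polynomial.C (evalC u P) * Y)) =
      (X - Polynomial.C (algebraMap F D (Q * u))) * (Y * Polynomial.C (evalC u P)) -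
        Polynomial.C (algebraMap F D ((1 - Q) * u)) * (Polynomial.C (evalC u Y) * P) :=
      eq_of_evalC_eq (F := F) _ _ fun v hv => by
        have := key v hv
        simp only [Algebra.smul_def] at this
        simpa [evalC_C, evalC_X, mul_assoc] using this
    have := congrArg (evalC v) this
    simp only [Algebra.smul_def]
    simpa [evalC_C, evalC_X, mul_assoc] using this
  have hYt : ∀ v : F, v ≠ 0 → evalC v Y * t = Q⁻¹ • (t * evalC v Y) := fun v hv => by
    have h1 := hrelY 0 v
    rw [evalC_zero, ← hp, sub_zero, mul_zero, mul_zero, zero_smul, sub_zero, sub_zero,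
      mul_comm, mul_smul] at h1
    have h2 := smul_right_injective D hv h1
    have h3 : Commute e (evalC v Y) := evalC_commute_of_coeff v Y heY
    have h4 : evalC v Y * p⁻¹ = Q⁻¹ • (p⁻¹ * evalC v Y) := by
      apply mul_left_cancel₀ hp0
      apply mul_right_cancel₀ hp0
      rw [mul_assoc, mul_assoc, inv_mul_cancel₀ hp0, mul_one, mul_smul_comm,
        mul_inv_cancel_left₀ hp0, smul_mul_assoc, ← h2, smul_smul, inv_mul_cancel₀ hQ, one_smul]
    rw [ht, ← mul_assoc, ← h3.eq, mul_assoc, h4, mul_smul_comm, mul_assoc]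
  -- In the expansion of A(u) A(v) = A(v) A(u), the mixed terms without `t` cancel by `d1` and those
  -- with `t` by `d2`, both consequences of `hrelY` at (u, v) and (v, u). What remains is u v times
  -- the commutator of Y(u) and Y(v).
  have hYY : ∀ u v : F, u ≠ 0 → v ≠ 0 →
      evalC u Y * evalC v Y = evalC v Y * evalC u Y := by
    intro u v hu hv
    by_cases huv : v = u
    · rw [huv]
    have hQuv : Q * (v - u) ≠ 0 := mul_ne_zero hQ (sub_ne_zero.mpr huv)
    have h1 := hrelY u v
    have h2 := hrelY v u
    have d1 : evalC u P * evalC v Y + evalC u Y * evalC v P =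
        evalC v P * evalC u Y + evalC v Y * evalC u P := by
      apply smul_right_injective D hQuv
      simp only
      linear_combination (norm := module) h1 + h2
    have d2 : v • (evalC u P * evalC v Y) + (u * Q⁻¹) • (evalC u Y * evalC v P) =
        u • (evalC v P * evalC u Y) + (v * Q⁻¹) • (evalC v Y * evalC u P) := by
      apply smul_right_injective D hQuv
      simp only [smul_add, smul_smul]
      rw [show Q * (v - u) * (u * Q⁻¹) = (v - u) * u by field_simp,
        show Q * (v - u) * (v * Q⁻¹) = (v - u) * v by field_simp]
      linear_combination (norm := module) v • h1 + u • h2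
    have d3 : t * (v • (evalC u P * evalC v Y) + (u * Q⁻¹) • (evalC u Y * evalC v P)) =
        t * (u • (evalC v P * evalC u Y) + (v * Q⁻¹) • (evalC v Y * evalC u P)) := by rw [d2]
    have hA : evalC u A * evalC v A = evalC v A * evalC u A :=
      (evalC_commute_of_coeff v A fun n =>
        (evalC_commute_of_coeff u A fun m => h.commA n m).symm)
    rw [hAe, hAe] at hA
    simp only [mul_add, mul_sub, add_mul, sub_mul, mul_smul_comm, smul_mul_assoc, mul_assoc]
      at hA d3
    rw [← mul_assoc (evalC u P) t, ← mul_assoc (evalC v P) t, ← mul_assoc (evalC u Y) t,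
      ← mul_assoc (evalC v Y) t, htu u, htu v, hYt u hu, hYt v hv, hPu u v] at hA
    simp only [smul_mul_assoc, mul_assoc, hPu u v] at hA
    apply smul_right_injective D (mul_ne_zero hu hv)
    simp only
    linear_combination (norm := module) hA + (u * v) • d1 + d3
  have hYcomm := coeff_commute_of_evalC (F := F) Y Y hYY
  have hPk : P.coeff k = 1 := by rw [hPn, ← hc, inv_mul_cancel₀ hc0]
  have hPz : ∀ n, k < n → P.coeff n = 0 := fun n hn => by
    rw [hPn, h.coeff_eq_zero n hn, mul_zero]
  have hPdeg : P.natDegree = k :=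
    natDegree_eq_of_le_of_coeff_ne_zero (natDegree_le_iff_coeff_eq_zero.mpr hPz)
      (by rw [hPk]; exact one_ne_zero)
  have hYe : ∀ n, (Y * Polynomial.C e⁻¹).coeff n = Y.coeff n * e⁻¹ := fun n => coeff_mul_C _ _ _
  -- Y itself Q-commutes with `c`; the factor e⁻¹ compensates this and does not disturb the other
  -- relations, as `e` commutes with P and Y.
  refine ⟨P, Y * Polynomial.C e⁻¹, ⟨?_, hPdeg, ?_, hPP, ?_, ?_, hp0, ?_⟩, hCn, ?_, hcP, ?_, heP,
    ?_⟩
  · rw [Monic, leadingCoeff, hPdeg, hPk]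
  · intro n hn
    rw [hYe, hYn, hPz (n + 1) (by omega)]
    rcases hn.eq_or_lt with rfl | hn'
    · rw [hPk, hA1]; simp
    · rw [hPz n hn', coeff_eq_zero_of_natDegree_lt (by rw [h.natDegree]; omega)]; simp
  · intro n m
    rw [hYe, hYe]
    exact Commute.mul_left ((hYcomm n m).mul_right (heY n).symm.inv_right₀)
      ((heY m).inv_left₀.mul_right (Commute.refl _))
  · intro u v
    have heu : ∀ u : F, e⁻¹ * evalC u P = evalC u P * e⁻¹ := fun u =>
      (evalC_commute_of_coeff u P heP).inv_left₀.eq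
    have := congrArg (· * e⁻¹) (hrelY u v)
    simp only [sub_mul, smul_mul_assoc, mul_assoc] at this
    simp only [map_mul, evalC_C, mul_assoc, heu]
    linear_combination (norm := module) this
  · obtain ⟨S, T, hST⟩ := h.coprime
    have hAp : A = X * P + Polynomial.C t * P - X * Y := by rw [hXY, hG]; abel
    have hCp : C = Polynomial.C c * P := by
      rw [hP, ← mul_assoc, ← Polynomial.C_mul, mul_inv_cancel₀ hc0, Polynomial.C_1, one_mul]
    have hPe : P * Polynomial.C e⁻¹ = Polynomial.C e⁻¹ * P := by
      ext n; rw [coeff_mul_C, coeff_C_mul]; exact (heP n).inv_left₀.eq.symm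
    refine ⟨Polynomial.C e * (S * (X + Polynomial.C t) + T * Polynomial.C c) *
      Polynomial.C e⁻¹, -(Polynomial.C e * S * X), ?_⟩
    have h1 : (S * (X + Polynomial.C t) + T * Polynomial.C c) * P - S * X * Y = 1 := by
      rw [← hST, hCp, hAp]; noncomm_ring
    calc _ = Polynomial.C e * ((S * (X + Polynomial.C t) + T * Polynomial.C c) * P -
          S * X * Y) * Polynomial.C e⁻¹ := by
          simp only [mul_assoc, ← hPe, mul_sub, sub_mul, neg_mul]; abel
      _ = 1 := by rw [h1, mul_one, ← Polynomial.C_mul, mul_inv_cancel₀ he0, Polynomial.C_1]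
  · intro n
    rw [hYe, inv_mul_cancel_right₀ he0, hYn, ← ht]; abel
  · intro n
    rw [hYe]
    have : c * e⁻¹ = Q⁻¹ • (e⁻¹ * c) := by
      apply mul_left_cancel₀ he0
      apply mul_right_cancel₀ he0
      rw [mul_assoc, mul_assoc, inv_mul_cancel₀ he0, mul_one, mul_smul_comm,
        mul_inv_cancel_left₀ he0, smul_mul_assoc, hce, smul_smul, inv_mul_cancel₀ hQ, one_smul]
    rw [Commute, SemiconjBy, ← mul_assoc, hcY, smul_mul_assoc, mul_assoc, this, mul_smul_comm,
      smul_smul, mul_inv_cancel₀ hQ, one_smul, mul_assoc]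
  · intro n
    rw [hYe]; exact (heY n).mul_right (Commute.refl e).inv_right₀

/-- The coefficients of a Toda pair of degree `r` generate the same division ring as `r` pairs of
`Q`-commuting elements. -/
theorem exists_generators (hQ : Q ≠ 0) (hQ1 : Q ≠ 1) : ∀ (r : ℕ) (A C : D[X]), TodaPair Q r A C →
    ∃ c e : Fin r → D, (∀ i, c i ≠ 0) ∧ (∀ i, e i ≠ 0) ∧ (∀ i j, Commute (c i) (c j)) ∧
      (∀ i j, Commute (e i) (e j)) ∧ (∀ i j, i ≠ j → Commute (c i) (e j)) ∧
      (∀ i, c i * e i = Q • (e i * c i)) ∧ (∀ i : Fin r, (i : ℕ) = 0 → e i = A.coeff 0) ∧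
      (∀ E : Subfield D, ((∀ n, A.coeff n ∈ E) ∧ ∀ n, C.coeff n ∈ E) ↔
        (∀ i, c i ∈ E) ∧ ∀ i, e i ∈ E) ∧
      ∀ (t : D) (l : F), l ≠ 0 → (∀ n, Commute t (A.coeff n)) →
        (∀ n, t * C.coeff n = l • (C.coeff n * t)) →
        (∀ i, Commute t (e i)) ∧ (∀ i : Fin r, (i : ℕ) ≠ 0 → Commute t (c i)) ∧
          ∀ i : Fin r, (i : ℕ) = 0 → t * c i = l • (c i * t)
  | 0, A, C, h => by
    have hA : A = 1 := eq_one_of_monic_natDegree_zero h.monic h.natDegree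
    have hC : C = 0 := by ext n; exact h.coeff_eq_zero n (Nat.zero_le n)
    refine ⟨Fin.elim0, Fin.elim0, fun i => i.elim0, fun i => i.elim0, fun i => i.elim0,
      fun i => i.elim0, fun i => i.elim0, fun i => i.elim0, fun i => i.elim0, fun E => ?_,
      fun t l _ _ _ => ⟨fun i => i.elim0, fun i => i.elim0, fun i => i.elim0⟩⟩
    refine ⟨fun _ => ⟨fun i => i.elim0, fun i => i.elim0⟩, fun _ => ⟨fun n => ?_, fun n => ?_⟩⟩
    · rw [hA, coeff_one]; split_ifs
      exacts [one_mem E, zero_mem E]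
    · rw [hC, coeff_zero]; exact zero_mem E
  | k + 1, A, C, h => by
    obtain ⟨A', C', h', hC, hA, hcA, hcC, heA, heC⟩ := h.exists_step hQ hQ1
    obtain ⟨c, e, hc0, he0, hcc, hee, hce, hceQ, -, hE, ht⟩ :=
      exists_generators hQ hQ1 k A' C' h'
    have hck := h.coeff_top_ne_zero hQ1
    have hek := h.ne_zero
    have hCe := h.rel_zero k
    set c₀ := C.coeff k
    set e₀ := A.coeff 0
    have hA' : ∀ n, A'.coeff n = c₀⁻¹ * C.coeff n := fun n => by
      rw [hC, inv_mul_cancel_left₀ hck]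
    have hC' : ∀ n, C'.coeff n = (A'.coeff n + e₀ * (A'.coeff 0)⁻¹ * A'.coeff (n + 1) -
        A.coeff (n + 1)) * e₀⁻¹ := fun n => by
      rw [hA, sub_sub_cancel, mul_inv_cancel_right₀ hek]
    -- The last clause of the induction hypothesis with l = 1: `c₀`, and then `e₀`, commute with the
    -- shorter pair and hence with all its generators.
    obtain ⟨h1, h2, h3⟩ := ht c₀ 1 one_ne_zero hcA fun n => by rw [one_smul]; exact hcC n
    obtain ⟨h4, h5, h6⟩ := ht e₀ 1 one_ne_zero heA fun n => by rw [one_smul]; exact heC n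
    have h23 : ∀ i, Commute c₀ (c i) := fun i => by
      by_cases hi : (i : ℕ) = 0
      · have := h3 i hi; rwa [one_smul] at this
      · exact h2 i hi
    have h56 : ∀ i, Commute e₀ (c i) := fun i => by
      by_cases hi : (i : ℕ) = 0
      · have := h6 i hi; rwa [one_smul] at this
      · exact h5 i hi
    refine ⟨Fin.cons c₀ c, Fin.cons e₀ e, ?_, ?_, ?_, ?_, ?_, ?_, ?_, ?_, ?_⟩
    · exact Fin.cases hck hc0
    · exact Fin.cases hek he0
    · refine Fin.cases (Fin.cases (Commute.refl _) h23) fun i => Fin.cases (h23 i).symm (hcc i)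
    · refine Fin.cases (Fin.cases (Commute.refl _) h4) fun i => Fin.cases (h4 i).symm (hee i)
    · refine Fin.cases (Fin.cases (fun h => absurd rfl h) fun j _ => h1 j) fun i =>
        Fin.cases (fun _ => (h56 i).symm) fun j hij => hce i j fun h => hij (by rw [h])
    · exact Fin.cases hCe hceQ
    · refine Fin.cases (fun _ => rfl) fun i hi => absurd hi (by simp)
    · intro E
      constructor
      · rintro ⟨hAE, hCE⟩
        have hA'E : ∀ n, A'.coeff n ∈ E := fun n => by
          rw [hA']; exact mul_mem (inv_mem (hCE k)) (hCE n)
        have hC'E : ∀ n, C'.coeff n ∈ E := fun n => by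
          rw [hC']
          exact mul_mem (sub_mem (add_mem (hA'E n) (mul_mem (mul_mem (hAE 0) (inv_mem (hA'E 0)))
            (hA'E _))) (hAE _)) (inv_mem (hAE 0))
        obtain ⟨h7, h8⟩ := (hE E).mp ⟨hA'E, hC'E⟩
        exact ⟨Fin.cases (hCE k) h7, Fin.cases (hAE 0) h8⟩
      · rintro ⟨hcE, heE⟩
        obtain ⟨hA'E, hC'E⟩ := (hE E).mpr ⟨fun i => hcE i.succ, fun i => heE i.succ⟩
        have hc0E : c₀ ∈ E := hcE 0
        have he0E : e₀ ∈ E := heE 0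
        refine ⟨fun n => ?_, fun n => by rw [hC]; exact mul_mem hc0E (hA'E n)⟩
        cases n with
        | zero => exact he0E
        | succ n =>
          rw [hA]
          exact sub_mem (add_mem (hA'E n) (mul_mem (mul_mem he0E (inv_mem (hA'E 0))) (hA'E _)))
            (mul_mem (hC'E n) he0E)
    -- An element scaling every coefficient of C by `l` scales `c₀` by `l`, hence commutes with the
    -- quotients forming A' and with C'. Only the first generator notices it.
    · intro t l hl htA htC
      have htA' : ∀ n, Commute t (A'.coeff n) := fun n => by
        apply mul_left_cancel₀ hck
        have h7 : c₀ * t = l⁻¹ • (t * c₀) := by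
          rw [htC k, smul_smul, inv_mul_cancel₀ hl, one_smul]
        rw [← mul_assoc, h7, hA', smul_mul_assoc, mul_assoc, mul_inv_cancel_left₀ hck, htC n,
          smul_smul, inv_mul_cancel₀ hl, one_smul, mul_assoc, mul_inv_cancel_left₀ hck]
      have htC' : ∀ n, Commute t (C'.coeff n) := fun n => by
        rw [hC']
        exact (((htA' n).add_right (((htA 0).mul_right (htA' 0).inv_right₀).mul_right
          (htA' _))).sub_right (htA _)).mul_right (htA 0).inv_right₀
      obtain ⟨h7, h8, h9⟩ := ht t 1 one_ne_zero htA' fun n => by rw [one_smul]; exact htC' n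
      refine ⟨Fin.cases (htA 0) h7, Fin.cases (fun h => absurd rfl h) fun i _ => ?_,
        Fin.cases (fun _ => htC k) fun i hi => absurd hi (by simp)⟩
      by_cases hi : (i : ℕ) = 0
      · have := h9 i hi; rwa [one_smul] at this
      · exact h8 i hi

end TodaPair
end Toda
end
end QuantumOGZ

namespace QuantumOGZ
open Polynomial

noncomputable section

/-! ### Toda pairs from Lagrange interpolation at twisted nodes. -/

section TodaNodes

variable {F L D I : Type*} [Field F] [Field L] [Algebra F L] [DivisionRing D] [Algebra F D]
  [Fintype I] [DecidableEq I]

theorem evalC_map (j : L →ₐ[F] D) (u : F) (f : L[X]) :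
    evalC u (f.map (j : L →+* D)) = j (f.eval (algebraMap F L u)) := by
  induction f using Polynomial.induction_on' with
  | add p q hp hq => rw [Polynomial.map_add, map_add, hp, hq, eval_add, map_add]
  | monomial n a =>
    rw [map_monomial, ← C_mul_X_pow_eq_monomial, map_mul, map_pow, evalC_C, evalC_X, eval_monomial,
      map_mul, map_pow, AlgHom.commutes]; rfl

theorem nodal_dvd_of_eval_eq_zero {z : I → L} (hz : Function.Injective z) (f : L[X])
    (h : ∀ i, f.eval (z i) = 0) : Lagrange.nodal Finset.univ z ∣ f :=
  Finset.prod_dvd_of_coprime (fun _ _ _ _ hij => pairwise_coprime_X_sub_C hz hij)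
    fun i _ => dvd_iff_isRoot.mpr (h i)

/-- The polynomial `∑ i, d i * ℓ_i` over `D`, where `ℓ_i` are the Lagrange basis polynomials at the
nodes `z i`. -/
def twistedInterpolant (j : L →ₐ[F] D) (z : I → L) (d : I → D) : D[X] :=
  ∑ i, C (d i) * (Lagrange.basis Finset.univ z i).map (j : L →+* D)

theorem evalC_twistedInterpolant (j : L →ₐ[F] D) (z : I → L) (d : I → D) (u : F) :
    evalC u (twistedInterpolant j z d) =
      ∑ i, d i * j ((Lagrange.basis Finset.univ z i).eval (algebraMap F L u)) := by
  simp only [twistedInterpolant, map_sum, map_mul, evalC_C, evalC_map]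

theorem coeff_twistedInterpolant (j : L →ₐ[F] D) (z : I → L) (d : I → D) (n : ℕ) :
    (twistedInterpolant j z d).coeff n =
      ∑ i, d i * j ((Lagrange.basis Finset.univ z i).coeff n) := by
  simp [twistedInterpolant, finsetSum_coeff]

theorem coeff_twistedInterpolant_eq_zero (j : L →ₐ[F] D) {z : I → L}
    (hz : Function.Injective z) (d : I → D) (n : ℕ) (hn : Fintype.card I ≤ n) :
    (twistedInterpolant j z d).coeff n = 0 := by
  rw [coeff_twistedInterpolant]
  refine Finset.sum_eq_zero fun i _ => ?_
  rw [coeff_eq_zero_of_degree_lt, map_zero, mul_zero]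
  rw [Lagrange.degree_basis hz.injOn (Finset.mem_univ i), Finset.card_univ]
  have : 0 < Fintype.card I := Fintype.card_pos_iff.mpr ⟨i⟩
  exact_mod_cast (by omega : Fintype.card I - 1 < n)

/-- Right evaluation of the twisted interpolant at a node. -/
theorem sum_coeff_twistedInterpolant (j : L →ₐ[F] D) {z : I → L} (hz : Function.Injective z)
    (d : I → D) (k : I) :
    ∑ n ∈ Finset.range (Fintype.card I), (twistedInterpolant j z d).coeff n * j (z k ^ n) =
      d k := by
  simp only [coeff_twistedInterpolant, Finset.sum_mul]
  rw [Finset.sum_comm]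
  have h : ∀ i, ∑ n ∈ Finset.range (Fintype.card I),
      d i * j ((Lagrange.basis Finset.univ z i).coeff n) * j (z k ^ n) =
      d i * j ((Lagrange.basis Finset.univ z i).eval (z k)) := fun i => by
    have hc : 0 < Fintype.card I := Fintype.card_pos_iff.mpr ⟨i⟩
    rw [eval_eq_sum_range' (n := Fintype.card I), map_sum, Finset.mul_sum]
    · simp only [map_mul, mul_assoc]
    · rw [natDegree_lt_iff_degree_lt (Lagrange.basis_ne_zero hz.injOn (Finset.mem_univ i)),
        Lagrange.degree_basis hz.injOn (Finset.mem_univ i), Finset.card_univ]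
      exact_mod_cast (by omega : Fintype.card I - 1 < Fintype.card I)
  rw [Finset.sum_congr rfl fun i _ => h i, Finset.sum_eq_single k]
  · rw [Lagrange.eval_basis_self hz.injOn (Finset.mem_univ k), map_one, mul_one]
  · intro i _ hi
    rw [Lagrange.eval_basis_of_ne hi (Finset.mem_univ k), map_zero, mul_zero]
  · simp

theorem eval_basis_eq_div (z : I → L) (i : I) (x : L) :
    (Lagrange.basis Finset.univ z i).eval x =
      (∏ k ∈ Finset.univ.erase i, (x - z k)) / ∏ k ∈ Finset.univ.erase i, (z i - z k) := by
  rw [Lagrange.basis, eval_prod, ← Finset.prod_div_distrib]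
  refine Finset.prod_congr rfl fun k _ => ?_
  simp [Lagrange.basisDivisor, div_eq_inv_mul]

variable {Q : F} {j : L →ₐ[F] D} {z : I → L} {d : I → D} {τ : I → L ≃ₐ[F] L}

theorem prod_map_eq_self (hτ' : ∀ i k, i ≠ k → τ i (z k) = z k) {i : I} {s : Finset I}
    (hi : i ∉ s) {x : L} (hx : τ i x = x) :
    τ i (∏ k ∈ s, (x - z k)) = ∏ k ∈ s, (x - z k) := by
  rw [map_prod]
  refine Finset.prod_congr rfl fun k hk => ?_
  rw [map_sub, hx, hτ' i k fun h => hi (h ▸ hk)]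

/-- The relation holds summand by summand. With dᵢ moved to the left and common factors removed it
reads Q(v - u)(u - Q⁻¹z) = (v - Qu)(u - z) - (1 - Q)u(v - z). -/
theorem todaRel_of_nodes (hQ : Q ≠ 0) (hd : ∀ i f, j f * d i = d i * j (τ i f))
    (hτ : ∀ i, τ i (z i) = Q⁻¹ • z i) (hτ' : ∀ i k, i ≠ k → τ i (z k) = z k) (u v : F) :
    (Q * (v - u)) • (evalC u ((Lagrange.nodal Finset.univ z).map (j : L →+* D)) *
        evalC v (twistedInterpolant j z d)) =
      (v - Q * u) • (evalC v (twistedInterpolant j z d) *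
        evalC u ((Lagrange.nodal Finset.univ z).map (j : L →+* D))) -
      ((1 - Q) * u) • (evalC u (twistedInterpolant j z d) *
        evalC v ((Lagrange.nodal Finset.univ z).map (j : L →+* D))) := by
  simp only [evalC_twistedInterpolant, evalC_map, Finset.sum_mul, Finset.mul_sum,
    Finset.smul_sum, ← Finset.sum_sub_distrib]
  refine Finset.sum_congr rfl fun i _ => ?_
  rw [← mul_assoc, hd, mul_assoc, mul_assoc, mul_assoc, ← map_mul, ← map_mul, ← map_mul,
    ← mul_smul_comm, ← mul_smul_comm, ← mul_smul_comm, ← map_smul, ← map_smul, ← map_smul,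
    ← mul_sub, ← map_sub]
  congr 2
  simp only [Lagrange.eval_nodal, eval_basis_eq_div,
    ← Finset.mul_prod_erase Finset.univ _ (Finset.mem_univ i)]
  rw [map_mul, map_sub, hτ, AlgEquiv.commutes,
    prod_map_eq_self hτ' (Finset.notMem_erase i _) (AlgEquiv.commutes _ _)]
  have hQ' : algebraMap F L Q ≠ 0 := by simpa using hQ
  simp only [Algebra.smul_def, map_mul, map_sub, map_inv₀, map_one]
  field_simp
  ring

/-- In the double sum for C(u) C(v), the coefficient of dᵢ dₖ becomes symmetric in u and v only
after adding the term with i and k exchanged, which is possible as the dᵢ commute; hence the factor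
2. The symmetry is the rational identity `key`. -/
theorem commute_twistedInterpolant [NeZero (2 : D)] (hz : Function.Injective z)
    (hd : ∀ i f, j f * d i = d i * j (τ i f)) (hdd : ∀ i k, Commute (d i) (d k))
    (hτ : ∀ i, τ i (z i) = Q⁻¹ • z i) (hτ' : ∀ i k, i ≠ k → τ i (z k) = z k) (u v : F) :
    evalC u (twistedInterpolant j z d) * evalC v (twistedInterpolant j z d) =
      evalC v (twistedInterpolant j z d) * evalC u (twistedInterpolant j z d) := by
  set l : I → F → L := fun i u => (Lagrange.basis Finset.univ z i).eval (algebraMap F L u) with hl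
  have key : ∀ i k (u v : F), τ k (l i u) * l k v + τ i (l k u) * l i v =
      τ k (l i v) * l k u + τ i (l k v) * l i u := by
    intro i k u v
    by_cases hik : i = k
    · subst hik
      simp only [hl, eval_basis_eq_div, map_div₀,
        prod_map_eq_self hτ' (Finset.notMem_erase i _) (AlgEquiv.commutes _ _)]
      ring
    · have hne : z i - z k ≠ 0 := sub_ne_zero.mpr fun h => hik (hz h)
      have hne' : z k - z i ≠ 0 := sub_ne_zero.mpr fun h => hik (hz h).symm
      have hk : k ∈ Finset.univ.erase i := by simp [Ne.symm hik]
      have hi : i ∈ Finset.univ.erase k := by simp [hik]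
      have h1 : z i - Q⁻¹ • z k ≠ 0 := by
        rw [← hτ k, ← hτ' k i (Ne.symm hik), ← map_sub]
        exact (map_ne_zero_iff _ (τ k).injective).mpr hne
      have h2 : z k - Q⁻¹ • z i ≠ 0 := by
        rw [← hτ i, ← hτ' i k hik, ← map_sub]
        exact (map_ne_zero_iff _ (τ i).injective).mpr hne'
      have hs : (Finset.univ.erase k).erase i = (Finset.univ.erase i).erase k :=
        Finset.erase_right_comm
      have hR : ∀ i k, ∏ l ∈ (Finset.univ.erase i).erase k, (z i - z l) ≠ 0 := fun i k =>
        Finset.prod_ne_zero_iff.mpr fun l hl => sub_ne_zero.mpr fun h => by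
          simp [hz h] at hl
      have hRi := hR i k
      have hRk := hR k i
      have ni : i ∉ (Finset.univ.erase i).erase k := by simp
      have nk : k ∉ (Finset.univ.erase i).erase k := by simp
      simp only [hl, eval_basis_eq_div, ← Finset.mul_prod_erase _ _ hk,
        ← Finset.mul_prod_erase _ _ hi, map_div₀, map_mul, map_sub, AlgEquiv.commutes, hτ,
        hτ' k i (Ne.symm hik), hτ' i k hik, hs,
        prod_map_eq_self hτ' ni (AlgEquiv.commutes _ _),
        prod_map_eq_self hτ' nk (AlgEquiv.commutes _ _),
        prod_map_eq_self hτ' nk (hτ' k i (Ne.symm hik)),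
        prod_map_eq_self hτ' ni (hτ' i k hik)] at hRi hRk ⊢
      generalize Q⁻¹ • z k = a at *
      generalize Q⁻¹ • z i = b at *
      have hRi' := hRi
      have hRk' := hRk
      generalize ∏ l ∈ (Finset.univ.erase i).erase k, (z i - z l) = Ri at *
      generalize ∏ l ∈ (Finset.univ.erase i).erase k, (z k - z l) = Rk at *
      generalize ∏ l ∈ (Finset.univ.erase i).erase k, (algebraMap F L u - z l) = Mu
      generalize ∏ l ∈ (Finset.univ.erase i).erase k, (algebraMap F L v - z l) = Mv
      generalize algebraMap F L u = U
      generalize algebraMap F L v = V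
      clear hRi' hRk' hR hs hi hk hik
      rw [← neg_sub (z i) (z k)]
      field_simp
      ring
  have hS : ∀ u v : F, (2 : D) * (evalC u (twistedInterpolant j z d) *
      evalC v (twistedInterpolant j z d)) =
      ∑ i, ∑ k, d i * d k * j (τ k (l i u) * l k v + τ i (l k u) * l i v) := by
    intro u v
    have h1 : evalC u (twistedInterpolant j z d) * evalC v (twistedInterpolant j z d) =
        ∑ i, ∑ k, d i * d k * j (τ k (l i u) * l k v) := by
      simp only [evalC_twistedInterpolant, Finset.sum_mul, Finset.mul_sum]
      rw [Finset.sum_comm]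
      refine Finset.sum_congr rfl fun i _ => Finset.sum_congr rfl fun k _ => ?_
      rw [mul_assoc, ← mul_assoc (j _), hd, map_mul]
      simp only [mul_assoc, hl]
    have h2 : evalC u (twistedInterpolant j z d) * evalC v (twistedInterpolant j z d) =
        ∑ i, ∑ k, d i * d k * j (τ i (l k u) * l i v) := by
      rw [h1, Finset.sum_comm]
      refine Finset.sum_congr rfl fun i _ => Finset.sum_congr rfl fun k _ => ?_
      rw [(hdd k i).eq]
    rw [two_mul]
    nth_rewrite 1 [h1]
    rw [h2]
    simp only [← Finset.sum_add_distrib, ← mul_add, ← map_add]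
  apply mul_left_cancel₀ (NeZero.ne (2 : D))
  rw [hS, hS]
  refine Finset.sum_congr rfl fun i _ => Finset.sum_congr rfl fun k _ => ?_
  rw [key]

/-- In the left ideal `J` generated by the pair, a suitable multiple of the interpolant isolates
each single Lagrange summand modulo the nodal polynomial; a combination of these is congruent to 1.
-/
theorem exists_coprime_of_nodes (hz : Function.Injective z) (hQ : Q ≠ 0) (hd0 : ∀ i, d i ≠ 0)
    (hd : ∀ i f, j f * d i = d i * j (τ i f))
    (hτ : ∀ i, τ i (z i) = Q⁻¹ • z i) (hτ' : ∀ i k, i ≠ k → τ i (z k) = z k) :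
    ∃ S T : D[X], S * (Lagrange.nodal Finset.univ z).map (j : L →+* D) +
      T * twistedInterpolant j z d = 1 := by
  set N := Lagrange.nodal Finset.univ z with hN
  set l := Lagrange.basis Finset.univ z with hl
  set J : Submodule D[X] D[X] :=
    Submodule.span D[X] {N.map (j : L →+* D), twistedInterpolant j z d} with hJ
  suffices h : (1 : D[X]) ∈ J by
    obtain ⟨a, b, hab⟩ := Submodule.mem_span_pair.mp h
    exact ⟨a, b, hab⟩
  have hNJ : ∀ g : L[X], N ∣ g → g.map (j : L →+* D) ∈ J := by
    rintro g ⟨w, rfl⟩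
    rw [mul_comm, Polynomial.map_mul]
    exact J.smul_mem _ (Submodule.subset_span (by simp))
  -- Moving `t i` past d k turns its factor X - Q zₖ into X - zₖ, so for k ≠ i the product with ℓₖ
  -- vanishes at every node. Moving it past d i changes nothing.
  set t : I → L[X] := fun i => ∏ k ∈ Finset.univ.erase i, (X - C (Q • z k)) with ht
  have hτt : ∀ i k, (t i).map (τ k : L →+* L) =
      ∏ k' ∈ Finset.univ.erase i, (X - C (Q • τ k (z k'))) := fun i k => by
    simp [ht, Polynomial.map_prod]
  have hdC : ∀ i (f : L[X]), f.map (j : L →+* D) * C (d i) =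
      C (d i) * (f.map (τ i : L →+* L)).map (j : L →+* D) := fun i f => by
    ext n
    simp only [coeff_mul_C, coeff_C_mul, coeff_map]
    exact hd i _
  have htC : ∀ i, (t i).map (j : L →+* D) * twistedInterpolant j z d ∈ J := fun i =>
    J.smul_mem _ (Submodule.subset_span (by simp))
  have htl : ∀ i, (t i * l i).map (j : L →+* D) ∈ J := by
    intro i
    have h1 := htC i
    rw [twistedInterpolant, Finset.mul_sum, ← Finset.add_sum_erase _ _ (Finset.mem_univ i)] at h1
    have h2 : ∑ k ∈ Finset.univ.erase i, (t i).map (j : L →+* D) *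
        (C (d k) * (l k).map (j : L →+* D)) ∈ J := by
      refine Submodule.sum_mem _ fun k hk => ?_
      rw [← mul_assoc, hdC, mul_assoc, ← Polynomial.map_mul]
      refine J.smul_mem _ (hNJ _ (nodal_dvd_of_eval_eq_zero hz _ fun m => ?_))
      rw [eval_mul]
      by_cases hmk : k = m
      · subst hmk
        rw [hτt, eval_prod, Finset.prod_eq_zero hk, zero_mul]
        rw [hτ, smul_smul, mul_inv_cancel₀ hQ, one_smul]; simp
      · rw [hl, Lagrange.eval_basis_of_ne hmk (Finset.mem_univ m), mul_zero]
    have h3 := (J.add_mem_iff_left h2).mp h1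
    have h4 : (t i).map (τ i : L →+* L) = t i := by
      rw [hτt]
      refine Finset.prod_congr rfl fun k hk => ?_
      rw [hτ' i k (Finset.ne_of_mem_erase hk).symm]
    rw [← mul_assoc, hdC, h4, mul_assoc, ← Polynomial.map_mul] at h3
    have h5 := J.smul_mem (C (d i)⁻¹) h3
    rwa [smul_eq_mul, ← mul_assoc, ← C_mul, inv_mul_cancel₀ (hd0 i), C_1, one_mul] at h5
  -- If zᵢ = Q zₖ, applying τₖ would give zᵢ = zₖ.
  have ht0 : ∀ i, (t i).eval (z i) ≠ 0 := fun i => by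
    rw [eval_prod]
    refine Finset.prod_ne_zero_iff.mpr fun k hk h0 => ?_
    rw [eval_sub, eval_X, eval_C, sub_eq_zero] at h0
    have h1 := congrArg (τ k) h0
    rw [map_smul, hτ, smul_smul, mul_inv_cancel₀ hQ, one_smul,
      hτ' k i (Finset.ne_of_mem_erase hk)] at h1
    exact Finset.ne_of_mem_erase hk (hz h1).symm
  set g : L[X] := ∑ i, C ((t i).eval (z i))⁻¹ * (t i * l i) with hg
  have hgJ : g.map (j : L →+* D) ∈ J := by
    rw [hg, Polynomial.map_sum]
    refine Submodule.sum_mem _ fun i _ => ?_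
    rw [Polynomial.map_mul]
    exact J.smul_mem _ (htl i)
  have hg1 : N ∣ g - 1 := by
    refine nodal_dvd_of_eval_eq_zero hz _ fun m => ?_
    rw [eval_sub, eval_one, hg, eval_finsetSum, Finset.sum_eq_single m, sub_eq_zero]
    · rw [eval_mul, eval_mul, eval_C, hl, Lagrange.eval_basis_self hz.injOn (Finset.mem_univ m),
        mul_one, inv_mul_cancel₀ (ht0 m)]
    · intro i _ him
      rw [eval_mul, eval_mul, hl, Lagrange.eval_basis_of_ne him (Finset.mem_univ m), mul_zero,
        mul_zero]
    · simp
  have := J.sub_mem hgJ (hNJ _ hg1)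
  rwa [Polynomial.map_sub, sub_sub_cancel, Polynomial.map_one] at this

/-- Distinct nodes and twisted commuting elements give a Toda pair. -/
theorem todaPair_of_nodes [CharZero F] (hz : Function.Injective z) (hz0 : ∀ i, z i ≠ 0)
    (hQ : Q ≠ 0) (hd0 : ∀ i, d i ≠ 0) (hd : ∀ i f, j f * d i = d i * j (τ i f))
    (hdd : ∀ i k, Commute (d i) (d k))
    (hτ : ∀ i, τ i (z i) = Q⁻¹ • z i) (hτ' : ∀ i k, i ≠ k → τ i (z k) = z k) :
    TodaPair Q (Fintype.card I) ((Lagrange.nodal Finset.univ z).map (j : L →+* D))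
      (twistedInterpolant j z d) where
  monic := (Lagrange.nodal_monic).map _
  natDegree := by
    rw [Lagrange.nodal_monic.natDegree_map, Lagrange.natDegree_nodal, Finset.card_univ]
  coeff_eq_zero := coeff_twistedInterpolant_eq_zero j hz d
  commA n m := by
    rw [coeff_map, coeff_map]; exact (Commute.all _ _).map _
  commC := coeff_commute_of_evalC (F := F) _ _ fun u v _ _ => by
    have : CharZero D := charZero_of_injective_algebraMap (algebraMap F D).injective
    exact commute_twistedInterpolant hz hd hdd hτ hτ' u v
  rel := todaRel_of_nodes hQ hd hτ hτ'
  ne_zero := by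
    rw [coeff_map, coeff_zero_eq_eval_zero, Lagrange.eval_nodal]
    simpa [Finset.prod_eq_zero_iff] using hz0
  coprime := exists_coprime_of_nodes hz hQ hd0 hd hτ hτ'

end TodaNodes
end
end QuantumOGZ

namespace QuantumOGZ

noncomputable section

/-! ### The Ore condition from subexponential growth. -/

section Growth

/-- The product of the word `w` in the letters `a` and `b`. -/
def wordProd {R : Type*} [Monoid R] (a b : R) : (n : ℕ) → (Fin n → Bool) → R
  | 0, _ => 1
  | n + 1, w => wordProd a b n (Fin.tail w) * cond (w 0) a b

/-- If Ra ∩ Rb = 0, the words in a and b are left independent over R: sort a relation by the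
rightmost letter, conclude that both halves vanish, cancel the letter and recurse. -/
theorem wordProd_independent {R : Type*} [Ring R] [IsDomain R] {a b : R} (ha : a ≠ 0)
    (hb : b ≠ 0) (h : ∀ c d : R, c * a = d * b → c * a = 0) :
    ∀ (n : ℕ) (g : (Fin n → Bool) → R), ∑ w, g w * wordProd a b n w = 0 → ∀ w, g w = 0
  | 0, g, hg, w => by
    rw [Fintype.sum_eq_single w fun w' hw' => absurd (Subsingleton.elim w' w) hw'] at hg
    simpa [wordProd] using hg
  | n + 1, g, hg, w => by
    have hsum : (∑ w', g (Fin.cons true w') * wordProd a b n w') * a +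
        (∑ w', g (Fin.cons false w') * wordProd a b n w') * b = 0 := by
      rw [← hg, ← Fintype.sum_equiv (Fin.consEquiv fun _ => Bool)
        (fun p => g (Fin.cons p.1 p.2) * wordProd a b (n + 1) (Fin.cons p.1 p.2)) _
        (fun p => rfl), Fintype.sum_prod_type, Fintype.sum_bool, Finset.sum_mul, Finset.sum_mul]
      simp [wordProd, mul_assoc]
    have h1 := h _ (-(∑ w', g (Fin.cons false w') * wordProd a b n w')) (by
      rw [neg_mul (∑ w', g (Fin.cons false w') * wordProd a b n w') b]; exact eq_neg_of_add_eq_zero_left hsum)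
    have h2 := (mul_eq_zero.mp h1).resolve_right ha
    rw [h2, zero_mul, zero_add] at hsum
    have h3 := (mul_eq_zero.mp hsum).resolve_right hb
    rw [← Fin.cons_self_tail w]
    cases w 0
    · exact wordProd_independent ha hb h n _ h3 _
    · exact wordProd_independent ha hb h n _ h2 _

theorem exists_lt_two_pow (a d C : ℕ) : ∃ n, a * (2 * (n * C) + 1) ^ d < 2 ^ n := by
  have h := (tendsto_pow_const_div_const_pow_of_one_lt d (r := (2 : ℝ)) one_lt_two).eventually
    (gt_mem_nhds (show (0 : ℝ) < 1 / (a * (2 * C + 1) ^ d + 1) by positivity))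
  obtain ⟨n, hn, hn1⟩ := (h.and (Filter.eventually_ge_atTop 1)).exists
  refine ⟨n, ?_⟩
  rw [div_lt_div_iff₀ (by positivity) (by positivity), one_mul] at hn
  have h1 : (2 * (n * C) + 1) ^ d ≤ n ^ d * (2 * C + 1) ^ d := by
    rw [← mul_pow]; exact Nat.pow_le_pow_left (by nlinarith) d
  have h2 : n ^ d * (a * (2 * C + 1) ^ d + 1) < 2 ^ n := by exact_mod_cast hn
  calc a * (2 * (n * C) + 1) ^ d ≤ a * (n ^ d * (2 * C + 1) ^ d) := Nat.mul_le_mul_left _ h1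
    _ ≤ n ^ d * (a * (2 * C + 1) ^ d + 1) := by nlinarith [Nat.zero_le (n ^ d)]
    _ < 2 ^ n := h2

/-- A domain of subexponential growth is a left Ore domain. -/
theorem left_ore_of_growth {k V R : Type*} [Field k] [Ring V] [Nontrivial V] [Module k V]
    [Ring R] [IsDomain R] (hsm : ∀ (c : k) (x y : V), (c • x) * y = c • (x * y))
    (f : R →+* V) (hf : Function.Injective f) (B : ℕ → Submodule k V)
    (hfin : ∀ n, FiniteDimensional k (B n)) (hB1 : (1 : V) ∈ B 0)
    (hBmul : ∀ n m x y, x ∈ B n → y ∈ B m → x * y ∈ B (n + m)) (hBmono : Monotone B)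
    (hB : ∀ x, ∃ n, x ∈ B n) {c d : ℕ}
    (hgrow : ∀ n, Module.finrank k (B n) ≤ c * (2 * n + 1) ^ d)
    (hden : ∀ x : k, ∃ y : k, y ≠ 0 ∧ (∃ g : R, f g = y • 1) ∧ ∃ g : R, f g = (y * x) • 1)
    (a b : R) (ha : a ≠ 0) (hb : b ≠ 0) : ∃ c d : R, c * a = d * b ∧ c * a ≠ 0 := by
  by_contra! hno
  obtain ⟨na, hna⟩ := hB (f a)
  obtain ⟨nb, hnb⟩ := hB (f b)
  set C := max na nb
  obtain ⟨n, hn⟩ := exists_lt_two_pow c d C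
  have hword : ∀ n w, f (wordProd a b n w) ∈ B (n * C) := by
    intro n
    induction n with
    | zero => intro w; simpa [wordProd] using hB1
    | succ n ih =>
      intro w
      rw [wordProd, map_mul, Nat.succ_mul]
      refine hBmul _ _ _ _ (ih _) ?_
      cases w 0
      · exact hBmono (le_max_right _ _) hnb
      · exact hBmono (le_max_left _ _) hna
  -- There are 2ⁿ words of length n, more than the dimension of B (n C).
  have hdep : ¬ LinearIndependent k fun w : Fin n → Bool =>
      (⟨f (wordProd a b n w), hword n w⟩ : B (n * C)) := by
    intro hli
    have := hli.fintype_card_le_finrank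
    rw [Fintype.card_fun, Fintype.card_bool, Fintype.card_fin] at this
    exact absurd (this.trans (hgrow _)) (not_le.mpr hn)
  obtain ⟨κ, hκ, w₀, hw₀⟩ := Fintype.not_linearIndependent_iff.mp hdep
  have hκ' : ∑ w, κ w • f (wordProd a b n w) = 0 := by
    simpa using congrArg Subtype.val hκ
  have hsm1 : ∀ c c' : k, (c • (1 : V)) * (c' • 1) = (c * c') • 1 := fun c c' => by
    rw [hsm, one_mul, mul_smul]
  -- The dependence has coefficients in `k`, acting on the left and not assumed central in V. A
  -- common denominator moves them into R, where the independence of words applies.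
  have hcommon : ∀ s : Finset (Fin n → Bool), ∃ y : k, y ≠ 0 ∧ (∃ g : R, f g = y • 1) ∧
      ∀ w ∈ s, ∃ g : R, f g = (y * κ w) • 1 := by
    intro s
    induction s using Finset.induction_on with
    | empty => exact ⟨1, one_ne_zero, ⟨1, by simp⟩, by simp⟩
    | insert w s _ ih =>
      obtain ⟨y, hy, ⟨g, hg⟩, hs⟩ := ih
      obtain ⟨y', hy', ⟨g', hg'⟩, g'', hg''⟩ := hden (κ w)
      refine ⟨y * y', mul_ne_zero hy hy', ⟨g * g', by rw [map_mul, hg, hg', hsm1]⟩, ?_⟩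
      intro v hv
      rcases Finset.mem_insert.mp hv with rfl | hv
      · exact ⟨g * g'', by rw [map_mul, hg, hg'', hsm1, mul_assoc]⟩
      · obtain ⟨x, hx⟩ := hs v hv
        exact ⟨g' * x, by rw [map_mul, hg', hx, hsm1, ← mul_assoc, mul_comm y' y]⟩
  obtain ⟨y, hy, -, hs⟩ := hcommon Finset.univ
  choose g hg using fun w => hs w (Finset.mem_univ w)
  have hg0 := wordProd_independent ha hb hno n g (by
    apply hf
    rw [map_sum, map_zero, ← smul_zero y, ← hκ', Finset.smul_sum]
    refine Finset.sum_congr rfl fun w _ => ?_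
    rw [map_mul, hg, hsm, one_mul, mul_smul]) w₀
  have := hg w₀
  rw [hg0, map_zero, eq_comm, smul_eq_zero] at this
  exact (mul_ne_zero hy hw₀) (this.resolve_right one_ne_zero)

end Growth

/-! ### Skew group algebras: absence of zero divisors and an anti-automorphism. -/

section SkewMonoid

open SkewMonoidAlgebra

variable {L G : Type*} [Field L]

/-- A unique product a b of the two supports receives a single contribution, f(a) · a(g(b)), which
the action keeps nonzero. -/
theorem noZeroDivisors_skewMonoidAlgebra [Monoid G] [MulSemiringAction G L] [IsCancelMul G]
    [UniqueProds G] (hG : ∀ (g : G) (x : L), g • x = 0 → x = 0) :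
    NoZeroDivisors (SkewMonoidAlgebra L G) where
  eq_zero_or_eq_zero_of_mul_eq_zero {f g} hfg := by
    classical
    by_contra! h
    have hf : f.support.Nonempty := Finset.nonempty_iff_ne_empty.mpr fun h0 =>
      h.1 (support_eq_empty.mp h0)
    have hg : g.support.Nonempty := Finset.nonempty_iff_ne_empty.mpr fun h0 =>
      h.2 (support_eq_empty.mp h0)
    obtain ⟨a, ha, b, hb, hu⟩ := UniqueProds.uniqueMul_of_nonempty hf hg
    have h1 : (f * g).coeff (a * b) = f.coeff a * a • g.coeff b := by
      rw [coeff_mul, sum_def', Finset.sum_eq_single a]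
      · rw [sum_def', Finset.sum_eq_single b]
        · simp
        · intro b' _ hb'
          rw [if_neg fun h => hb' (mul_left_cancel h)]
        · intro hb'; exact absurd hb hb'
      · intro a' ha' haa'
        rw [sum_def']
        refine Finset.sum_eq_zero fun b' hb' => ?_
        rw [if_neg fun h => haa' (hu ha' hb' h).1]
      · intro ha'; exact absurd ha ha'
    rw [hfg, coeff_zero, Finsupp.zero_apply, eq_comm, mul_eq_zero] at h1
    rcases h1 with h1 | h1
    · exact mem_support_iff.mp ha h1
    · exact mem_support_iff.mp hb (hG _ _ h1)

/-- The anti-automorphism `f g ↦ g⁻¹ f` of a skew group algebra of a commutative group. -/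
def skewStar [CommGroup G] [MulSemiringAction G L] :
    SkewMonoidAlgebra L G →+* (SkewMonoidAlgebra L G)ᵐᵒᵖ :=
  liftNCRingHom
    { toFun := fun x => MulOpposite.op (single 1 x)
      map_one' := rfl
      map_zero' := by simp
      map_add' := fun x y => by rw [single_add, MulOpposite.op_add]
      map_mul' := fun x y => by
        rw [← MulOpposite.op_mul, single_mul_single, one_smul, mul_one, mul_comm] }
    { toFun := fun g => MulOpposite.op (single g⁻¹ 1)
      map_one' := by rw [inv_one]; rfl
      map_mul' := fun x y => by
        rw [← MulOpposite.op_mul, single_mul_single, smul_one, mul_one, mul_inv_rev] }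
    (by
      intro x y
      simp only [RingHom.coe_mk, MonoidHom.coe_mk, OneHom.coe_mk]
      rw [← MulOpposite.op_mul, ← MulOpposite.op_mul, single_mul_single, single_mul_single,
        inv_smul_smul, one_mul, mul_one, one_smul, mul_one, one_mul])

theorem skewStar_single [CommGroup G] [MulSemiringAction G L] (g : G) (x : L) :
    skewStar (single g x) = MulOpposite.op (single g⁻¹ (g⁻¹ • x)) := by
  have : skewStar (single g x) =
      MulOpposite.op (single 1 x) * MulOpposite.op (single g⁻¹ (1 : L)) :=
    liftNC_single _ _ _ _
  rw [this, ← MulOpposite.op_mul, single_mul_single, one_mul, mul_one]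

theorem skewStar_skewStar [CommGroup G] [MulSemiringAction G L] (v : SkewMonoidAlgebra L G) :
    MulOpposite.unop (skewStar (MulOpposite.unop (skewStar v))) = v := by
  induction v with
  | single g x =>
    rw [skewStar_single, MulOpposite.unop_op, skewStar_single, MulOpposite.unop_op, inv_inv,
      smul_inv_smul]
  | add f g hf hg => rw [map_add, MulOpposite.unop_add, map_add, MulOpposite.unop_add, hf, hg]

theorem skewStar_injective [CommGroup G] [MulSemiringAction G L] :
    Function.Injective (skewStar : SkewMonoidAlgebra L G → _) := fun a b h => by
  rw [← skewStar_skewStar a, h, skewStar_skewStar]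

end SkewMonoid

/-! ### Polynomial growth of skew group algebras of free abelian groups. -/

section SkewBall

open SkewMonoidAlgebra

variable {L G I : Type*} [Field L] [CommGroup G] [MulSemiringAction G L]
  (ε : G ≃* Multiplicative (I → ℤ)) (k : Type*) [Field k] [Algebra k L]

/-- The elements of the skew group algebra with all exponents in `[-n, n]`. -/
def skewBall (n : ℕ) : Submodule k (SkewMonoidAlgebra L G) where
  carrier := {v | ∀ g, v.coeff g ≠ 0 → ∀ i, |(ε g).toAdd i| ≤ n}
  zero_mem' := fun g hg => absurd rfl hg
  add_mem' := by
    intro v w hv hw g hg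
    by_cases h : v.coeff g = 0
    · refine hw g fun h' => hg ?_
      rw [coeff_add, Finsupp.add_apply, h, h', add_zero]
    · exact hv g h
  smul_mem' := by
    intro c v hv g hg
    refine hv g fun h => hg ?_
    rw [coeff_smul, Finsupp.smul_apply, h, smul_zero]

theorem one_mem_skewBall : (1 : SkewMonoidAlgebra L G) ∈
    skewBall (L := L) ε k 0 := by
  classical
  intro g hg i
  rw [coeff_one, Finsupp.single_apply] at hg
  have : 1 = g := by by_contra h; simp [h] at hg
  simp [← this, ]

theorem mul_mem_skewBall {n m : ℕ} {v w : SkewMonoidAlgebra L G}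
    (hv : v ∈ skewBall (L := L) ε k n) (hw : w ∈ skewBall (L := L) ε k m) : v * w ∈ skewBall (L := L) ε k (n + m) := by
  classical
  intro g hg i
  obtain ⟨a, ha, b, hb, rfl⟩ := Finset.mem_mul.mp (support_mul _ _ (mem_support_iff.mpr hg))
  rw [map_mul, toAdd_mul, Pi.add_apply, Nat.cast_add]
  exact (abs_add_le _ _).trans
    (add_le_add (hv a (mem_support_iff.mp ha) i) (hw b (mem_support_iff.mp hb) i))

theorem skewBall_mono : Monotone (skewBall (L := L) ε k) := fun _ _ hnm _ hv g hg i =>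
  (hv g hg i).trans (by exact_mod_cast hnm)

theorem exists_mem_skewBall [Finite I] (v : SkewMonoidAlgebra L G) :
    ∃ n, v ∈ skewBall (L := L) ε k n := by
  have := Fintype.ofFinite I
  refine ⟨∑ g ∈ v.support, ∑ i, ((ε g).toAdd i).natAbs, fun g hg i => ?_⟩
  rw [Int.abs_eq_natAbs]
  norm_cast
  exact (Finset.single_le_sum (f := fun i => ((ε g).toAdd i).natAbs) (fun _ _ => Nat.zero_le _)
    (Finset.mem_univ i)).trans
    (Finset.single_le_sum (f := fun g : G => ∑ i, ((ε g).toAdd i).natAbs)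
      (fun _ _ => Nat.zero_le _) (mem_support_iff.mpr hg))

/-- The coefficients at the exponents in `[-n, n]`. -/
def skewBallCoeff [Fintype I] [DecidableEq I] (n : ℕ) : skewBall (L := L) ε k n →ₗ[k]
    (Fintype.piFinset fun _ : I => Finset.Icc (-(n : ℤ)) n) → L where
  toFun v a := v.1.coeff (ε.symm (Multiplicative.ofAdd a.1))
  map_add' v w := by ext a; simp
  map_smul' c v := by ext a; simp

theorem skewBallCoeff_injective [Fintype I] [DecidableEq I] (n : ℕ) :
    Function.Injective (skewBallCoeff (L := L) ε k n) := by
  rw [injective_iff_map_eq_zero]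
  intro v hv
  ext g
  by_contra h
  have hg := v.2 g h
  refine h ?_
  have := congrFun hv ⟨(ε g).toAdd, Fintype.mem_piFinset.mpr fun i =>
    Finset.mem_Icc.mpr (abs_le.mp (hg i))⟩
  simpa [skewBallCoeff] using this

theorem skew_smul_mul (c : k) (x y : SkewMonoidAlgebra L G) :
    (c • x) * y = c • (x * y) := by
  have h : ∀ x : SkewMonoidAlgebra L G,
      c • x = single 1 (algebraMap k L c) * x := fun x => by
    refine SkewMonoidAlgebra.ext fun g => ?_
    rw [coeff_single_one_mul, coeff_smul, Finsupp.smul_apply, Algebra.smul_def]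
  rw [h, h, mul_assoc]

theorem skew_smul_one (c : k) : c • (1 : SkewMonoidAlgebra L G) =
    single 1 (algebraMap k L c) := by
  rw [one_def, smul_single, Algebra.smul_def, mul_one]

variable [FiniteDimensional k L]

theorem finiteDimensional_skewBall [Finite I] (n : ℕ) :
    FiniteDimensional k (skewBall (L := L) ε k n) := by
  classical
  have := Fintype.ofFinite I
  exact FiniteDimensional.of_injective _ (skewBallCoeff_injective (L := L) ε k n)

theorem finrank_skewBall_le [Fintype I] (n : ℕ) : Module.finrank k (skewBall (L := L) ε k n) ≤
    Module.finrank k L * (2 * n + 1) ^ Fintype.card I := by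
  classical
  refine (LinearMap.finrank_le_finrank_of_injective (skewBallCoeff_injective (L := L) ε k n)).trans ?_
  rw [Module.finrank_pi_fintype, Finset.sum_const, smul_eq_mul, mul_comm, Finset.card_univ,
    Fintype.card_coe, Fintype.card_piFinset, Finset.prod_const, Int.card_Icc, Finset.card_univ]
  have : ((n : ℤ) + 1 - -(n : ℤ)).toNat = 2 * n + 1 := by omega
  rw [this]

/-- A subring of the skew group algebra which contains a ring of rational functions with finite
index in the field of all rational functions is an Ore domain. -/
theorem isOreDomain_of_injective [Finite I] (ε : G ≃* Multiplicative (I → ℤ)) {R : Type u} [Ring R]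
    (f : R →+* SkewMonoidAlgebra L G) (hf : Function.Injective f)
    (hden : ∀ x : k, ∃ y : k, y ≠ 0 ∧ (∃ g : R, f g = single 1 (algebraMap k L y)) ∧
      ∃ g : R, f g = single 1 (algebraMap k L (y * x))) : IsOreDomain R := by
  have := Fintype.ofFinite I
  have : UniqueProds G := ε.uniqueProds_iff.mpr inferInstance
  have : NoZeroDivisors (SkewMonoidAlgebra L G) :=
    noZeroDivisors_skewMonoidAlgebra fun g x h => by rw [← inv_smul_smul g x, h, smul_zero]
  have : IsDomain (SkewMonoidAlgebra L G) :=
    NoZeroDivisors.to_isDomain _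
  have hR : IsDomain R := hf.isDomain f
  refine { hR with left_ore := fun a b ha hb => ?_, right_ore := fun a b ha hb => ?_ }
  · refine left_ore_of_growth (k := k) (skew_smul_mul k) f hf (skewBall (L := L) ε k)
      (finiteDimensional_skewBall (L := L) ε k) (one_mem_skewBall (L := L) ε k)
      (fun n m x y => mul_mem_skewBall (L := L) ε k) (skewBall_mono ε k) (exists_mem_skewBall (L := L) ε k)
      (finrank_skewBall_le ε k) (fun x => ?_) a b ha hb
    simpa only [skew_smul_one] using hden x
  · let f' : Rᵐᵒᵖ →+* SkewMonoidAlgebra L G :=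
      (RingEquiv.opOp _).symm.toRingHom.comp (RingHom.op (skewStar.comp f))
    have hf' : ∀ x, f' x = MulOpposite.unop (skewStar (f x.unop)) := fun x => rfl
    have hinj : Function.Injective f' := fun x y h => by
      rw [hf', hf'] at h
      exact MulOpposite.unop_injective (hf (skewStar_injective (MulOpposite.unop_injective h)))
    obtain ⟨c, d, h1, h2⟩ := left_ore_of_growth (k := k) (skew_smul_mul k) f' hinj
      (skewBall (L := L) ε k) (finiteDimensional_skewBall (L := L) ε k) (one_mem_skewBall (L := L) ε k)
      (fun n m x y => mul_mem_skewBall (L := L) ε k) (skewBall_mono ε k) (exists_mem_skewBall (L := L) ε k)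
      (finrank_skewBall_le ε k) (fun x => by
        obtain ⟨y, hy, ⟨g, hg⟩, g', hg'⟩ := hden x
        refine ⟨y, hy, ⟨MulOpposite.op g, ?_⟩, MulOpposite.op g', ?_⟩ <;>
        rw [hf', MulOpposite.unop_op] <;> simp only [hg, hg', skewStar_single, inv_one, one_smul,
          MulOpposite.unop_op, skew_smul_one])
      (MulOpposite.op a) (MulOpposite.op b) (by simpa using ha) (by simpa using hb)
    refine ⟨c.unop, d.unop, ?_, fun h0 => h2 ?_⟩
    · simpa using congrArg MulOpposite.unop h1
    · apply MulOpposite.unop_injective; simpa using h0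

end SkewBall

section SkewAlgOre

variable {F : Type u} [Field F] {I : Type} (q : Fˣ)

/-- The shift group is a free abelian group. -/
def ShiftGroup.equiv : ShiftGroup I q ≃* Multiplicative (I → ℤ) := MulEquiv.refl _

instance [Finite I] : IsOreDomain (SkewAlg I q) :=
  isOreDomain_of_injective (RatFun F I) (ShiftGroup.equiv q) (RingHom.id (SkewAlg I q))
    Function.injective_id
    fun x => ⟨1, one_ne_zero, ⟨SkewAlg.mono q 1 1, rfl⟩, ⟨SkewAlg.mono q (1 * x) 1, rfl⟩⟩

end SkewAlgOre
end
end QuantumOGZ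

namespace QuantumOGZ

noncomputable section

/-! ### Ordered monomials in quantum affine generators. -/

section QuantumMonomials

/-- The defining relations of the quantum affine algebra. -/
structure QuantumRel {K R ι : Type*} [Field K] [Ring R] [Algebra K R] (c : ι → K) (x y : ι → R) :
    Prop where
  xx : ∀ i j, Commute (x i) (x j)
  yy : ∀ i j, Commute (y i) (y j)
  yx_same : ∀ i, y i * x i = c i • (x i * y i)
  yx_ne : ∀ i j, i ≠ j → Commute (y i) (x j)

variable {ι : Type*} [Fintype ι] [DecidableEq ι]

/-- The monomial with exponents `a` in a commuting family. -/
def commMonomial {R : Type*} [Monoid R] (x : ι → R) (hx : ∀ i j, Commute (x i) (x j)) :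
    (ι → Multiplicative ℕ) →* R :=
  MonoidHom.noncommPiCoprod (fun i => powersHom R (x i)) fun i j _ a b => by
    simp only [powersHom_apply]
    exact (hx i j).pow_pow _ _

theorem commMonomial_mulSingle {R : Type*} [Monoid R] (x : ι → R)
    (hx : ∀ i j, Commute (x i) (x j)) (i : ι) (n : Multiplicative ℕ) :
    commMonomial x hx (Pi.mulSingle i n) = x i ^ n.toAdd :=
  (MonoidHom.noncommPiCoprod_mulSingle (ϕ := fun i => powersHom R (x i)) i n).trans
    (powersHom_apply _ _)

theorem mem_submonoid_of_mulSingle (S : Submonoid (ι → Multiplicative ℕ))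
    (h : ∀ i n, Pi.mulSingle i n ∈ S) (a : ι → Multiplicative ℕ) : a ∈ S := by
  rw [← Finset.univ_prod_mulSingle a]
  exact Submonoid.prod_mem _ fun i _ => h i _

variable {K R : Type*} [Field K] [Ring R] [Algebra K R] {c : ι → K} {x y : ι → R}

/-- The scalar by which two monomials commute. -/
def monomialPairing (c : ι → K) (a b : ι → Multiplicative ℕ) : K :=
  ∏ i, c i ^ ((a i).toAdd * (b i).toAdd)

theorem monomialPairing_mul_left (a a' b : ι → Multiplicative ℕ) :
    monomialPairing c (a * a') b = monomialPairing c a b * monomialPairing c a' b := by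
  simp only [monomialPairing, Pi.mul_apply, toAdd_mul, add_mul, pow_add, Finset.prod_mul_distrib]

theorem monomialPairing_comm (a b : ι → Multiplicative ℕ) :
    monomialPairing c a b = monomialPairing c b a := by
  simp only [monomialPairing, mul_comm]

theorem monomialPairing_one_left (b : ι → Multiplicative ℕ) : monomialPairing c 1 b = 1 := by
  simp [monomialPairing]

theorem monomialPairing_one_right (b : ι → Multiplicative ℕ) : monomialPairing c b 1 = 1 := by
  simp [monomialPairing]

theorem monomialPairing_mul_right (a b b' : ι → Multiplicative ℕ) :
    monomialPairing c a (b * b') = monomialPairing c a b * monomialPairing c a b' := by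
  rw [monomialPairing_comm, monomialPairing_mul_left, monomialPairing_comm b,
    monomialPairing_comm b']

theorem monomialPairing_mulSingle_right (a : ι → Multiplicative ℕ) (i : ι) (n : Multiplicative ℕ) :
    monomialPairing c a (Pi.mulSingle i n) = c i ^ ((a i).toAdd * n.toAdd) := by
  rw [monomialPairing, Finset.prod_eq_single i]
  · rw [Pi.mulSingle_eq_same]
  · intro j _ hj; rw [Pi.mulSingle_eq_of_ne hj]; simp
  · simp

namespace QuantumRel

theorem y_mul_x_pow (h : QuantumRel c x y) (i : ι) (n : ℕ) :
    y i * x i ^ n = c i ^ n • (x i ^ n * y i) := by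
  induction n with
  | zero => simp
  | succ n ih =>
    rw [pow_succ, ← mul_assoc, ih, smul_mul_assoc, mul_assoc, h.yx_same, mul_smul_comm, smul_smul,
      ← pow_succ, mul_assoc]

theorem y_mul_monomial (h : QuantumRel c x y) (i : ι) (a : ι → Multiplicative ℕ) :
    y i * commMonomial x h.xx a = c i ^ (a i).toAdd • (commMonomial x h.xx a * y i) := by
  let S : Submonoid (ι → Multiplicative ℕ) :=
    { carrier := {a | y i * commMonomial x h.xx a =
        c i ^ (a i).toAdd • (commMonomial x h.xx a * y i)}
      one_mem' := by simp
      mul_mem' := by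
        intro a b ha hb
        simp only [Set.mem_ofPred_eq] at ha hb ⊢
        rw [map_mul, ← mul_assoc, ha, smul_mul_assoc, mul_assoc, hb, mul_smul_comm, smul_smul,
          Pi.mul_apply, toAdd_mul, pow_add, mul_assoc] }
  refine mem_submonoid_of_mulSingle S (fun k n => ?_) a
  change _ = _
  rw [commMonomial_mulSingle]
  by_cases hik : i = k
  · subst hik
    rw [Pi.mulSingle_eq_same, h.y_mul_x_pow]
  · rw [Pi.mulSingle_eq_of_ne hik, toAdd_one, pow_zero, one_smul]
    exact (h.yx_ne i k hik).pow_right _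

theorem monomial_mul_monomial (h : QuantumRel c x y) (a b : ι → Multiplicative ℕ) :
    commMonomial y h.yy b * commMonomial x h.xx a =
      monomialPairing c a b • (commMonomial x h.xx a * commMonomial y h.yy b) := by
  let S : Submonoid (ι → Multiplicative ℕ) :=
    { carrier := {b | commMonomial y h.yy b * commMonomial x h.xx a =
        monomialPairing c a b • (commMonomial x h.xx a * commMonomial y h.yy b)}
      one_mem' := by
        simp [monomialPairing_one_right]
      mul_mem' := by
        intro b b' hb hb'
        simp only [Set.mem_ofPred_eq] at hb hb' ⊢
        rw [map_mul, mul_assoc, hb', mul_smul_comm, ← mul_assoc, hb, smul_mul_assoc, smul_smul,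
          monomialPairing_mul_right, mul_comm (monomialPairing c a b), mul_assoc] }
  refine mem_submonoid_of_mulSingle S (fun i n => ?_) b
  change _ = _
  rw [commMonomial_mulSingle, monomialPairing_mulSingle_right]
  induction n.toAdd with
  | zero => simp
  | succ n ih =>
    rw [pow_succ', mul_assoc, ih, mul_smul_comm, ← mul_assoc, h.y_mul_monomial, smul_mul_assoc,
      smul_smul, mul_assoc, ← pow_add, mul_add, mul_one]

/-- The monomials `x ^ a * y ^ b`. -/
def mono (h : QuantumRel c x y) (m : (ι → Multiplicative ℕ) × (ι → Multiplicative ℕ)) : R :=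
  commMonomial x h.xx m.1 * commMonomial y h.yy m.2

theorem mono_mul_mono (h : QuantumRel c x y)
    (m m' : (ι → Multiplicative ℕ) × (ι → Multiplicative ℕ)) :
    h.mono m * h.mono m' = monomialPairing c m'.1 m.2 • h.mono (m * m') := by
  simp only [mono, Prod.fst_mul, Prod.snd_mul, map_mul]
  rw [mul_assoc, ← mul_assoc (commMonomial y h.yy m.2), h.monomial_mul_monomial, smul_mul_assoc,
    mul_smul_comm]
  simp only [mul_assoc]

/-- Moving a fixed monomial in y (from the left) and one in x (from the right) across xᵃ yᵇ
multiplies it by a character value. As no c i is a root of unity, different monomials have different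
characters, and Dedekind's independence of characters applies. -/
theorem linearIndependent_mono [IsDomain R] (h : QuantumRel c x y) (hc0 : ∀ i, c i ≠ 0)
    (hc : ∀ i n, 0 < n → c i ^ n ≠ 1) (hx : ∀ i, x i ≠ 0) (hy : ∀ i, y i ≠ 0) :
    LinearIndependent K h.mono := by
  have hne : ∀ (z : ι → R) (hz : ∀ i j, Commute (z i) (z j)), (∀ i, z i ≠ 0) →
      ∀ a, commMonomial z hz a ≠ 0 := by
    intro z hz hz0
    let S : Submonoid (ι → Multiplicative ℕ) :=
      { carrier := {a | commMonomial z hz a ≠ 0}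
        one_mem' := by simp
        mul_mem' := by
          intro a b ha hb
          change _ ≠ _
          rw [map_mul]; exact mul_ne_zero ha hb }
    exact mem_submonoid_of_mulSingle S fun i n => by
      change _ ≠ _
      rw [commMonomial_mulSingle]; exact pow_ne_zero _ (hz0 i)
  have hpow : ∀ i (n n' : ℕ), c i ^ n = c i ^ n' → n = n' := by
    intro i
    have : ∀ n n' : ℕ, n ≤ n' → c i ^ n = c i ^ n' → n = n' := by
      intro n n' hnn' he
      by_contra hne
      refine hc i (n' - n) (by omega) ?_
      apply mul_left_cancel₀ (pow_ne_zero n (hc0 i))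
      rw [← pow_add, mul_one, he, Nat.add_sub_cancel' hnn']
    intro n n' he
    rcases le_total n n' with hle | hle
    · exact this n n' hle he
    · exact (this n' n hle he.symm).symm
  rw [linearIndependent_iff']
  intro s κ hκ m hm
  let χ : (ι → Multiplicative ℕ) × (ι → Multiplicative ℕ) →
      ((ι → Multiplicative ℕ) × (ι → Multiplicative ℕ) →* K) := fun m =>
    { toFun := fun g => monomialPairing c m.1 g.1 * monomialPairing c g.2 m.2
      map_one' := by simp [monomialPairing_one_right, monomialPairing_one_left]
      map_mul' := fun g g' => by
        simp only [Prod.fst_mul, Prod.snd_mul, monomialPairing_mul_right,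
          monomialPairing_mul_left]
        ring }
  have hχ : Function.Injective χ := by
    intro m m' hmm'
    refine Prod.ext ?_ ?_ <;> funext i
    · have := DFunLike.congr_fun hmm' (Pi.mulSingle i (Multiplicative.ofAdd 1), 1)
      simp only [χ, MonoidHom.coe_mk, OneHom.coe_mk, monomialPairing_mulSingle_right,
        monomialPairing_one_left, mul_one, toAdd_ofAdd] at this
      exact Multiplicative.toAdd.injective (hpow i _ _ this)
    · have := DFunLike.congr_fun hmm' (1, Pi.mulSingle i (Multiplicative.ofAdd 1))
      simp only [χ, MonoidHom.coe_mk, OneHom.coe_mk, monomialPairing_one_right,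
        monomialPairing_comm (Pi.mulSingle i _), monomialPairing_mulSingle_right, mul_one,
        one_mul, toAdd_ofAdd] at this
      exact Multiplicative.toAdd.injective (hpow i _ _ this)
  have key : ∀ g, ∑ m ∈ s, (κ m * χ m g) • h.mono m = 0 := by
    intro g
    have h1 : ∑ m ∈ s, (κ m * monomialPairing c m.1 g.1) • h.mono m = 0 := by
      have := congrArg (commMonomial y h.yy g.1 * ·) hκ
      simp only [mul_zero, Finset.mul_sum] at this
      apply (mul_eq_zero.mp (Eq.trans ?_ this)).resolve_right (hne y h.yy hy g.1)
      rw [Finset.sum_mul]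
      refine Finset.sum_congr rfl fun m _ => ?_
      rw [mul_smul_comm, mono, ← mul_assoc, h.monomial_mul_monomial, smul_mul_assoc,
        smul_mul_assoc, smul_smul, mul_assoc, mul_assoc, ← map_mul, ← map_mul, mul_comm m.2]
    have := congrArg (· * commMonomial x h.xx g.2) h1
    simp only [zero_mul, Finset.sum_mul] at this
    apply (mul_eq_zero.mp (Eq.trans ?_ this)).resolve_left (hne x h.xx hx g.2)
    rw [Finset.mul_sum]
    refine Finset.sum_congr rfl fun m _ => ?_
    rw [smul_mul_assoc, mono, mul_assoc, h.monomial_mul_monomial, mul_smul_comm,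
      mul_smul_comm, smul_smul, ← mul_assoc, ← mul_assoc, ← map_mul, ← map_mul, mul_comm m.1,
      mul_assoc (κ m)]
    rfl
  by_contra hκm
  have hm0 : h.mono m ≠ 0 := mul_ne_zero (hne x h.xx hx _) (hne y h.yy hy _)
  -- A functional not killing the chosen monomial turns the relations `key`, valued in R, into one
  -- K-valued relation among the characters.
  obtain ⟨l, hl⟩ : ∃ l : Module.Dual K R, l (h.mono m) ≠ 0 := by
    by_contra! hl
    exact hm0 ((Module.forall_dual_apply_eq_zero_iff K _).mp hl)
  have hli := (linearIndependent_monoidHom _ K).comp χ hχ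
  rw [linearIndependent_iff'] at hli
  have := hli s (fun m => κ m * l (h.mono m)) (by
    funext g
    have := congrArg l (key g)
    rw [map_sum, map_zero] at this
    rw [Finset.sum_apply, Pi.zero_apply, ← this]
    refine Finset.sum_congr rfl fun m _ => ?_
    simp only [Pi.smul_apply, Function.comp_apply, smul_eq_mul, map_smul]
    ring) m hm
  exact mul_ne_zero hκm hl this

/-- The span of the monomials with all exponents at most `n`. -/
def filtration (h : QuantumRel c x y) (n : ℕ) : Submodule K R :=
  Submodule.span K (h.mono '' {m | ∀ i, (m.1 i).toAdd ≤ n ∧ (m.2 i).toAdd ≤ n})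

theorem filtration_mono (h : QuantumRel c x y) : Monotone h.filtration := fun _ _ hnm =>
  Submodule.span_mono (Set.image_mono fun _ hm i =>
    ⟨(hm i).1.trans hnm, (hm i).2.trans hnm⟩)

theorem one_mem_filtration (h : QuantumRel c x y) : (1 : R) ∈ h.filtration 0 :=
  Submodule.subset_span ⟨1, fun _ => ⟨le_rfl, le_rfl⟩, by simp [mono]⟩

theorem mul_mem_filtration (h : QuantumRel c x y) {n m : ℕ} {v w : R} (hv : v ∈ h.filtration n)
    (hw : w ∈ h.filtration m) : v * w ∈ h.filtration (n + m) := by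
  have := Submodule.mul_mem_mul hv hw
  rw [filtration, filtration, Submodule.span_mul_span] at this
  refine Submodule.span_le.mpr ?_ this
  rintro _ ⟨_, ⟨a, ha, rfl⟩, _, ⟨b, hb, rfl⟩, rfl⟩
  simp only [h.mono_mul_mono]
  refine Submodule.smul_mem _ _ (Submodule.subset_span ⟨_, fun i => ?_, rfl⟩)
  exact ⟨add_le_add (ha i).1 (hb i).1, add_le_add (ha i).2 (hb i).2⟩

theorem filtration_eq_span_range (h : QuantumRel c x y) (n : ℕ) :
    h.filtration n = Submodule.span K (Set.range fun p : (ι → Fin (n + 1)) × (ι → Fin (n + 1)) =>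
      h.mono (fun i => Multiplicative.ofAdd (p.1 i : ℕ), fun i => Multiplicative.ofAdd (p.2 i : ℕ)))
    := by
  apply le_antisymm
  · refine Submodule.span_le.mpr ?_
    rintro _ ⟨m, hm, rfl⟩
    refine Submodule.subset_span ⟨(fun i => ⟨(m.1 i).toAdd, Nat.lt_succ_of_le (hm i).1⟩,
      fun i => ⟨(m.2 i).toAdd, Nat.lt_succ_of_le (hm i).2⟩), rfl⟩
  · refine Submodule.span_le.mpr ?_
    rintro _ ⟨p, rfl⟩
    exact Submodule.subset_span ⟨(fun i => Multiplicative.ofAdd (p.1 i : ℕ),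
      fun i => Multiplicative.ofAdd (p.2 i : ℕ)), fun i => ⟨Nat.le_of_lt_succ (p.1 i).2,
      Nat.le_of_lt_succ (p.2 i).2⟩, rfl⟩

theorem finiteDimensional_filtration (h : QuantumRel c x y) (n : ℕ) :
    FiniteDimensional K (h.filtration n) := by
  rw [filtration_eq_span_range]
  exact FiniteDimensional.span_of_finite K (Set.finite_range _)

theorem finrank_filtration_le (h : QuantumRel c x y) (n : ℕ) :
    Module.finrank K (h.filtration n) ≤ 1 * (2 * n + 1) ^ (2 * Fintype.card ι) := by
  rw [filtration_eq_span_range]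
  refine (finrank_range_le_card _).trans ?_
  rw [Fintype.card_prod, Fintype.card_fun, Fintype.card_fin, one_mul, two_mul (Fintype.card ι),
    pow_add]
  gcongr <;> omega

theorem exists_mem_filtration (h : QuantumRel c x y)
    (hspan : ∀ v, v ∈ Submodule.span K (Set.range h.mono)) (v : R) : ∃ n, v ∈ h.filtration n := by
  induction hspan v using Submodule.span_induction with
  | mem v hv =>
    obtain ⟨m, rfl⟩ := hv
    refine ⟨∑ i, ((m.1 i).toAdd + (m.2 i).toAdd), Submodule.subset_span ⟨m, fun i => ?_, rfl⟩⟩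
    have := Finset.single_le_sum (f := fun i => (m.1 i).toAdd + (m.2 i).toAdd)
      (fun _ _ => Nat.zero_le _) (Finset.mem_univ i)
    omega
  | zero => exact ⟨0, zero_mem _⟩
  | add v w _ _ hv hw =>
    obtain ⟨n, hn⟩ := hv
    obtain ⟨m, hm⟩ := hw
    exact ⟨max n m, add_mem (h.filtration_mono (le_max_left _ _) hn)
      (h.filtration_mono (le_max_right _ _) hm)⟩
  | smul a v _ hv =>
    obtain ⟨n, hn⟩ := hv
    exact ⟨n, Submodule.smul_mem _ _ hn⟩

end QuantumRel

end QuantumMonomials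
end
end QuantumOGZ

namespace QuantumOGZ

noncomputable section

open scoped nonZeroDivisors
open OreLocalization

/-! ### The quantum affine algebra: monomial basis, Ore property, embeddings in division rings. -/

section QuantumAffineEmbedding

variable {K : Type u} [Field K] {ι : Type} [Fintype ι] [DecidableEq ι] {c : ι → K}

/-- The generators of the quantum affine algebra. -/
def QuantumAffine.gen (c : ι → K) (s : ι ⊕ ι) : QuantumAffine c :=
  RingQuot.mkAlgHom K (AffineRel c) (FreeAlgebra.ι K s)

theorem QuantumAffine.quantumRel (c : ι → K) :
    QuantumRel c (fun i => QuantumAffine.gen c (Sum.inl i))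
      fun i => QuantumAffine.gen c (Sum.inr i) where
  xx i j := by
    have := RingQuot.mkAlgHom_rel K (AffineRel.xx (c := c) i j)
    rw [map_mul, map_mul] at this
    exact this
  yy i j := by
    have := RingQuot.mkAlgHom_rel K (AffineRel.yy (c := c) i j)
    rw [map_mul, map_mul] at this
    exact this
  yx_same i := by
    have := RingQuot.mkAlgHom_rel K (AffineRel.yx_same (c := c) i)
    rw [map_smul, map_mul, map_mul] at this
    exact this
  yx_ne i j hij := by
    have := RingQuot.mkAlgHom_rel K (AffineRel.yx_ne (c := c) i j hij)
    rw [map_mul, map_mul] at this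
    exact this

/-- The span of the monomials contains 1 and is stable under left multiplication by the generators,
since each generator is a monomial and products of monomials are multiples of monomials. -/
theorem QuantumAffine.mem_span_mono (v : QuantumAffine c) :
    v ∈ Submodule.span K (Set.range (QuantumAffine.quantumRel c).mono) := by
  set h := QuantumAffine.quantumRel c
  set W := Submodule.span K (Set.range h.mono) with hW
  have hmem : ∀ m, h.mono m ∈ W := fun m => Submodule.subset_span ⟨m, rfl⟩
  have hgen : ∀ s, ∀ w ∈ W, QuantumAffine.gen c s * w ∈ W := by
    intro s w hw
    induction hw using Submodule.span_induction with
    | mem w hw =>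
      obtain ⟨m, rfl⟩ := hw
      obtain ⟨m', hm'⟩ : ∃ m', QuantumAffine.gen c s = h.mono m' := by
        rcases s with i | i
        · refine ⟨(Pi.mulSingle i (Multiplicative.ofAdd 1), 1), ?_⟩
          simp only [QuantumRel.mono, commMonomial_mulSingle]
          rw [(commMonomial _ _).map_one, mul_one, toAdd_ofAdd, pow_one]
        · refine ⟨(1, Pi.mulSingle i (Multiplicative.ofAdd 1)), ?_⟩
          simp only [QuantumRel.mono, commMonomial_mulSingle]
          rw [(commMonomial _ _).map_one, one_mul, toAdd_ofAdd, pow_one]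
      rw [hm', h.mono_mul_mono]
      exact W.smul_mem _ (hmem _)
    | zero => rw [mul_zero]; exact W.zero_mem
    | add a b _ _ ha hb => rw [mul_add]; exact W.add_mem ha hb
    | smul t a _ ha => rw [mul_smul_comm]; exact W.smul_mem _ ha
  obtain ⟨f, rfl⟩ := RingQuot.mkAlgHom_surjective K (AffineRel c) v
  have key : ∀ w ∈ W, RingQuot.mkAlgHom K (AffineRel c) f * w ∈ W := by
    induction f using FreeAlgebra.induction with
    | grade0 r =>
      intro w hw
      rw [AlgHom.commutes, ← Algebra.smul_def]
      exact W.smul_mem _ hw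
    | grade1 s => exact hgen s
    | mul a b ha hb =>
      intro w hw
      rw [map_mul, mul_assoc]
      exact ha _ (hb _ hw)
    | add a b ha hb =>
      intro w hw
      rw [map_add, add_mul]
      exact W.add_mem (ha _ hw) (hb _ hw)
  have h1 := key 1 (by
    have := hmem 1
    rwa [QuantumRel.mono, Prod.fst_one, Prod.snd_one, map_one, map_one, mul_one] at this)
  rwa [mul_one] at h1

/-- The homomorphism from the quantum affine algebra given by elements which satisfy the defining
relations. -/
def QuantumAffine.lift {R : Type*} [Ring R] [Algebra K R] {x y : ι → R} (h : QuantumRel c x y) :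
    QuantumAffine c →ₐ[K] R :=
  RingQuot.liftAlgHom K ⟨FreeAlgebra.lift K (Sum.elim x y), by
    intro a b hab
    induction hab with
    | xx i j => simpa using (h.xx i j).eq
    | yy i j => simpa using (h.yy i j).eq
    | yx_same i => simpa using h.yx_same i
    | yx_ne i j hij => simpa using (h.yx_ne i j hij).eq⟩

theorem QuantumAffine.lift_gen {R : Type*} [Ring R] [Algebra K R] {x y : ι → R}
    (h : QuantumRel c x y) (s : ι ⊕ ι) :
    QuantumAffine.lift h (QuantumAffine.gen c s) = Sum.elim x y s := by
  rw [QuantumAffine.lift, QuantumAffine.gen, RingQuot.liftAlgHom_mkAlgHom_apply,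
    FreeAlgebra.lift_ι_apply]

theorem QuantumAffine.lift_mono {R : Type*} [Ring R] [Algebra K R] {x y : ι → R}
    (h : QuantumRel c x y) (m : (ι → Multiplicative ℕ) × (ι → Multiplicative ℕ)) :
    QuantumAffine.lift h ((QuantumAffine.quantumRel c).mono m) = h.mono m := by
  have key : ∀ (z : ι → QuantumAffine c) (hz) (w : ι → R) (hw),
      (∀ i, QuantumAffine.lift h (z i) = w i) →
      ∀ a, QuantumAffine.lift h (commMonomial z hz a) = commMonomial w hw a := by
    intro z hz w hw hzw a
    let S : Submonoid (ι → Multiplicative ℕ) :=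
      MonoidHom.eqLocusM ((QuantumAffine.lift h : QuantumAffine c →* R).comp (commMonomial z hz))
        (commMonomial w hw)
    refine mem_submonoid_of_mulSingle S (fun i n => ?_) a
    change QuantumAffine.lift h _ = _
    rw [commMonomial_mulSingle, commMonomial_mulSingle, map_pow, hzw]
  rw [QuantumRel.mono, map_mul, key _ _ x h.xx fun i => lift_gen h _,
    key _ _ y h.yy fun i => lift_gen h _, QuantumRel.mono]

theorem QuantumAffine.lift_injective {R : Type*} [Ring R] [IsDomain R] [Algebra K R]
    {x y : ι → R} (h : QuantumRel c x y) (hc0 : ∀ i, c i ≠ 0) (hc : ∀ i n, 0 < n → c i ^ n ≠ 1)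
    (hx : ∀ i, x i ≠ 0) (hy : ∀ i, y i ≠ 0) : Function.Injective (QuantumAffine.lift h) := by
  rw [injective_iff_map_eq_zero]
  intro v hv
  obtain ⟨f, rfl⟩ := (Finsupp.mem_span_range_iff_exists_finsupp).mp
    (QuantumAffine.mem_span_mono v)
  have hli := h.linearIndependent_mono hc0 hc hx hy
  rw [linearIndependent_iff] at hli
  have : f = 0 := by
    apply hli
    rw [← hv, Finsupp.linearCombination_apply, Finsupp.sum, Finsupp.sum, map_sum]
    simp only [map_smul, QuantumAffine.lift_mono]
  rw [this, Finsupp.sum_zero_index]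

/-- Monomials with exponents at most n number (n + 1)^(2|ι|), so the growth criterion applies. For
the right condition the same filtration is transported to the opposite ring. -/
theorem QuantumRel.isOreDomain {R : Type u} [Ring R] [IsDomain R] [Algebra K R] {x y : ι → R}
    (h : QuantumRel c x y) (hspan : ∀ v, v ∈ Submodule.span K (Set.range h.mono)) :
    IsOreDomain R where
  left_ore := left_ore_of_growth (k := K) (fun a v w => smul_mul_assoc a v w) (RingHom.id R)
    Function.injective_id h.filtration h.finiteDimensional_filtration h.one_mem_filtration
    (fun _ _ _ _ => h.mul_mem_filtration) h.filtration_mono (h.exists_mem_filtration hspan)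
    h.finrank_filtration_le
    (fun a => ⟨1, one_ne_zero, ⟨(1 : K) • (1 : R), rfl⟩, ⟨((1 : K) * a) • (1 : R), rfl⟩⟩)
  right_ore a b ha hb := by
    let e : R ≃ₗ[K] Rᵐᵒᵖ := MulOpposite.opLinearEquiv K
    let B : ℕ → Submodule K Rᵐᵒᵖ := fun n => (h.filtration n).map (e : R →ₗ[K] Rᵐᵒᵖ)
    have hB : ∀ n v, v ∈ B n ↔ v.unop ∈ h.filtration n := fun n v => by
      constructor
      · rintro ⟨w, hw, rfl⟩; exact hw
      · intro hv; exact ⟨v.unop, hv, rfl⟩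
    obtain ⟨c, d, h1, h2⟩ := left_ore_of_growth (k := K) (R := Rᵐᵒᵖ) (V := Rᵐᵒᵖ)
      (fun a v w => smul_mul_assoc a v w) (RingHom.id _) Function.injective_id B
      (fun n => by
        have := h.finiteDimensional_filtration n
        exact Module.Finite.map _ _)
      ((hB 0 _).mpr h.one_mem_filtration)
      (fun n m v w hv hw => (hB _ _).mpr (by
        rw [MulOpposite.unop_mul, add_comm]
        exact h.mul_mem_filtration ((hB _ _).mp hw) ((hB _ _).mp hv)))
      (fun n m hnm => Submodule.map_mono (h.filtration_mono hnm))
      (fun v => by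
        obtain ⟨n, hn⟩ := h.exists_mem_filtration hspan v.unop
        exact ⟨n, (hB n v).mpr hn⟩)
      (fun n => by
        have := h.finiteDimensional_filtration n
        exact (Submodule.finrank_map_le _ _).trans (h.finrank_filtration_le n))
      (fun a => ⟨1, one_ne_zero, ⟨(1 : K) • (1 : Rᵐᵒᵖ), rfl⟩, ⟨((1 : K) * a) • (1 : Rᵐᵒᵖ), rfl⟩⟩)
      (MulOpposite.op a) (MulOpposite.op b) (by simpa using ha) (by simpa using hb)
    refine ⟨c.unop, d.unop, ?_, fun h0 => h2 ?_⟩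
    · simpa using congrArg MulOpposite.unop h1
    · apply MulOpposite.unop_injective; simpa using h0

/-- Elements of a division ring which satisfy the relations of the quantum affine algebra, over a
subfield with which they commute, give an embedding of the quantum affine algebra. -/
theorem QuantumAffine.exists_embedding {F : Type*} [Field F] [Algebra F K] {D : Type*}
    [DivisionRing D] [Algebra F D] (j : K →ₐ[F] D) {x y : ι → D}
    (hjx : ∀ a i, Commute (j a) (x i)) (hjy : ∀ a i, Commute (j a) (y i))
    (hxx : ∀ i k, Commute (x i) (x k)) (hyy : ∀ i k, Commute (y i) (y k))
    (hyx : ∀ i, y i * x i = j (c i) * (x i * y i)) (hyx' : ∀ i k, i ≠ k → Commute (y i) (x k))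
    (hc0 : ∀ i, c i ≠ 0) (hc : ∀ i n, 0 < n → c i ^ n ≠ 1)
    (hx : ∀ i, x i ≠ 0) (hy : ∀ i, y i ≠ 0) :
    IsOreDomain (QuantumAffine c) ∧ ∃ φ : QuantumAffine c →ₐ[F] D, Function.Injective φ ∧
      ∀ E : Subfield D, (∀ v, φ v ∈ E) ↔
        (∀ a, j a ∈ E) ∧ (∀ i, x i ∈ E) ∧ ∀ i, y i ∈ E := by
  -- The image of K need not be central in D, so D is not a K-algebra through `j`. Its centralizer
  -- is one, and it contains all the x i and y i.
  let Z : Subring D := Subring.centralizer (Set.range j)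
  have hjZ : ∀ a, j a ∈ Z := fun a => Subring.mem_centralizer_iff.mpr <| by
    rintro _ ⟨b, rfl⟩
    rw [← map_mul, mul_comm, map_mul]
  let jZ : K →+* Z := (j : K →+* D).codRestrict Z hjZ
  let _ : Algebra K Z := jZ.toAlgebra' fun a z => Subtype.ext
    (Subring.mem_centralizer_iff.mp z.2 _ ⟨a, rfl⟩)
  have hsm : ∀ (a : K) (z : Z), ((a • z : Z) : D) = j a * z := fun a z => by
    rw [Algebra.smul_def]; rfl
  let x' : ι → Z := fun i => ⟨x i, Subring.mem_centralizer_iff.mpr <| by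
    rintro _ ⟨b, rfl⟩; exact hjx b i⟩
  let y' : ι → Z := fun i => ⟨y i, Subring.mem_centralizer_iff.mpr <| by
    rintro _ ⟨b, rfl⟩; exact hjy b i⟩
  have h : QuantumRel c x' y' :=
    { xx := fun i k => Subtype.ext (hxx i k)
      yy := fun i k => Subtype.ext (hyy i k)
      yx_same := fun i => Subtype.ext ((hyx i).trans (hsm (c i) (x' i * y' i)).symm)
      yx_ne := fun i k hik => Subtype.ext (hyx' i k hik) }
  have hinj := QuantumAffine.lift_injective h hc0 hc (fun i h0 => hx i (congrArg Subtype.val h0))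
    fun i h0 => hy i (congrArg Subtype.val h0)
  have : IsDomain (QuantumAffine c) := hinj.isDomain (QuantumAffine.lift h).toRingHom
  refine ⟨(QuantumAffine.quantumRel c).isOreDomain QuantumAffine.mem_span_mono, ?_⟩
  have hφK : ∀ a : K, ((QuantumAffine.lift h (algebraMap K _ a) : Z) : D) = j a := fun a => by
    rw [AlgHom.commutes]; rfl
  let φ : QuantumAffine c →ₐ[F] D :=
    { (Z.subtype.comp (QuantumAffine.lift h : QuantumAffine c →+* Z)) with
      commutes' := fun r => (hφK (algebraMap F K r)).trans (j.commutes r) }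
  have hφ : ∀ v, φ v = (QuantumAffine.lift h v : D) := fun v => rfl
  refine ⟨φ, fun a b hab => hinj (Subtype.ext hab), fun E => ⟨fun hE => ⟨fun a => ?_, fun i => ?_,
    fun i => ?_⟩, fun ⟨h1, h2, h3⟩ v => ?_⟩⟩
  · rw [← hφK]; exact hE _
  · have := hE (QuantumAffine.gen c (Sum.inl i))
    rwa [hφ, QuantumAffine.lift_gen] at this
  · have := hE (QuantumAffine.gen c (Sum.inr i))
    rwa [hφ, QuantumAffine.lift_gen] at this
  · rw [hφ]
    have hmono : ∀ (z : ι → Z) (hz), (∀ i, (z i : D) ∈ E) →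
        ∀ a, (commMonomial z hz a : D) ∈ E := by
      intro z hz hzE
      refine mem_submonoid_of_mulSingle (E.toSubmonoid.comap
        ((Z.subtype : Z →* D).comp (commMonomial z hz))) fun i n => ?_
      change ((commMonomial z hz (Pi.mulSingle i n) : Z) : D) ∈ E
      rw [commMonomial_mulSingle]
      exact pow_mem (hzE i) _
    induction QuantumAffine.mem_span_mono v using Submodule.span_induction with
    | mem v hv =>
      obtain ⟨m, rfl⟩ := hv
      rw [QuantumAffine.lift_mono]
      exact mul_mem (hmono x' h.xx h2 _) (hmono y' h.yy h3 _)
    | zero => rw [map_zero]; exact zero_mem E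
    | add a b _ _ ha hb => rw [map_add]; exact add_mem ha hb
    | smul t a _ ha => rw [map_smul, hsm]; exact mul_mem (h1 t) ha

end QuantumAffineEmbedding

/-! ### Division rings of fractions as division subrings of a given division ring. -/

section FractionRings

/-- The extension of an embedding of an Ore domain in a division ring to the division ring of
fractions. -/
theorem exists_frac_hom {F : Type*} [Field F] {A : Type u} [Ring A] [Algebra F A] [IsOreDomain A]
    {D : Type*} [DivisionRing D] [Algebra F D] (f : A →ₐ[F] D) (hf : Function.Injective f) :
    ∃ g : Frac A →ₐ[F] D, Function.Injective g ∧
      (g.range : Set D) = Subfield.closure (Set.range f) := by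
  have hne : ∀ s : A⁰, f s ≠ 0 := fun s h0 =>
    nonZeroDivisors.ne_zero s.2 (hf (h0.trans (map_zero f).symm))
  let fS : A⁰ →* Dˣ :=
    { toFun := fun s => Units.mk0 (f s) (hne s)
      map_one' := Units.ext (map_one f)
      map_mul' := fun s t => Units.ext (map_mul f _ _) }
  let φ : Frac A →+* D := OreLocalization.universalHom (f : A →+* D) fS fun _ => rfl
  have hφ : ∀ a s, φ (a /ₒ s) = (f s)⁻¹ * f a := fun a s => by
    have := OreLocalization.universalHom_apply (f : A →+* D) fS (fun _ => rfl) (r := a) (s := s)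
    rw [Units.val_inv_eq_inv_val] at this
    exact this
  have hφ1 : ∀ a, φ (a /ₒ 1) = f a := fun a => by
    rw [hφ, OneMemClass.coe_one, map_one, inv_one, one_mul]
  let g : Frac A →ₐ[F] D :=
    { φ with
      commutes' := fun t => (hφ1 (algebraMap F A t)).trans (f.commutes t) }
  refine ⟨g, φ.injective, Set.Subset.antisymm ?_ ?_⟩
  · rintro _ ⟨z, rfl⟩
    induction z using OreLocalization.ind with
    | _ a s =>
      change φ _ ∈ _
      rw [hφ]
      exact mul_mem (inv_mem (Subfield.subset_closure (Set.mem_range_self _)))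
        (Subfield.subset_closure (Set.mem_range_self _))
  · have : Subfield.closure (Set.range f) ≤ φ.fieldRange := by
      refine Subfield.closure_le.mpr ?_
      rintro _ ⟨a, rfl⟩
      exact ⟨a /ₒ 1, hφ1 a⟩
    intro d hd
    obtain ⟨z, hz⟩ := this hd
    exact ⟨z, hz⟩

/-- Each fraction ring is the division subring generated by the image. `hfg` says that the same
division subrings contain the two images, so the generated ones coincide, and no map between A and B
is needed. -/
theorem nonempty_frac_equiv {F : Type*} [Field F] {A B : Type u} [Ring A] [Algebra F A]
    [IsOreDomain A] [Ring B] [Algebra F B] [IsOreDomain B]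
    {D : Type*} [DivisionRing D] [Algebra F D] (f : A →ₐ[F] D) (hf : Function.Injective f)
    (g : B →ₐ[F] D) (hg : Function.Injective g)
    (hfg : ∀ E : Subfield D, (∀ a, f a ∈ E) ↔ ∀ b, g b ∈ E) :
    Nonempty (Frac A ≃ₐ[F] Frac B) := by
  obtain ⟨f', hf', hfr⟩ := exists_frac_hom f hf
  obtain ⟨g', hg', hgr⟩ := exists_frac_hom g hg
  have h : f'.range = g'.range := by
    apply SetLike.coe_injective
    rw [hfr, hgr]
    congr 1
    apply le_antisymm
    · refine Subfield.closure_le.mpr ?_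
      rintro _ ⟨a, rfl⟩
      exact (hfg _).mpr (fun b => Subfield.subset_closure (Set.mem_range_self b)) a
    · refine Subfield.closure_le.mpr ?_
      rintro _ ⟨a, rfl⟩
      exact (hfg _).mp (fun b => Subfield.subset_closure (Set.mem_range_self b)) a
  exact ⟨(AlgEquiv.ofInjective f' hf').trans ((Subalgebra.equivOfEq _ _ h).trans
    (AlgEquiv.ofInjective g' hg').symm)⟩

end FractionRings
end
end QuantumOGZ

namespace QuantumOGZ

noncomputable section

open Polynomial

/-! ### The rational function field and its monomial automorphisms. -/

section RationalFunctions

variable {F : Type u} [Field F] {I : Type}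

theorem extendHom_algebraMap (e : MvPolynomial I F ≃ₐ[F] MvPolynomial I F) (f : MvPolynomial I F) :
    extendHom F e (algebraMap _ (RatFun F I) f) = algebraMap _ (RatFun F I) (e f) :=
  IsFractionRing.fieldEquivOfAlgEquiv_algebraMap _ _ _ _ _

theorem extendHom_scaleHom_xvar (c : I → Fˣ) (i : I) :
    extendHom F (scaleHom c) (xvar F i) = (c i : F) • xvar F i := by
  rw [xvar, extendHom_algebraMap, Algebra.smul_def, IsScalarTower.algebraMap_apply F (MvPolynomial I F),
    ← map_mul]
  congr 1
  simp [scaleHom, scaleEnd, MvPolynomial.algebraMap_eq]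

theorem monomialAut_xvar (σ : Equiv.Perm I) (c : I → Fˣ) (i : I) :
    monomialAut σ c (xvar F i) = (c i : F) • xvar F (σ i) := by
  rw [xvar, monomialAut, extendHom_algebraMap, Algebra.smul_def, xvar,
    IsScalarTower.algebraMap_apply F (MvPolynomial I F), ← map_mul]
  congr 1
  simp [scaleHom, scaleEnd, MvPolynomial.algebraMap_eq]

theorem shift_smul_xvar (q : Fˣ) (a : I → ℤ) (i : I) :
    ShiftGroup.of q a • xvar F i = ((q ^ (-a i) : Fˣ) : F) • xvar F i :=
  extendHom_scaleHom_xvar _ _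

theorem xvar_ne_zero (i : I) : xvar F i ≠ 0 := by
  rw [xvar, ne_eq, FaithfulSMul.algebraMap_eq_zero_iff]
  exact MvPolynomial.X_ne_zero i

theorem isTranscendenceBasis_xvar : IsTranscendenceBasis F (xvar F : I → RatFun F I) := by
  have : Algebra.IsAlgebraic (MvPolynomial I F) (RatFun F I) :=
    IsLocalization.isAlgebraic _ (nonZeroDivisors (MvPolynomial I F))
  exact (IsTranscendenceBasis.mvPolynomial I F).algebraMap_comp

theorem adjoin_range_xvar :
    IntermediateField.adjoin F (Set.range (xvar F : I → RatFun F I)) = ⊤ := by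
  have h : ∀ f : MvPolynomial I F, algebraMap _ (RatFun F I) f ∈
      IntermediateField.adjoin F (Set.range (xvar F : I → RatFun F I)) := by
    intro f
    induction f using MvPolynomial.induction_on with
    | C a =>
      rw [← MvPolynomial.algebraMap_eq, ← IsScalarTower.algebraMap_apply]
      exact IntermediateField.algebraMap_mem _ a
    | add f g hf hg => rw [map_add]; exact add_mem hf hg
    | mul_X f i hf =>
      rw [map_mul]
      exact mul_mem hf (IntermediateField.subset_adjoin _ _ (Set.mem_range_self i))
  rw [eq_top_iff]
  intro x _
  obtain ⟨a, b, -, rfl⟩ := IsFractionRing.div_surjective (A := MvPolynomial I F) x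
  exact div_mem (h a) (h b)

theorem algHom_ext_xvar {L : Type*} [Field L] [Algebra F L] {f g : RatFun F I →ₐ[F] L}
    (h : ∀ i, f (xvar F i) = g (xvar F i)) : f = g := by
  refine AlgHom.ext fun x => ?_
  have hx : x ∈ IntermediateField.adjoin F (Set.range (xvar F : I → RatFun F I)) := by
    rw [adjoin_range_xvar]; trivial
  induction hx using IntermediateField.adjoin_induction with
  | mem x hx => obtain ⟨i, rfl⟩ := hx; exact h i
  | algebraMap a => rw [AlgHom.commutes, AlgHom.commutes]
  | add x y _ _ hx hy => rw [map_add, map_add, hx, hy]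
  | inv x _ hx => rw [map_inv₀, map_inv₀, hx]
  | mul x y _ _ hx hy => rw [map_mul, map_mul, hx, hy]

theorem smul_xvar_pow_ne [CharZero F] {i j : I} (hij : i ≠ j) (a : F) {m : ℕ} (hm : 0 < m) :
    xvar F i ^ m ≠ a • xvar F j ^ m := by
  intro h
  rw [xvar, xvar, Algebra.smul_def, IsScalarTower.algebraMap_apply F (MvPolynomial I F),
    ← map_pow, ← map_pow, ← map_mul] at h
  have h := FaithfulSMul.algebraMap_injective _ _ h
  classical
  have := congrArg (MvPolynomial.eval (Pi.single i 1 : I → F)) h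
  simp [hij.symm, hm.ne'] at this

theorem xvar_pow_injective {m : ℕ} (hm : 0 < m) [CharZero F] :
    Function.Injective fun i : I => xvar F i ^ m := by
  intro i j h
  by_contra hij
  exact smul_xvar_pow_ne hij (1 : F) hm (by rw [one_smul]; exact h)

end RationalFunctions

/-! ### The field of invariants of the reflection group. -/

section Invariants

variable {F : Type u} [Field F] {n : ℕ} (m p : ℕ) (r : Fin n → ℕ)

theorem reflAut_xvar (σ : ∀ k, Equiv.Perm (Fin (r k))) (α : ∀ k, Fin (r k) → Fˣ) (k : Fin n)
    (i : Fin (r k)) :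
    reflAut r σ α (xvar F ⟨k, i⟩) = (α k i : F) • xvar F ⟨k, σ k i⟩ := by
  rw [reflAut, monomialAut_xvar]; rfl

/-- The `m`-th powers of the variables in row `k`. -/
def rowNode (F : Type u) [Field F] (k : Fin n) (i : Fin (r k)) : RatFun F (Idx r) :=
  xvar F ⟨k, i⟩ ^ m

/-- The monic polynomial with roots the `m`-th powers of the variables in row `k`. -/
def rowPoly (F : Type u) [Field F] (k : Fin n) : (RatFun F (Idx r))[X] :=
  Lagrange.nodal Finset.univ (rowNode m r F k)

/-- The `m / p`-th power of the product of the variables in row `k`. -/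
def rowProd (F : Type u) [Field F] (k : Fin n) : RatFun F (Idx r) :=
  (∏ i : Fin (r k), xvar F ⟨k, i⟩) ^ (m / p)

/-- The generators of the field of invariants: those of row `k` are `rowProd k` and the
coefficients of `rowPoly k` of degrees `1, …, r k - 1`. -/
def invGen (F : Type u) [Field F] (t : Idx r) : RatFun F (Idx r) :=
  if (t.2 : ℕ) = 0 then rowProd m p r F t.1 else (rowPoly m r F t.1).coeff t.2

/-- The field of invariants. -/
def invField (F : Type u) [Field F] : IntermediateField F (RatFun F (Idx r)) :=
  IntermediateField.adjoin F (Set.range (invGen m p r F))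

variable {m p r}

theorem rowNode_ne_zero (k : Fin n) (i : Fin (r k)) : rowNode m r F k i ≠ 0 :=
  pow_ne_zero _ (xvar_ne_zero _)

theorem rowNode_injective [CharZero F] (hm : 0 < m) (k : Fin n) :
    Function.Injective (rowNode m r F k) := fun i j h => by
  have := xvar_pow_injective hm h
  simpa using this

theorem rowProd_ne_zero (k : Fin n) : rowProd m p r F k ≠ 0 :=
  pow_ne_zero _ (Finset.prod_ne_zero_iff.mpr fun _ _ => xvar_ne_zero _)

/-- Since (m/p) p = m, the constant coefficient is a power of `rowProd` up to sign; this is why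
`invGen` can use `rowProd` in its place. -/
theorem rowPoly_coeff_zero (hpm : p ∣ m) (k : Fin n) :
    (rowPoly m r F k).coeff 0 = (-1) ^ r k * rowProd m p r F k ^ p := by
  rw [rowPoly, coeff_zero_eq_eval_zero, Lagrange.eval_nodal, rowProd, ← pow_mul,
    Nat.div_mul_cancel hpm, ← Finset.prod_pow]
  simp only [zero_sub, rowNode]
  rw [Finset.prod_neg, Finset.card_univ, Fintype.card_fin]

theorem rowPoly_natDegree (k : Fin n) : (rowPoly m r F k).natDegree = r k := by
  rw [rowPoly, Lagrange.natDegree_nodal, Finset.card_univ, Fintype.card_fin]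

theorem rowPoly_monic (k : Fin n) : (rowPoly m r F k).Monic := Lagrange.nodal_monic

theorem rowProd_mem_adjoin (hr : ∀ k, 0 < r k) (k : Fin n) :
    rowProd m p r F k ∈ Algebra.adjoin F (Set.range (invGen m p r F)) := by
  refine Algebra.subset_adjoin ⟨⟨k, ⟨0, hr k⟩⟩, ?_⟩
  simp [invGen]

theorem rowPoly_coeff_mem_adjoin (hpm : p ∣ m) (hr : ∀ k, 0 < r k) (k : Fin n) (l : ℕ) :
    (rowPoly m r F k).coeff l ∈ Algebra.adjoin F (Set.range (invGen m p r F)) := by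
  rcases Nat.eq_zero_or_pos l with rfl | hl
  · rw [rowPoly_coeff_zero hpm]
    exact mul_mem (pow_mem (neg_mem (one_mem _)) _) (pow_mem (rowProd_mem_adjoin hr k) _)
  rcases lt_trichotomy l (r k) with hlt | rfl | hgt
  · refine Algebra.subset_adjoin ⟨⟨k, ⟨l, hlt⟩⟩, ?_⟩
    simp [invGen, hl.ne']
  · have := rowPoly_monic (F := F) (m := m) (r := r) k
    rw [Monic, leadingCoeff, rowPoly_natDegree] at this
    rw [this]; exact one_mem _
  · rw [coeff_eq_zero_of_natDegree_lt (by rwa [rowPoly_natDegree])]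
    exact zero_mem _

theorem adjoin_le_invField :
    ∀ x ∈ Algebra.adjoin F (Set.range (invGen m p r F)), x ∈ invField m p r F := fun _ hx =>
  IntermediateField.algebra_adjoin_le_adjoin _ _ hx

theorem rowProd_mem (hr : ∀ k, 0 < r k) (k : Fin n) : rowProd m p r F k ∈ invField m p r F :=
  adjoin_le_invField _ (rowProd_mem_adjoin hr k)

theorem rowPoly_coeff_mem (hpm : p ∣ m) (hr : ∀ k, 0 < r k) (k : Fin n) (l : ℕ) :
    (rowPoly m r F k).coeff l ∈ invField m p r F :=
  adjoin_le_invField _ (rowPoly_coeff_mem_adjoin hpm hr k l)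

theorem reflAut_rowNode {σ : ∀ k, Equiv.Perm (Fin (r k))} {α : ∀ k, Fin (r k) → Fˣ}
    (hα : ∀ k, α k ∈ groupA F m p (r k)) (k : Fin n) (i : Fin (r k)) :
    reflAut r σ α (rowNode m r F k i) = rowNode m r F k (σ k i) := by
  rw [rowNode, map_pow, reflAut_xvar, _root_.smul_pow, ← Units.val_pow_eq_pow_val, (hα k).1,
    Units.val_one, one_smul, rowNode]

theorem reflAut_rowProd {σ : ∀ k, Equiv.Perm (Fin (r k))} {α : ∀ k, Fin (r k) → Fˣ}
    (hα : ∀ k, α k ∈ groupA F m p (r k)) (k : Fin n) :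
    reflAut r σ α (rowProd m p r F k) = rowProd m p r F k := by
  rw [rowProd, map_pow, map_prod]
  simp only [reflAut_xvar]
  rw [Finset.prod_smul, _root_.smul_pow, ← Units.coe_prod, ← Units.val_pow_eq_pow_val, (hα k).2,
    Units.val_one, one_smul]
  exact congrArg (· ^ (m / p)) (Equiv.prod_comp (σ k) fun i => xvar F (⟨k, i⟩ : Idx r))

theorem reflAut_rowPoly {σ : ∀ k, Equiv.Perm (Fin (r k))} {α : ∀ k, Fin (r k) → Fˣ}
    (hα : ∀ k, α k ∈ groupA F m p (r k)) (k : Fin n) :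
    (rowPoly m r F k).map (reflAut r σ α : RatFun F (Idx r) →+* RatFun F (Idx r)) =
      rowPoly m r F k := by
  simp only [rowPoly, Lagrange.nodal_eq, Polynomial.map_prod, Polynomial.map_sub,
    Polynomial.map_X, Polynomial.map_C, RingHom.coe_coe, reflAut_rowNode hα]
  exact Equiv.prod_comp (σ k) fun i => X - C (rowNode m r F k i)

theorem xvar_mem_laurent (t : Idx r) : xvar F t ∈ laurent F r :=
  Algebra.subset_adjoin (Or.inl (Set.mem_range_self t))

theorem coeff_nodal_mem {R S : Type*} [CommRing R] [SetLike S R] [SubringClass S R] (A : S)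
    {ι : Type*} (s : Finset ι) (z : ι → R) (hz : ∀ i, z i ∈ A) (l : ℕ) :
    (Lagrange.nodal s z).coeff l ∈ A := by
  classical
  induction s using Finset.induction_on generalizing l with
  | empty =>
    rw [Lagrange.nodal_empty, coeff_one]
    split_ifs
    exacts [one_mem _, zero_mem _]
  | insert a s ha ih =>
    rw [Lagrange.nodal_insert_eq_nodal ha, sub_mul, coeff_sub, coeff_C_mul]
    refine sub_mem ?_ (mul_mem (hz a) (ih l))
    rcases l with _ | l
    · rw [coeff_X_mul_zero]; exact zero_mem _
    · rw [coeff_X_mul]; exact ih l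

theorem invGen_mem_invariants (t : Idx r) : invGen m p r F t ∈ invariants F m p r := by
  rw [invGen]
  split_ifs
  · exact ⟨pow_mem (prod_mem fun i _ => xvar_mem_laurent _) _,
      fun σ α hα => reflAut_rowProd hα _⟩
  · refine ⟨coeff_nodal_mem _ _ _ (fun i => pow_mem (xvar_mem_laurent _) _) _,
      fun σ α hα => ?_⟩
    have := congrArg (fun f => coeff f t.2) (reflAut_rowPoly (σ := σ) hα t.1)
    simp only [coeff_map] at this
    exact this

theorem adjoin_invGen_le_invariants :
    Algebra.adjoin F (Set.range (invGen m p r F)) ≤ invariants F m p r :=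
  Algebra.adjoin_le (by rintro _ ⟨t, rfl⟩; exact invGen_mem_invariants t)

theorem exists_rowPoly_lift (hpm : p ∣ m) (hr : ∀ k, 0 < r k) (k : Fin n) :
    ∃ P : (invField m p r F)[X], P.map (algebraMap _ (RatFun F (Idx r))) = rowPoly m r F k := by
  refine (mem_lifts _).mp ((lifts_iff_coeff_lifts _).mpr fun l => ?_)
  exact ⟨⟨_, rowPoly_coeff_mem hpm hr k l⟩, rfl⟩

variable [CharZero F]

/-- The monic polynomial over the field of invariants with roots the products of the variables in
row `k` and `m`-th roots of unity. -/
theorem exists_annihilator (hm : 0 < m) (hpm : p ∣ m) (hr : ∀ k, 0 < r k) (k : Fin n) :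
    ∃ P : (invField m p r F)[X], P.map (algebraMap _ (RatFun F (Idx r))) =
      ∏ i : Fin (r k), (X ^ m - C (rowNode m r F k i)) ∧ P.Monic := by
  obtain ⟨P, hP⟩ := exists_rowPoly_lift (F := F) hpm hr k
  have h1 : (expand _ m P).map (algebraMap _ (RatFun F (Idx r))) =
      ∏ i : Fin (r k), (X ^ m - C (rowNode m r F k i)) := by
    rw [map_expand, hP, rowPoly, Lagrange.nodal_eq, map_prod]
    simp
  refine ⟨_, h1, ?_⟩
  have hP1 : P.Monic := by
    apply Polynomial.monic_of_injective (FaithfulSMul.algebraMap_injective _ (RatFun F (Idx r)))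
    rw [hP]; exact rowPoly_monic k
  exact hP1.expand hm

theorem xvar_isIntegral (hm : 0 < m) (hpm : p ∣ m) (hr : ∀ k, 0 < r k) (t : Idx r) :
    IsIntegral (invField m p r F) (xvar F t) := by
  obtain ⟨P, hP, hP1⟩ := exists_annihilator (F := F) hm hpm hr t.1
  refine ⟨P, hP1, ?_⟩
  rw [← eval_map, hP, eval_prod]
  exact Finset.prod_eq_zero (Finset.mem_univ t.2) (by simp [rowNode])

theorem adjoin_xvar_eq_top :
    IntermediateField.adjoin (invField m p r F) (Set.range (xvar F : Idx r → RatFun F (Idx r))) = ⊤ := by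
  rw [eq_top_iff]
  intro x hx0
  clear hx0
  have hx : x ∈ IntermediateField.adjoin F (Set.range (xvar F : Idx r → RatFun F (Idx r))) := by
    rw [adjoin_range_xvar]; trivial
  induction hx using IntermediateField.adjoin_induction with
  | mem x hx => exact IntermediateField.subset_adjoin _ _ hx
  | algebraMap a =>
    exact IntermediateField.algebraMap_mem _ (algebraMap F (invField m p r F) a)
  | add x y _ _ hx hy => exact add_mem hx hy
  | inv x _ hx => exact inv_mem hx
  | mul x y _ _ hx hy => exact mul_mem hx hy

theorem finiteDimensional_invField (hm : 0 < m) (hpm : p ∣ m) (hr : ∀ k, 0 < r k) :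
    FiniteDimensional (invField m p r F) (RatFun F (Idx r)) := by
  have := IntermediateField.finiteDimensional_adjoin (K := invField m p r F)
    (S := Set.range (xvar F : Idx r → RatFun F (Idx r))) (by
      rintro _ ⟨t, rfl⟩; exact xvar_isIntegral hm hpm hr t)
  rw [adjoin_xvar_eq_top] at this
  exact Module.Finite.equiv
    (IntermediateField.topEquiv (F := invField m p r F) (E := RatFun F (Idx r))).toLinearEquiv

/-- The variables are roots of polynomials over the invariants that split because F contains the
m-th roots of unity; separability is automatic in characteristic zero. -/
theorem isGalois_invField (hm : 0 < m) (hpm : p ∣ m) (hr : ∀ k, 0 < r k) {ζ : F}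
    (hζ : IsPrimitiveRoot ζ m) : IsGalois (invField m p r F) (RatFun F (Idx r)) := by
  have := finiteDimensional_invField (F := F) hm hpm hr
  have : Normal (invField m p r F) (RatFun F (Idx r)) := by
    refine ⟨fun x => ?_⟩
    have hx : x ∈ IntermediateField.adjoin (invField m p r F) (Set.range (xvar F : Idx r → RatFun F (Idx r))) := by
      rw [adjoin_xvar_eq_top]; trivial
    refine IntermediateField.splits_of_mem_adjoin _ _ ?_ hx
    rintro _ ⟨t, rfl⟩
    refine ⟨xvar_isIntegral hm hpm hr t, ?_⟩
    obtain ⟨P, hP, hP1⟩ := exists_annihilator (F := F) hm hpm hr t.1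
    have hPs : (P.map (algebraMap _ (RatFun F (Idx r)))).Splits := by
      rw [hP]
      refine Splits.prod fun i _ => ?_
      exact X_pow_sub_C_splits_of_isPrimitiveRoot
        (hζ.map_of_injective (algebraMap F (RatFun F (Idx r))).injective) rfl
    refine hPs.of_dvd (hP1.map _).ne_zero (Polynomial.map_dvd _ (minpoly.dvd _ _ ?_))
    rw [aeval_def, ← eval_map, hP, eval_prod]
    exact Finset.prod_eq_zero (Finset.mem_univ t.2) (by simp [rowNode])
  exact ⟨⟩

/-- An automorphism over the invariants permutes the m-th powers in each row, so it sends a variable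
to a root of unity times another variable of its row. Fixing `rowProd` is precisely the condition on
the product of these roots. -/
theorem exists_reflAut_eq (hm : 0 < m) (hpm : p ∣ m) (hr : ∀ k, 0 < r k) {ζ : F}
    (hζ : IsPrimitiveRoot ζ m) (g : RatFun F (Idx r) ≃ₐ[invField m p r F] RatFun F (Idx r)) :
    ∃ (σ : ∀ k, Equiv.Perm (Fin (r k))) (α : ∀ k, Fin (r k) → Fˣ),
      (∀ k, α k ∈ groupA F m p (r k)) ∧ ∀ x, g x = reflAut r σ α x := by
  have hg : ∀ x ∈ invField m p r F, g x = x := fun x hx => g.commutes ⟨x, hx⟩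
  have hnode : ∀ t : Idx r, ∃ i, g (xvar F t) ^ m = rowNode m r F t.1 i := by
    intro t
    obtain ⟨P, hP, hP1⟩ := exists_annihilator (F := F) hm hpm hr t.1
    have h1 : aeval (g (xvar F t)) P = 0 := by
      have h2 : aeval (xvar F t) P = 0 := by
        rw [aeval_def, ← eval_map, hP, eval_prod]
        exact Finset.prod_eq_zero (Finset.mem_univ t.2) (by simp [rowNode])
      have := aeval_algHom_apply g.toAlgHom (xvar F t) P
      rw [h2, map_zero] at this
      exact this
    rw [aeval_def, ← eval_map, hP, eval_prod, Finset.prod_eq_zero_iff] at h1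
    obtain ⟨i, -, hi⟩ := h1
    exact ⟨i, by simpa [sub_eq_zero] using hi⟩
  choose s hs using show ∀ k (i : Fin (r k)), ∃ i' : Fin (r k),
    g (xvar F ⟨k, i⟩) ^ m = rowNode m r F k i' from fun k i => hnode ⟨k, i⟩
  have hs_inj : ∀ k, Function.Injective fun i => s k i := by
    intro k i j hij
    have h1 := hs k i
    have h2 := hs k j
    simp only at hij h1 h2
    rw [hij, ← h2, ← map_pow, ← map_pow] at h1
    exact rowNode_injective hm k (g.injective h1)
  let σ : ∀ k, Equiv.Perm (Fin (r k)) := fun k =>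
    Equiv.ofBijective _ (Finite.injective_iff_bijective.mp (hs_inj k))
  have hσ : ∀ k i, σ k i = s k i := fun k i => rfl
  have hα : ∀ t : Idx r, ∃ a : Fˣ, a ^ m = 1 ∧
      g (xvar F t) = (a : F) • xvar F ⟨t.1, σ t.1 t.2⟩ := by
    intro t
    have hx := xvar_ne_zero (F := F) (⟨t.1, σ t.1 t.2⟩ : Idx r)
    have h1 : (g (xvar F t) / xvar F ⟨t.1, σ t.1 t.2⟩) ^ m = 1 := by
      rw [div_pow, hs t.1 t.2, rowNode, hσ, div_self (pow_ne_zero _ (xvar_ne_zero _))]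
    have : NeZero m := ⟨hm.ne'⟩
    obtain ⟨i, -, hi⟩ := (hζ.map_of_injective
      (algebraMap F (RatFun F (Idx r))).injective).eq_pow_of_pow_eq_one h1
    refine ⟨Units.mk0 (ζ ^ i) (pow_ne_zero _ (hζ.ne_zero hm.ne')), Units.ext ?_, ?_⟩
    · rw [Units.val_pow_eq_pow_val, Units.val_mk0, ← pow_mul, mul_comm i, pow_mul, hζ.pow_eq_one,
        one_pow, Units.val_one]
    · rw [Units.val_mk0, Algebra.smul_def, map_pow, hi, div_mul_cancel₀ _ hx]
  choose α hα1 hα2 using hα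
  refine ⟨σ, fun k i => α ⟨k, i⟩, fun k => ⟨fun i => hα1 _, ?_⟩, fun x => ?_⟩
  · have h1 := hg _ (rowProd_mem hr k)
    rw [rowProd, map_pow, map_prod] at h1
    simp only [hα2] at h1
    rw [Finset.prod_smul, _root_.smul_pow, ← Units.coe_prod, ← Units.val_pow_eq_pow_val,
      show ∏ i, xvar F (⟨k, σ k i⟩ : Idx r) = ∏ i, xvar F (⟨k, i⟩ : Idx r) from
        Equiv.prod_comp (σ k) fun i => xvar F (⟨k, i⟩ : Idx r), Algebra.smul_def] at h1
    have h2 := (mul_eq_right₀ (rowProd_ne_zero (F := F) (m := m) (p := p) k)).mp h1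
    apply Units.ext
    apply (algebraMap F (RatFun F (Idx r))).injective
    rw [h2, Units.val_one, map_one]
  · have := algHom_ext_xvar (F := F) (f := (g.restrictScalars F).toAlgHom)
      (g := (reflAut r σ fun k i => α ⟨k, i⟩).toAlgHom) (fun t =>
        (hα2 t).trans (reflAut_xvar r σ (fun k i => α ⟨k, i⟩) t.1 t.2).symm)
    exact DFunLike.congr_fun this x

/-- Galois descent: every automorphism over `invField` is a reflection automorphism. This replaces
any explicit description of the ring Γ. -/
theorem mem_invField_of_fixed (hm : 0 < m) (hpm : p ∣ m) (hr : ∀ k, 0 < r k) {ζ : F}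
    (hζ : IsPrimitiveRoot ζ m) {x : RatFun F (Idx r)}
    (hx : ∀ (σ : ∀ k, Equiv.Perm (Fin (r k))) (α : ∀ k, Fin (r k) → Fˣ),
      (∀ k, α k ∈ groupA F m p (r k)) → reflAut r σ α x = x) : x ∈ invField m p r F := by
  have := finiteDimensional_invField (F := F) hm hpm hr
  have := isGalois_invField hm hpm hr hζ
  have h : x ∈ (⊥ : IntermediateField (invField m p r F) (RatFun F (Idx r))) := by
    rw [IsGalois.mem_bot_iff_fixed]
    intro g
    obtain ⟨σ, α, hα, hg⟩ := exists_reflAut_eq hm hpm hr hζ g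
    rw [hg, hx σ α hα]
  obtain ⟨y, rfl⟩ := IntermediateField.mem_bot.mp h
  exact y.2

-- The generators are as many as the variables and the whole field is algebraic over them, so they
-- must be algebraically independent.
open scoped IntermediateField.algebraAdjoinAdjoin in
theorem isTranscendenceBasis_invGen (hm : 0 < m) (hpm : p ∣ m) (hr : ∀ k, 0 < r k) :
    IsTranscendenceBasis F (invGen m p r F) := by
  have : FiniteDimensional (IntermediateField.adjoin F (Set.range (invGen m p r F)))
    (RatFun F (Idx r)) := finiteDimensional_invField hm hpm hr
  have : Algebra.IsAlgebraic (Algebra.adjoin F (Set.range (invGen m p r F)))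
      (RatFun F (Idx r)) :=
    Algebra.IsAlgebraic.trans _ (IntermediateField.adjoin F (Set.range (invGen m p r F))) _
  apply Algebra.IsAlgebraic.isTranscendenceBasis_of_lift_le_trdeg_of_finite
  exact isTranscendenceBasis_xvar.lift_cardinalMk_eq_trdeg.le

end Invariants

end
end QuantumOGZ

namespace QuantumOGZ

noncomputable section

open Polynomial

/-! ### Equivariant families and the coefficients of the raising and lowering elements. -/

section Equivariance

variable {F : Type u} [Field F] {n : ℕ} {m p : ℕ} {r : Fin n → ℕ}

variable (m p) in
/-- Families of rational functions, indexed by row `k`, which are permuted by the reflection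
group in the same way as the row. -/
def IsEquivariant {k : Fin n} (b : Fin (r k) → RatFun F (Idx r)) : Prop :=
  ∀ (σ : ∀ k, Equiv.Perm (Fin (r k))) (α : ∀ k, Fin (r k) → Fˣ),
    (∀ k, α k ∈ groupA F m p (r k)) → ∀ i, reflAut r σ α (b i) = b (σ k i)

variable {k : Fin n} {b b' : Fin (r k) → RatFun F (Idx r)}

theorem IsEquivariant.mul (hb : IsEquivariant m p b) (hb' : IsEquivariant m p b') :
    IsEquivariant m p fun i => b i * b' i := fun σ α hα i => by
  rw [map_mul, hb σ α hα, hb' σ α hα]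

theorem IsEquivariant.div (hb : IsEquivariant m p b) (hb' : IsEquivariant m p b') :
    IsEquivariant m p fun i => b i / b' i := fun σ α hα i => by
  rw [map_div₀, hb σ α hα, hb' σ α hα]

theorem IsEquivariant.pow (hb : IsEquivariant m p b) (l : ℕ) :
    IsEquivariant m p fun i => b i ^ l := fun σ α hα i => by
  rw [map_pow, hb σ α hα]

theorem isEquivariant_rowNode : IsEquivariant m p (rowNode m r F k) :=
  fun _ _ hα i => reflAut_rowNode hα k i

theorem isEquivariant_basis_coeff (l : ℕ) :
    IsEquivariant m p fun i => (Lagrange.basis Finset.univ (rowNode m r F k) i).coeff l := by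
  intro σ α hα i
  rw [← RingHom.coe_coe, ← coeff_map]
  congr 1
  rw [Lagrange.basis, Polynomial.map_prod]
  refine Finset.prod_equiv (σ k) (by simp) fun j _ => ?_
  simp only [Lagrange.basisDivisor, Polynomial.map_mul, Polynomial.map_sub, Polynomial.map_X,
    Polynomial.map_C, RingHom.coe_coe, map_inv₀, map_sub, reflAut_rowNode hα]

theorem IsEquivariant.sum_mem [CharZero F] (hm : 0 < m) (hpm : p ∣ m) (hr : ∀ k, 0 < r k) {ζ : F}
    (hζ : IsPrimitiveRoot ζ m) (hb : IsEquivariant m p b) : ∑ i, b i ∈ invField m p r F := by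
  refine mem_invField_of_fixed hm hpm hr hζ fun σ α hα => ?_
  rw [map_sum]
  simp only [hb σ α hα]
  exact Equiv.sum_comp (σ k) b

/-- An equivariant family is given by a polynomial over the field of invariants. -/
theorem IsEquivariant.exists_sum_pow [CharZero F] (hm : 0 < m) (hpm : p ∣ m) (hr : ∀ k, 0 < r k)
    {ζ : F} (hζ : IsPrimitiveRoot ζ m) (hb : IsEquivariant m p b) :
    ∃ a : ℕ → RatFun F (Idx r), (∀ l, a l ∈ invField m p r F) ∧
      ∀ i, b i = ∑ l ∈ Finset.range (r k), a l * rowNode m r F k i ^ l := by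
  -- These are the coefficients of the polynomial interpolating b at the nodes; each is a sum over
  -- an equivariant family and hence invariant.
  refine ⟨fun l => ∑ i, b i * (Lagrange.basis Finset.univ (rowNode m r F k) i).coeff l,
    fun l => (hb.mul (isEquivariant_basis_coeff l)).sum_mem hm hpm hr hζ, fun i => ?_⟩
  have hinj := rowNode_injective (F := F) (r := r) hm k
  simp only [Finset.sum_mul]
  rw [Finset.sum_comm]
  have hdeg : ∀ j, (Lagrange.basis Finset.univ (rowNode m r F k) j).natDegree < r k := by
    intro j
    have h0 : Lagrange.basis Finset.univ (rowNode m r F k) j ≠ 0 :=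
      Lagrange.basis_ne_zero hinj.injOn (Finset.mem_univ j)
    rw [natDegree_lt_iff_degree_lt h0, Lagrange.degree_basis hinj.injOn (Finset.mem_univ j),
      Finset.card_univ, Fintype.card_fin]
    exact_mod_cast Nat.sub_lt (hr k) one_pos
  have : ∀ j, ∑ l ∈ Finset.range (r k), b j *
      (Lagrange.basis Finset.univ (rowNode m r F k) j).coeff l * rowNode m r F k i ^ l =
      if i = j then b j else 0 := by
    intro j
    simp only [mul_assoc]
    rw [← Finset.mul_sum, ← eval_eq_sum_range' (hdeg j)]
    split_ifs with hij
    · subst hij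
      rw [Lagrange.eval_basis_self hinj.injOn (Finset.mem_univ _), mul_one]
    · rw [Lagrange.eval_basis_of_ne (Ne.symm hij) (Finset.mem_univ _), mul_zero]
  simp only [this]
  simp

theorem prod_rows_eq (P : Fin n → Prop) [DecidablePred P] :
    (∏ t ∈ Finset.univ.filter fun t : Idx r => P t.1, xvar F t) ^ (m / p) =
      ∏ k, if P k then rowProd m p r F k else 1 := by
  rw [Finset.prod_filter, Fintype.prod_sigma, ← Finset.prod_pow]
  refine Finset.prod_congr rfl fun k _ => ?_
  by_cases h : P k
  · simp [h, rowProd]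
  · simp [h]

/-- The constant in the denominator of `qBracket`. -/
def qConst (q : Fˣ) (m p : ℕ) : F := (q : F) ^ (-((m / p : ℕ) : ℤ)) * ((q : F) ^ m - 1)

theorem qConst_ne_zero {q : Fˣ} (hq : ∀ k : ℕ, 0 < k → q ^ k ≠ 1) (hm : 0 < m) :
    qConst q m p ≠ 0 := by
  refine mul_ne_zero (zpow_ne_zero _ q.ne_zero) (sub_ne_zero.mpr fun h => hq m hm ?_)
  exact Units.ext (by rw [Units.val_pow_eq_pow_val, h, Units.val_one])

theorem qBracket_xvar (q : Fˣ) {I : Type} (t s : I) :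
    qBracket q m p (xvar F t * (xvar F s)⁻¹) =
      xvar F s ^ (m / p) / (xvar F s ^ m * algebraMap F _ (qConst q m p)) *
        ((xvar F t ^ m - xvar F s ^ m) / xvar F t ^ (m / p)) := by
  have ht := xvar_ne_zero (F := F) t
  have hs := xvar_ne_zero (F := F) s
  rw [qBracket, qConst, zpow_neg, zpow_natCast, mul_pow, mul_pow, inv_pow, inv_pow]
  have h1 := pow_ne_zero (m / p) ht
  have h2 := pow_ne_zero (m / p) hs
  have h3 := pow_ne_zero m hs
  rw [show xvar F t ^ m * (xvar F s ^ m)⁻¹ - 1 = (xvar F t ^ m - xvar F s ^ m) / xvar F s ^ m by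
    field_simp]
  rw [mul_inv, inv_inv, div_mul_div_comm, ← div_eq_inv_mul, div_mul_div_comm, div_div]
  congr 1
  ring

/-- A single (m/p)-th power of a variable is not permuted by the group. The monomial prefactor
cancels all surplus powers of x_{ki} and leaves one factor, which completes the product over the
row; only row products and nodes remain, and these make the equivariance visible. -/
theorem coeffA_eq {q : Fˣ} (hq : ∀ k : ℕ, 0 < k → q ^ k ≠ 1) (hm : 0 < m) [CharZero F]
    (T : Finset (Idx r)) (i : Fin (r k)) :
    coeffA q m p r T k i =
      rowProd m p r F k / (∏ t ∈ T, xvar F t) ^ (m / p) *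
        ((rowNode m r F k i * algebraMap F _ (qConst q m p)) ^ (r k - 1) /
          (rowNode m r F k i * algebraMap F _ (qConst q m p)) ^ T.card) *
        ((∏ t ∈ T, (xvar F t ^ m - rowNode m r F k i)) /
          ∏ j ∈ Finset.univ.erase i, (rowNode m r F k j - rowNode m r F k i)) := by
  have hκ : algebraMap F (RatFun F (Idx r)) (qConst q m p) ≠ 0 := by
    rw [ne_eq, FaithfulSMul.algebraMap_eq_zero_iff]; exact qConst_ne_zero hq hm
  have hx := xvar_ne_zero (F := F) (⟨k, i⟩ : Idx r)
  have hX : xvar F (⟨k, i⟩ : Idx r) ^ (m / p) ≠ 0 := pow_ne_zero _ hx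
  have hw := rowProd_ne_zero (F := F) (m := m) (p := p) (r := r) k
  have hy := mul_ne_zero (rowNode_ne_zero (F := F) (m := m) k i) hκ
  have hW : (∏ t ∈ T, xvar F t) ^ (m / p) ≠ 0 :=
    pow_ne_zero _ (Finset.prod_ne_zero_iff.mpr fun _ _ => xvar_ne_zero _)
  have hD : ∏ j ∈ Finset.univ.erase i, (rowNode m r F k j - rowNode m r F k i) ≠ 0 :=
    Finset.prod_ne_zero_iff.mpr fun j hj => sub_ne_zero.mpr fun h =>
      Finset.ne_of_mem_erase hj (rowNode_injective hm k h)
  have hcard : r k = (r k - 1) + 1 := by have := i.2; omega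
  have hprod : rowProd m p r F k =
      (∏ j ∈ Finset.univ.erase i, xvar F (⟨k, j⟩ : Idx r) ^ (m / p)) *
        xvar F (⟨k, i⟩ : Idx r) ^ (m / p) := by
    rw [Finset.prod_erase_mul _ _ (Finset.mem_univ i), rowProd, Finset.prod_pow]
  have hexp : xvar F (⟨k, i⟩ : Idx r) ^ (-((m / p : ℕ) : ℤ) * ((T.card : ℤ) - (r k : ℤ))) =
      (xvar F (⟨k, i⟩ : Idx r) ^ (m / p)) ^ ((r k - 1) + 1) /
        (xvar F (⟨k, i⟩ : Idx r) ^ (m / p)) ^ T.card := by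
    rw [← hcard, ← pow_mul, ← pow_mul, ← zpow_natCast, ← zpow_natCast, ← zpow_sub₀ hx]
    congr 1
    push_cast
    ring
  simp only [coeffA, qBracket_xvar, Finset.prod_mul_distrib, Finset.prod_const,
    Finset.prod_div_distrib, hexp, Finset.card_erase_of_mem (Finset.mem_univ i), Finset.card_univ,
    Fintype.card_fin, Finset.prod_pow]
  change _ * (((_ / (rowNode m r F k i * _)) ^ _ * ((∏ t ∈ T, (_ - rowNode m r F k i)) / _)) /
    ((_ / (rowNode m r F k i * _)) ^ _ *
      ((∏ j ∈ Finset.univ.erase i, (rowNode m r F k j - rowNode m r F k i)) / _))) = _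
  rw [Finset.prod_pow] at hprod
  have hP : (∏ j ∈ Finset.univ.erase i, xvar F (⟨k, j⟩ : Idx r)) ^ (m / p) ≠ 0 :=
    left_ne_zero_of_mul (hprod ▸ hw)
  rw [hprod]
  generalize (∏ j ∈ Finset.univ.erase i, xvar F (⟨k, j⟩ : Idx r)) ^ (m / p) = P at *
  generalize xvar F (⟨k, i⟩ : Idx r) ^ (m / p) = X at *
  generalize (∏ t ∈ T, xvar F t) ^ (m / p) = W at *
  generalize ∏ j ∈ Finset.univ.erase i, (rowNode m r F k j - rowNode m r F k i) = D at *
  generalize ∏ t ∈ T, (xvar F t ^ m - rowNode m r F k i) = A at *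
  generalize rowNode m r F k i * algebraMap F _ (qConst q m p) = y at *
  generalize r k - 1 = s
  generalize T.card = c
  rw [div_pow, div_pow]
  field_simp
  ring

theorem coeffA_ne_zero {q : Fˣ} (hq : ∀ k : ℕ, 0 < k → q ^ k ≠ 1) (hm : 0 < m) [CharZero F]
    {T : Finset (Idx r)} (hT : ∀ t ∈ T, t.1 ≠ k) (i : Fin (r k)) : coeffA q m p r T k i ≠ 0 := by
  have hκ : algebraMap F (RatFun F (Idx r)) (qConst q m p) ≠ 0 := by
    rw [ne_eq, FaithfulSMul.algebraMap_eq_zero_iff]; exact qConst_ne_zero hq hm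
  have hy := mul_ne_zero (rowNode_ne_zero (F := F) (m := m) k i) hκ
  rw [coeffA_eq hq hm]
  refine mul_ne_zero (mul_ne_zero (div_ne_zero (rowProd_ne_zero k) ?_) ?_) (div_ne_zero ?_ ?_)
  · exact pow_ne_zero _ (Finset.prod_ne_zero_iff.mpr fun _ _ => xvar_ne_zero _)
  · exact div_ne_zero (pow_ne_zero _ hy) (pow_ne_zero _ hy)
  · refine Finset.prod_ne_zero_iff.mpr fun t ht => sub_ne_zero.mpr fun h => hT t ht ?_
    have := xvar_pow_injective hm h
    rw [this]
  · exact Finset.prod_ne_zero_iff.mpr fun j hj => sub_ne_zero.mpr fun h =>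
      Finset.ne_of_mem_erase hj (rowNode_injective hm k h)

theorem isEquivariant_coeffA {q : Fˣ} (hq : ∀ k : ℕ, 0 < k → q ^ k ≠ 1) (hm : 0 < m) [CharZero F]
    (P : Fin n → Prop) [DecidablePred P] :
    IsEquivariant m p (coeffA q m p r (Finset.univ.filter fun t : Idx r => P t.1) k) := by
  intro σ α hα i
  rw [coeffA_eq hq hm, coeffA_eq hq hm, prod_rows_eq]
  simp only [map_mul, map_div₀, map_pow, map_prod, map_sub, reflAut_rowProd hα, reflAut_rowNode hα,
    apply_ite (reflAut r σ α), map_one, AlgEquiv.commutes]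
  congr 2
  · refine Finset.prod_equiv (Equiv.sigmaCongrRight σ) (by simp) fun t _ => ?_
    have := reflAut_rowNode (σ := σ) hα t.1 t.2
    rw [rowNode, map_pow] at this
    rw [this]
    rfl
  · exact Finset.prod_equiv (σ k) (by simp) fun j _ => rfl

end Equivariance

end
end QuantumOGZ

namespace QuantumOGZ

noncomputable section

open scoped nonZeroDivisors
open Polynomial

/-! ### Commutation of rational functions with shifts. -/

section SkewEmbedding

variable {F : Type u} [Field F] {I : Type} {q : Fˣ} {D : Type*} [DivisionRing D] [Algebra F D]

theorem SkewAlg.mono_mul_mono (f f' : RatFun F I) (g g' : ShiftGroup I q) :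
    SkewAlg.mono q f g * SkewAlg.mono q f' g' = SkewAlg.mono q (f * g • f') (g * g') :=
  SkewMonoidAlgebra.single_mul_single

theorem SkewAlg.mono_one : SkewAlg.mono q (1 : RatFun F I) 1 = 1 := rfl

variable (q) in
/-- The embedding of the field of rational functions in the skew group algebra. -/
def ratHom : RatFun F I →ₐ[F] SkewAlg I q where
  toFun f := SkewAlg.mono q f 1
  map_one' := rfl
  map_mul' f f' := by rw [SkewAlg.mono_mul_mono, one_smul, one_mul]
  map_zero' := SkewMonoidAlgebra.single_zero _
  map_add' f f' := SkewMonoidAlgebra.single_add _ _ _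
  commutes' _ := rfl

variable [DecidableEq I]

variable (q) in
/-- The generator `δ^i` of the shift group. -/
def shiftGen (i : I) : ShiftGroup I q := ShiftGroup.of q (Pi.single i 1)

variable (q) in
/-- The automorphism by which rational functions are moved past `δ^i`. -/
def shiftAut (i : I) : RatFun F I ≃ₐ[F] RatFun F I := shiftHom q (shiftGen q i)⁻¹

theorem of_neg_single (i : I) : ShiftGroup.of q (-Pi.single i 1) = (shiftGen q i)⁻¹ := rfl

theorem shiftAut_xvar_self (i : I) : shiftAut q i (xvar F i) = (q : F) • xvar F i := by
  have := shift_smul_xvar q (-Pi.single i 1) i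
  rw [of_neg_single] at this
  refine this.trans ?_
  simp

theorem shiftAut_xvar_of_ne {i k : I} (h : k ≠ i) : shiftAut q i (xvar F k) = xvar F k := by
  have := shift_smul_xvar q (-Pi.single i 1) k
  rw [of_neg_single] at this
  refine this.trans ?_
  simp [h]

theorem ratHom_mul_shift (f : RatFun F I) (i : I) :
    ratHom q f * SkewAlg.mono q 1 (shiftGen q i) =
      SkewAlg.mono q 1 (shiftGen q i) * ratHom q (shiftAut q i f) := by
  change SkewAlg.mono q f 1 * _ = _ * SkewAlg.mono q _ 1
  rw [SkewAlg.mono_mul_mono, SkewAlg.mono_mul_mono, smul_one, mul_one, one_mul, one_mul, mul_one]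
  congr 1
  change f = shiftGen q i • (shiftGen q i)⁻¹ • f
  rw [smul_inv_smul]

theorem shift_mul_shift (g g' : ShiftGroup I q) :
    SkewAlg.mono q (1 : RatFun F I) g * SkewAlg.mono q 1 g' = SkewAlg.mono q 1 (g * g') := by
  rw [SkewAlg.mono_mul_mono, smul_one, one_mul]

theorem shift_commute (g g' : ShiftGroup I q) :
    Commute (SkewAlg.mono q (1 : RatFun F I) g) (SkewAlg.mono q 1 g') := by
  rw [Commute, SemiconjBy, shift_mul_shift, shift_mul_shift, mul_comm]

end SkewEmbedding

/-! ### The quantum OGZ algebra inside the skew group algebra. -/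

section OGZEmbedding

variable {F : Type u} [Field F] {n : ℕ} {m p : ℕ} {r : Fin n → ℕ} {q : Fˣ}

theorem exists_mulLeft_eq (u : quantumOGZ (F := F) q m p r) :
    ∃ v, LinearMap.mulLeft F v = (u : Module.End F (SkewAlg (Idx r) q)) := by
  have h : quantumOGZ (F := F) q m p r ≤ (Algebra.lmul F (SkewAlg (Idx r) q)).range := by
    refine Algebra.adjoin_le ?_
    rintro φ (⟨f, -, rfl⟩ | ⟨k, -, rfl | rfl⟩)
    exacts [⟨_, rfl⟩, ⟨_, rfl⟩, ⟨_, rfl⟩]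
  exact h u.2

variable (F q m p r) in
/-- The quantum OGZ algebra acts by left multiplications by elements of the skew group algebra. -/
def ogzHom : quantumOGZ (F := F) q m p r →ₐ[F] SkewAlg (Idx r) q where
  toFun u := (u : Module.End F (SkewAlg (Idx r) q)) 1
  map_one' := rfl
  map_mul' u v := by
    obtain ⟨a, ha⟩ := exists_mulLeft_eq u
    obtain ⟨b, hb⟩ := exists_mulLeft_eq v
    rw [MulMemClass.coe_mul, ← ha, ← hb, Module.End.mul_apply]
    simp
  map_zero' := rfl
  map_add' _ _ := rfl
  commutes' a := (Algebra.algebraMap_eq_smul_one a).symm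

theorem mulLeft_ogzHom (u : quantumOGZ (F := F) q m p r) :
    LinearMap.mulLeft F (ogzHom F m p r q u) = (u : Module.End F (SkewAlg (Idx r) q)) := by
  obtain ⟨a, ha⟩ := exists_mulLeft_eq u
  have : ogzHom F m p r q u = a := by
    change (u : Module.End F (SkewAlg (Idx r) q)) 1 = a
    rw [← ha]
    exact mul_one a
  rw [this, ha]

theorem ogzHom_injective : Function.Injective (ogzHom F m p r q) := fun u v h =>
  Subtype.ext (by rw [← mulLeft_ogzHom, ← mulLeft_ogzHom, h])

theorem exists_ogzHom_eq {v : SkewAlg (Idx r) q}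
    (hv : LinearMap.mulLeft F v ∈ quantumOGZ (F := F) q m p r) : ∃ u, ogzHom F m p r q u = v :=
  ⟨⟨_, hv⟩, mul_one v⟩

theorem exists_ogzHom_eq_ratHom {f : RatFun F (Idx r)} (hf : f ∈ invariants F m p r) :
    ∃ u, ogzHom F m p r q u = ratHom q f :=
  exists_ogzHom_eq (Algebra.subset_adjoin (Or.inl ⟨f, hf, rfl⟩))

theorem exists_ogzHom_eq_Xplus {k : Fin n} (hk : (k : ℕ) + 1 < n) :
    ∃ u, ogzHom F m p r q u = Xplus q m p r k :=
  exists_ogzHom_eq (Algebra.subset_adjoin (Or.inr ⟨k, hk, Or.inl rfl⟩))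

theorem ogzHom_mem {S : Subalgebra F (SkewAlg (Idx r) q)}
    (h1 : ∀ f ∈ invariants F m p r, ratHom q f ∈ S)
    (h2 : ∀ k : Fin n, (k : ℕ) + 1 < n → Xplus q m p r k ∈ S)
    (h3 : ∀ k : Fin n, (k : ℕ) + 1 < n → Xminus q m p r k ∈ S)
    (u : quantumOGZ (F := F) q m p r) : ogzHom F m p r q u ∈ S := by
  have h : quantumOGZ (F := F) q m p r ≤ S.map (Algebra.lmul F (SkewAlg (Idx r) q)) := by
    refine Algebra.adjoin_le ?_
    rintro φ (⟨f, hf, rfl⟩ | ⟨k, hk, rfl | rfl⟩)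
    exacts [⟨_, h1 f hf, rfl⟩, ⟨_, h2 k hk, rfl⟩, ⟨_, h3 k hk, rfl⟩]
  obtain ⟨v, hv, hvu⟩ := h u.2
  have : ogzHom F m p r q u = v := by
    change (u : Module.End F (SkewAlg (Idx r) q)) 1 = v
    rw [← hvu]
    exact mul_one v
  rwa [this]

/-- The growth criterion is applied over the field of invariants: the rational functions are finite
over it, and its elements are quotients of polynomials in `invGen`, which lie in Γ. -/
theorem isOreDomain_quantumOGZ [CharZero F] (hm : 0 < m) (hpm : p ∣ m) (hr : ∀ k, 0 < r k)
    (q : Fˣ) : IsOreDomain (quantumOGZ (F := F) q m p r) := by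
  have := finiteDimensional_invField (F := F) hm hpm hr
  refine isOreDomain_of_injective (invField m p r F) (ShiftGroup.equiv q)
    (ogzHom F m p r q).toRingHom ogzHom_injective fun x => ?_
  obtain ⟨a, ha, b, hb, hx⟩ := IntermediateField.mem_adjoin_iff_div.mp x.2
  by_cases hb0 : b = 0
  · rw [hb0, div_zero] at hx
    refine ⟨1, one_ne_zero, ⟨1, map_one _⟩, 0, ?_⟩
    obtain rfl : x = 0 := Subtype.ext hx
    rw [mul_zero]
    exact (map_zero (ogzHom F m p r q)).trans (map_zero (ratHom q)).symm
  · refine ⟨⟨b, adjoin_le_invField b hb⟩, fun h => hb0 (congrArg Subtype.val h),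
      exists_ogzHom_eq_ratHom (adjoin_invGen_le_invariants hb), ?_⟩
    obtain ⟨u, hu⟩ := exists_ogzHom_eq_ratHom (q := q)
      (adjoin_invGen_le_invariants (F := F) (m := m) (p := p) (r := r) ha)
    refine ⟨u, hu.trans ?_⟩
    rw [map_mul]
    change SkewAlg.mono q a 1 = SkewAlg.mono q (b * (x : RatFun F (Idx r))) 1
    rw [hx, mul_div_cancel₀ _ hb0]

end OGZEmbedding

/-! ### Interpolating the inverses of twisted elements. -/

section InverseCoefficients

variable {F L D : Type*} [Field F] [Field L] [Algebra F L] [DivisionRing D] [Algebra F D]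

/-- If right multiplication by `d` preserves the left span of the powers of `z` over a division
ring `E`, then `d⁻¹` is in this span. -/
theorem exists_sum_mul_eq_one (j : L →ₐ[F] D) {s : ℕ} {z : Fin s → L} (hz : Function.Injective z)
    {d : Fin s → D} (hd : ∀ i, d i ≠ 0) (hs : 0 < s) (E : Subfield D) (M : Matrix (Fin s) (Fin s) E)
    (hM : ∀ (l : Fin s) i, j (z i ^ (l : ℕ)) * d i = ∑ l', (M l l' : D) * j (z i ^ (l' : ℕ))) :
    ∃ t : Fin s → E, ∀ i, (∑ l, (t l : D) * j (z i ^ (l : ℕ))) * d i = 1 := by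
  have key : ∀ t : Fin s → E, ∀ i, (∑ l, (t l : D) * j (z i ^ (l : ℕ))) * d i =
      ∑ l', ((Matrix.vecMul t M l' : E) : D) * j (z i ^ (l' : ℕ)) := by
    intro t i
    simp only [Matrix.vecMul, dotProduct, AddSubmonoidClass.coe_finsetSum, MulMemClass.coe_mul,
      Finset.sum_mul, mul_assoc, hM, Finset.mul_sum]
    exact Finset.sum_comm
  -- The coefficients of the Lagrange basis form the inverse of the Vandermonde matrix.
  have hli : ∀ t : Fin s → D, (∀ i, ∑ l, t l * j (z i ^ (l : ℕ)) = 0) → t = 0 := by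
    intro t ht
    funext l₀
    have h1 : ∑ i, (∑ l, t l * j (z i ^ (l : ℕ))) *
        j ((Lagrange.basis Finset.univ z i).coeff l₀) = t l₀ := by
      simp only [Finset.sum_mul, mul_assoc, ← map_mul]
      rw [Finset.sum_comm]
      simp only [← Finset.mul_sum, ← map_sum]
      have h2 : ∀ l : Fin s, ∑ i, z i ^ (l : ℕ) * (Lagrange.basis Finset.univ z i).coeff l₀ =
          if l = l₀ then 1 else 0 := by
        intro l
        have h3 := Lagrange.eq_interpolate (s := Finset.univ) (v := z) (f := X ^ (l : ℕ))
          hz.injOn (by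
            rw [degree_X_pow, Finset.card_univ, Fintype.card_fin]; exact_mod_cast l.2)
        have h4 := congrArg (fun f => coeff f l₀) h3
        simp only [Lagrange.interpolate_apply, finsetSum_coeff, coeff_C_mul, eval_pow, eval_X,
          coeff_X_pow] at h4
        rw [← h4]
        simp only [Fin.ext_iff, eq_comm]
      simp only [h2]
      simp
    rw [← h1]
    simp only [ht, zero_mul, Finset.sum_const_zero, Pi.zero_apply]
  -- As the d i are invertible, `M` is an injective, hence surjective, endomorphism of Eˢ; a
  -- preimage of the vector representing 1 = z⁰ gives the coefficients of d⁻¹.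
  have hinj : Function.Injective (Matrix.vecMulLinear M) := by
    rw [injective_iff_map_eq_zero]
    intro t ht
    have h1 := hli (fun l => (t l : D)) fun i => by
      have h2 := key t i
      rw [show Matrix.vecMul t M = 0 from ht] at h2
      simp only [Pi.zero_apply, ZeroMemClass.coe_zero, zero_mul, Finset.sum_const_zero] at h2
      exact (mul_eq_zero.mp h2).resolve_right (hd i)
    funext l
    exact Subtype.ext (congrFun h1 l)
  obtain ⟨t, ht⟩ := LinearMap.injective_iff_surjective.mp hinj (Pi.single ⟨0, hs⟩ 1)
  refine ⟨t, fun i => ?_⟩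
  rw [key, show Matrix.vecMul t M = Pi.single ⟨0, hs⟩ 1 from ht,
    Finset.sum_eq_single_of_mem ⟨0, hs⟩ (Finset.mem_univ _)]
  · simp
  · intro l _ hl
    simp [hl]

end InverseCoefficients

end
end QuantumOGZ

namespace QuantumOGZ

noncomputable section

open Polynomial

/-! ### The division ring generated by the quantum OGZ algebra. -/

section Rows

variable {F : Type u} [Field F] {n : ℕ} {m p : ℕ} {r : Fin n → ℕ} {q : Fˣ}
variable {D : Type*} [DivisionRing D] [Algebra F D] (ψ : SkewAlg (Idx r) q →ₐ[F] D)

/-- The image of the rational functions. -/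
def ratMap : RatFun F (Idx r) →ₐ[F] D := ψ.comp (ratHom q)

/-- The image of `δ^{ki}`. -/
def shiftMap (k : Fin n) (i : Fin (r k)) : D := ψ (SkewAlg.mono q 1 (shiftGen q ⟨k, i⟩))

variable (m) in
/-- The image of the polynomial `rowPoly`. -/
def rowA (k : Fin n) : D[X] := (rowPoly m r F k).map (ratMap ψ : RatFun F (Idx r) →+* D)

variable (m) in
/-- The polynomial with the value `δ^{ki}` at the `m`-th power of `x_{ki}`. -/
def rowC (k : Fin n) : D[X] := twistedInterpolant (ratMap ψ) (rowNode m r F k) (shiftMap ψ k)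

theorem ratMap_mul_shiftMap (f : RatFun F (Idx r)) (k : Fin n) (i : Fin (r k)) :
    ratMap ψ f * shiftMap ψ k i = shiftMap ψ k i * ratMap ψ (shiftAut q ⟨k, i⟩ f) := by
  have := congrArg ψ (ratHom_mul_shift (q := q) f (⟨k, i⟩ : Idx r))
  rwa [map_mul, map_mul] at this

theorem shiftMap_commute (k k' : Fin n) (i : Fin (r k)) (i' : Fin (r k')) :
    Commute (shiftMap ψ k i) (shiftMap ψ k' i') :=
  (shift_commute _ _).map ψ

theorem shiftMap_mul_inv (k : Fin n) (i : Fin (r k)) :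
    shiftMap ψ k i * ψ (SkewAlg.mono q 1 (shiftGen q ⟨k, i⟩)⁻¹) = 1 := by
  rw [shiftMap, ← map_mul, shift_mul_shift, mul_inv_cancel, SkewAlg.mono_one, map_one]

theorem shiftMap_ne_zero (k : Fin n) (i : Fin (r k)) : shiftMap ψ k i ≠ 0 :=
  left_ne_zero_of_mul (by rw [shiftMap_mul_inv ψ k i]; exact one_ne_zero)

theorem map_shift_inv (k : Fin n) (i : Fin (r k)) :
    ψ (SkewAlg.mono q 1 (shiftGen q ⟨k, i⟩)⁻¹) = (shiftMap ψ k i)⁻¹ :=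
  (eq_inv_of_mul_eq_one_right (shiftMap_mul_inv ψ k i))

theorem map_Xplus (k : Fin n) :
    ψ (Xplus q m p r k) =
      ∑ i, shiftMap ψ k i * ratMap ψ (-coeffA q m p r (nextRow r k) k i) := by
  rw [Xplus, map_sum]
  refine Finset.sum_congr rfl fun i _ => ?_
  rw [map_mul]; rfl

theorem map_Xminus (k : Fin n) :
    ψ (Xminus q m p r k) =
      ∑ i, (shiftMap ψ k i)⁻¹ * ratMap ψ (coeffA q m p r (prevRow r k) k i) := by
  rw [Xminus, map_sum]
  refine Finset.sum_congr rfl fun i _ => ?_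
  rw [map_mul, of_neg_single, map_shift_inv]; rfl

theorem shiftAut_rowNode_self (k : Fin n) (i : Fin (r k)) :
    shiftAut q ⟨k, i⟩ (rowNode m r F k i) = ((q : F) ^ m) • rowNode m r F k i := by
  rw [rowNode, map_pow, shiftAut_xvar_self, _root_.smul_pow]

theorem shiftAut_rowNode_of_ne {k k' : Fin n} {i : Fin (r k)} {i' : Fin (r k')}
    (h : (⟨k', i'⟩ : Idx r) ≠ ⟨k, i⟩) :
    shiftAut q ⟨k, i⟩ (rowNode m r F k' i') = rowNode m r F k' i' := by
  rw [rowNode, map_pow, shiftAut_xvar_of_ne h]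

theorem shiftAut_rowPoly_of_ne {k k' : Fin n} (h : k' ≠ k) (i : Fin (r k)) (l : ℕ) :
    shiftAut q ⟨k, i⟩ ((rowPoly m r F k').coeff l) = (rowPoly m r F k').coeff l := by
  have : (rowPoly m r F k').map (shiftAut q (⟨k, i⟩ : Idx r) : RatFun F (Idx r) →+* RatFun F (Idx r)) =
      rowPoly m r F k' := by
    simp only [rowPoly, Lagrange.nodal_eq, Polynomial.map_prod, Polynomial.map_sub,
      Polynomial.map_X, Polynomial.map_C, RingHom.coe_coe]
    refine Finset.prod_congr rfl fun i' _ => ?_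
    rw [shiftAut_rowNode_of_ne (k := k) (i := i) (i' := i') (by simp [h])]
  have := congrArg (fun f => coeff f l) this
  simp only [coeff_map] at this
  exact this

theorem shiftAut_rowProd_of_ne {k k' : Fin n} (h : k' ≠ k) (i : Fin (r k)) :
    shiftAut q ⟨k, i⟩ (rowProd m p r F k') = rowProd m p r F k' := by
  rw [rowProd, map_pow, map_prod]
  congr 1
  exact Finset.prod_congr rfl fun i' _ => shiftAut_xvar_of_ne (by simp [h])

theorem shiftAut_rowProd_self (k : Fin n) (i : Fin (r k)) :
    shiftAut q ⟨k, i⟩ (rowProd m p r F k) = ((q : F) ^ (m / p)) • rowProd m p r F k := by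
  rw [rowProd, map_pow, map_prod, ← _root_.smul_pow]
  congr 1
  rw [← Finset.mul_prod_erase _ _ (Finset.mem_univ i), ← Finset.mul_prod_erase _
    (fun i => xvar F (⟨k, i⟩ : Idx r)) (Finset.mem_univ i), shiftAut_xvar_self, smul_mul_assoc]
  congr 2
  refine Finset.prod_congr rfl fun i' hi' => shiftAut_xvar_of_ne ?_
  have := Finset.ne_of_mem_erase hi'
  simpa using this

variable [CharZero F]

theorem pow_ne_one {q : Fˣ} (hq : ∀ k : ℕ, 0 < k → q ^ k ≠ 1) {l : ℕ} (hl : 0 < l) :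
    (q : F) ^ l ≠ 1 := fun h =>
  hq l hl (Units.ext (by rw [Units.val_pow_eq_pow_val, h, Units.val_one]))

/-- The parameter is q^{-m} because a node moved to the right past its own shift is multiplied by
q^m. -/
theorem todaPair_row (hm : 0 < m) (k : Fin n) :
    TodaPair ((q : F) ^ m)⁻¹ (r k) (rowA m ψ k) (rowC m ψ k) := by
  have := todaPair_of_nodes (j := ratMap ψ) (Q := ((q : F) ^ m)⁻¹)
    (τ := fun i => shiftAut q ⟨k, i⟩) (rowNode_injective (r := r) hm k) (rowNode_ne_zero k)
    (inv_ne_zero (pow_ne_zero _ q.ne_zero)) (shiftMap_ne_zero ψ k)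
    (fun i f => ratMap_mul_shiftMap ψ f k i) (shiftMap_commute ψ k k)
    (fun i => by rw [inv_inv]; exact shiftAut_rowNode_self k i)
    (fun i i' h => shiftAut_rowNode_of_ne (by simpa using h.symm))
  rwa [Fintype.card_fin] at this

theorem mul_sum_shiftMap (f : RatFun F (Idx r)) (k : Fin n) (b : Fin (r k) → RatFun F (Idx r)) :
    ratMap ψ f * ∑ i, shiftMap ψ k i * ratMap ψ (b i) =
      ∑ i, shiftMap ψ k i * ratMap ψ (shiftAut q ⟨k, i⟩ f * b i) := by
  rw [Finset.mul_sum]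
  refine Finset.sum_congr rfl fun i _ => ?_
  rw [← mul_assoc, ratMap_mul_shiftMap, mul_assoc, ← map_mul]

theorem sum_shiftMap_mul (f : RatFun F (Idx r)) (k : Fin n) (b : Fin (r k) → RatFun F (Idx r)) :
    (∑ i, shiftMap ψ k i * ratMap ψ (b i)) * ratMap ψ f =
      ∑ i, shiftMap ψ k i * ratMap ψ (b i * f) := by
  rw [Finset.sum_mul]
  refine Finset.sum_congr rfl fun i _ => ?_
  rw [mul_assoc, ← map_mul]

/-- The invariant ∑ zᵢ changes by (q^m - 1) zᵢ when moved past δ^{ki}, so the commutator with it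
multiplies the i-th summand by that quantity; the constant is nonzero as q is not a root of unity.
-/
theorem sum_shiftMap_rowNode_mem (hm : 0 < m) (hpm : p ∣ m) (hr : ∀ k, 0 < r k)
    {ζ : F} (hζ : IsPrimitiveRoot ζ m) (hq : ∀ k : ℕ, 0 < k → q ^ k ≠ 1) {E : Subfield D}
    (hE : ∀ a ∈ invField m p r F, ratMap ψ a ∈ E) {k : Fin n} {b : Fin (r k) → RatFun F (Idx r)}
    (hb : ∑ i, shiftMap ψ k i * ratMap ψ (b i) ∈ E) (l : ℕ) :
    ∑ i, shiftMap ψ k i * ratMap ψ (rowNode m r F k i ^ l * b i) ∈ E := by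
  have step : ∀ b : Fin (r k) → RatFun F (Idx r), ∑ i, shiftMap ψ k i * ratMap ψ (b i) ∈ E →
      ∑ i, shiftMap ψ k i * ratMap ψ (rowNode m r F k i * b i) ∈ E := by
    intro b hb
    have hc : (q : F) ^ m - 1 ≠ 0 := sub_ne_zero.mpr (pow_ne_one hq hm)
    have hp1 : ∑ i, rowNode m r F k i ∈ invField m p r F :=
      isEquivariant_rowNode.sum_mem hm hpm hr hζ
    have hτ : ∀ i, shiftAut q ⟨k, i⟩ (∑ i, rowNode m r F k i) =
        ∑ i, rowNode m r F k i + algebraMap F _ ((q : F) ^ m - 1) * rowNode m r F k i := by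
      intro i
      rw [map_sum, ← Finset.add_sum_erase _ _ (Finset.mem_univ i),
        ← Finset.add_sum_erase _ (rowNode m r F k) (Finset.mem_univ i), shiftAut_rowNode_self,
        Finset.sum_congr rfl fun i' hi' => shiftAut_rowNode_of_ne (by
          simpa using Finset.ne_of_mem_erase hi'), map_sub, map_one, Algebra.smul_def]
      ring
    have h1 := sub_mem (mul_mem (hE _ hp1) hb) (mul_mem hb (hE _ hp1))
    rw [mul_sum_shiftMap, sum_shiftMap_mul, ← Finset.sum_sub_distrib] at h1
    have h2 := mul_mem h1 (hE _ (IntermediateField.algebraMap_mem _ ((q : F) ^ m - 1)⁻¹))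
    rw [Finset.sum_mul] at h2
    convert h2 using 2 with i
    rw [← mul_sub, ← map_sub, hτ, mul_assoc, ← map_mul]
    congr 2
    rw [map_inv₀]
    have : algebraMap F (RatFun F (Idx r)) ((q : F) ^ m - 1) ≠ 0 := by
      rwa [ne_eq, FaithfulSMul.algebraMap_eq_zero_iff]
    field_simp
    ring
  induction l with
  | zero => simpa using hb
  | succ l ih =>
    have := step _ ih
    simpa only [pow_succ', mul_assoc] using this

/-- The ratio b / a is a polynomial in the nodes with invariant coefficients, so powers of the nodes
suffice. One nowhere vanishing equivariant family thus produces all others, in particular the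
coefficients of `rowC` from those of X_k^+. -/
theorem sum_shiftMap_equivariant_mem (hm : 0 < m) (hpm : p ∣ m) (hr : ∀ k, 0 < r k)
    {ζ : F} (hζ : IsPrimitiveRoot ζ m) (hq : ∀ k : ℕ, 0 < k → q ^ k ≠ 1) {E : Subfield D}
    (hE : ∀ a ∈ invField m p r F, ratMap ψ a ∈ E) {k : Fin n}
    {a b : Fin (r k) → RatFun F (Idx r)} (ha : IsEquivariant m p a) (ha0 : ∀ i, a i ≠ 0)
    (hb : IsEquivariant m p b) (haE : ∑ i, shiftMap ψ k i * ratMap ψ (a i) ∈ E) :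
    ∑ i, shiftMap ψ k i * ratMap ψ (b i) ∈ E := by
  obtain ⟨c, hc, hcb⟩ := (hb.div ha).exists_sum_pow hm hpm hr hζ
  have : ∑ i, shiftMap ψ k i * ratMap ψ (b i) = ∑ l ∈ Finset.range (r k),
      (∑ i, shiftMap ψ k i * ratMap ψ (rowNode m r F k i ^ l * a i)) * ratMap ψ (c l) := by
    simp only [sum_shiftMap_mul]
    rw [Finset.sum_comm]
    refine Finset.sum_congr rfl fun i _ => ?_
    rw [← Finset.mul_sum, ← map_sum, ← div_mul_cancel₀ (b i) (ha0 i), hcb, Finset.sum_mul]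
    congr 2
    exact Finset.sum_congr rfl fun l _ => by ring
  rw [this]
  exact sum_mem fun l _ =>
    mul_mem (sum_shiftMap_rowNode_mem ψ hm hpm hr hζ hq hE haE l) (hE _ (hc l))

theorem shiftMap_eq_sum (hm : 0 < m) (k : Fin n) (i : Fin (r k)) :
    shiftMap ψ k i = ∑ l ∈ Finset.range (r k), (rowC m ψ k).coeff l *
      ratMap ψ (rowNode m r F k i ^ l) := by
  have := sum_coeff_twistedInterpolant (ratMap ψ) (rowNode_injective (r := r) hm k)
    (shiftMap ψ k) i
  rw [Fintype.card_fin] at this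
  exact this.symm

theorem isEquivariant_nextRow (hm : 0 < m) (hq : ∀ k : ℕ, 0 < k → q ^ k ≠ 1) (k : Fin n) :
    IsEquivariant m p (coeffA q m p r (nextRow r k) k) :=
  isEquivariant_coeffA hq hm fun k' => (k' : ℕ) = (k : ℕ) + 1

theorem isEquivariant_prevRow (hm : 0 < m) (hq : ∀ k : ℕ, 0 < k → q ^ k ≠ 1) (k : Fin n) :
    IsEquivariant m p (coeffA q m p r (prevRow r k) k) :=
  isEquivariant_coeffA hq hm fun k' => (k' : ℕ) + 1 = (k : ℕ)

theorem map_Xplus_mem (hm : 0 < m) (hpm : p ∣ m) (hr : ∀ k, 0 < r k)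
    {ζ : F} (hζ : IsPrimitiveRoot ζ m) (hq : ∀ k : ℕ, 0 < k → q ^ k ≠ 1) {E : Subfield D}
    (hE : ∀ a ∈ invField m p r F, ratMap ψ a ∈ E) {k : Fin n}
    (hC : ∀ l, (rowC m ψ k).coeff l ∈ E) : ψ (Xplus q m p r k) ∈ E := by
  have h : ψ (Xplus q m p r k) = -∑ l ∈ Finset.range (r k), (rowC m ψ k).coeff l *
      ratMap ψ (∑ i, rowNode m r F k i ^ l * coeffA q m p r (nextRow r k) k i) := by
    rw [map_Xplus]
    simp only [map_neg, mul_neg, Finset.sum_neg_distrib, map_sum, Finset.mul_sum]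
    rw [Finset.sum_comm]
    congr 1
    refine Finset.sum_congr rfl fun i _ => ?_
    rw [shiftMap_eq_sum ψ hm, Finset.sum_mul]
    simp only [map_mul, mul_assoc]
  rw [h]
  exact neg_mem (sum_mem fun l _ => mul_mem (hC l) (hE _
    (((isEquivariant_rowNode.pow l).mul (isEquivariant_nextRow hm hq k)).sum_mem hm hpm hr hζ)))

/-- The inverse shifts have the form ∑ tₗ zᵢˡ with tₗ in E independent of i, by
`exists_sum_mul_eq_one`; summing against an equivariant family then gives invariant coefficients. -/
theorem map_Xminus_mem (hm : 0 < m) (hpm : p ∣ m) (hr : ∀ k, 0 < r k)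
    {ζ : F} (hζ : IsPrimitiveRoot ζ m) (hq : ∀ k : ℕ, 0 < k → q ^ k ≠ 1) {E : Subfield D}
    (hE : ∀ a ∈ invField m p r F, ratMap ψ a ∈ E) {k : Fin n}
    (hC : ∀ l, (rowC m ψ k).coeff l ∈ E) : ψ (Xminus q m p r k) ∈ E := by
  choose c hc hcz using fun l : ℕ => (IsEquivariant.pow (isEquivariant_rowNode (F := F)
    (m := m) (p := p) (r := r) (k := k)) l).exists_sum_pow hm hpm hr hζ
  -- From zˡ δ = q^{ml} δ zˡ and δ = ∑ C_{l₀} z^{l₀}; the power z^{l + l₀} is reduced to exponents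
  -- below r k with the invariant coefficients `c`.
  let M : Matrix (Fin (r k)) (Fin (r k)) E := fun l l' =>
    ⟨∑ l₀ ∈ Finset.range (r k), (rowC m ψ k).coeff l₀ *
      ratMap ψ (algebraMap F _ (((q : F) ^ m) ^ (l : ℕ)) * c (l + l₀) l'),
      sum_mem fun l₀ _ => mul_mem (hC l₀) (hE _ (mul_mem
        (IntermediateField.algebraMap_mem _ _) (hc _ _)))⟩
  obtain ⟨t, ht⟩ := exists_sum_mul_eq_one (ratMap ψ) (rowNode_injective (r := r) hm k)
    (shiftMap_ne_zero ψ k) (hr k) E M (fun l i => by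
      rw [ratMap_mul_shiftMap, map_pow, shiftAut_rowNode_self, shiftMap_eq_sum ψ hm,
        Finset.sum_mul]
      simp only [M, Finset.sum_mul]
      rw [Finset.sum_comm]
      refine Finset.sum_congr rfl fun l₀ _ => ?_
      simp only [mul_assoc, ← map_mul]
      rw [← Finset.mul_sum, ← map_sum, ← Finset.mul_sum, Finset.sum_fin_eq_sum_range]
      congr 2
      rw [_root_.smul_pow, Algebra.smul_def, ← mul_left_comm, ← pow_add, add_comm l₀, hcz]
      congr 1
      exact Finset.sum_congr rfl fun l' hl' => by rw [dif_pos (Finset.mem_range.mp hl')])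
  have h : ψ (Xminus q m p r k) = ∑ l, (t l : D) *
      ratMap ψ (∑ i, rowNode m r F k i ^ (l : ℕ) * coeffA q m p r (prevRow r k) k i) := by
    rw [map_Xminus]
    simp only [map_sum, Finset.mul_sum]
    rw [Finset.sum_comm]
    refine Finset.sum_congr rfl fun i _ => ?_
    rw [← eq_inv_of_mul_eq_one_left (ht i), Finset.sum_mul]
    simp only [map_mul, mul_assoc]
  rw [h]
  exact sum_mem fun l _ => mul_mem (t l).2 (hE _
    (((isEquivariant_rowNode.pow l).mul (isEquivariant_prevRow hm hq k)).sum_mem hm hpm hr hζ))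

theorem ratMap_mem_of_invGen_mem {E : Subfield D} (hF : ∀ a : F, algebraMap F D a ∈ E)
    (h : ∀ t, ratMap ψ (invGen m p r F t) ∈ E) :
    ∀ a ∈ invField m p r F, ratMap ψ a ∈ E := by
  intro a ha
  induction ha using IntermediateField.adjoin_induction with
  | mem x hx => obtain ⟨t, rfl⟩ := hx; exact h t
  | algebraMap a => rw [AlgHom.commutes]; exact hF a
  | add x y _ _ hx hy => rw [map_add]; exact add_mem hx hy
  | inv x _ hx => rw [map_inv₀]; exact inv_mem hx
  | mul x y _ _ hx hy => rw [map_mul]; exact mul_mem hx hy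

/-- The division ring generated by the quantum OGZ algebra. -/
theorem map_ogzHom_mem_iff (hm : 0 < m) (hpm : p ∣ m) (hr : ∀ k, 0 < r k)
    {ζ : F} (hζ : IsPrimitiveRoot ζ m) (hq : ∀ k : ℕ, 0 < k → q ^ k ≠ 1) (E : Subfield D) :
    (∀ u, ψ (ogzHom F m p r q u) ∈ E) ↔ (∀ a ∈ invField m p r F, ratMap ψ a ∈ E) ∧
      ∀ k : Fin n, (k : ℕ) + 1 < n → ∀ l, (rowC m ψ k).coeff l ∈ E := by
  constructor
  · intro h
    have hE : ∀ a ∈ invField m p r F, ratMap ψ a ∈ E := by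
      refine ratMap_mem_of_invGen_mem ψ (fun a => ?_) fun t => ?_
      · have := h (algebraMap F _ a)
        rwa [AlgHom.commutes, AlgHom.commutes] at this
      · obtain ⟨u, hu⟩ := exists_ogzHom_eq_ratHom (q := q) (invGen_mem_invariants (F := F)
          (m := m) (p := p) t)
        have := h u
        rwa [hu] at this
    refine ⟨hE, fun k hk l => ?_⟩
    obtain ⟨u, hu⟩ := exists_ogzHom_eq_Xplus (F := F) (m := m) (p := p) (q := q) hk
    have hX := h u
    rw [hu, map_Xplus] at hX
    simp only [map_neg, mul_neg, Finset.sum_neg_distrib] at hX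
    rw [rowC, coeff_twistedInterpolant]
    refine sum_shiftMap_equivariant_mem ψ hm hpm hr hζ hq hE (isEquivariant_nextRow hm hq k)
      (coeffA_ne_zero hq hm fun t ht hk => ?_) (isEquivariant_basis_coeff l) (neg_mem_iff.mp hX)
    have := (Finset.mem_filter.mp ht).2
    rw [hk] at this
    omega
  · rintro ⟨h1, h2⟩
    let S : Subalgebra F (SkewAlg (Idx r) q) :=
      { (E.toSubring.comap (ψ : SkewAlg (Idx r) q →+* D)) with
        algebraMap_mem' := fun a => by
          have := h1 _ (IntermediateField.algebraMap_mem _ a)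
          rw [AlgHom.commutes, ← ψ.commutes] at this
          exact this }
    exact ogzHom_mem (S := S)
      (fun f hf => h1 f (mem_invField_of_fixed hm hpm hr hζ hf.2))
      (fun k hk => map_Xplus_mem ψ hm hpm hr hζ hq h1 (h2 k hk))
      (fun k hk => map_Xminus_mem ψ hm hpm hr hζ hq h1 (h2 k hk))

end Rows

end
end QuantumOGZ

namespace QuantumOGZ

noncomputable section

open Polynomial

/-! ### Quantum affine generators for each row. -/

section Generators

variable {F : Type u} [Field F] {n : ℕ} {m p : ℕ} {r : Fin n → ℕ} {q : Fˣ}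
variable {D : Type*} [DivisionRing D] [Algebra F D] (ψ : SkewAlg (Idx r) q →ₐ[F] D)

theorem ratMap_mul_rowC_coeff {f : RatFun F (Idx r)} {k : Fin n} {a : F}
    (hf : ∀ i, shiftAut q ⟨k, i⟩ f = a • f) (l : ℕ) :
    ratMap ψ f * (rowC m ψ k).coeff l = a • ((rowC m ψ k).coeff l * ratMap ψ f) := by
  rw [rowC, coeff_twistedInterpolant, Finset.mul_sum, Finset.sum_mul, Finset.smul_sum]
  refine Finset.sum_congr rfl fun i _ => ?_
  rw [← mul_assoc, ratMap_mul_shiftMap, hf, map_smul, mul_assoc, mul_assoc, ← map_mul, mul_comm,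
    map_mul, smul_mul_assoc, mul_smul_comm]

theorem ratMap_commute (f g : RatFun F (Idx r)) : Commute (ratMap ψ f) (ratMap ψ g) :=
  (Commute.all f g).map (ratMap ψ)

theorem shiftAut_basis_coeff_of_ne {k k' : Fin n} (h : k' ≠ k) (i : Fin (r k)) (i' : Fin (r k'))
    (l : ℕ) : shiftAut q ⟨k, i⟩ ((Lagrange.basis Finset.univ (rowNode m r F k') i').coeff l) =
      (Lagrange.basis Finset.univ (rowNode m r F k') i').coeff l := by
  have : (Lagrange.basis Finset.univ (rowNode m r F k') i').map
      (shiftAut q (⟨k, i⟩ : Idx r) : RatFun F (Idx r) →+* RatFun F (Idx r)) =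
      Lagrange.basis Finset.univ (rowNode m r F k') i' := by
    have hz : ∀ j, shiftAut q ⟨k, i⟩ (rowNode m r F k' j) = rowNode m r F k' j := fun j =>
      shiftAut_rowNode_of_ne (k := k) (i := i) (i' := j) (by simp [h])
    rw [Lagrange.basis, Polynomial.map_prod]
    refine Finset.prod_congr rfl fun j _ => ?_
    simp only [Lagrange.basisDivisor, Polynomial.map_mul, Polynomial.map_sub, Polynomial.map_X,
      Polynomial.map_C, RingHom.coe_coe, map_inv₀, map_sub, hz]
  have := congrArg (fun f => coeff f l) this
  simp only [coeff_map] at this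
  exact this

theorem ratMap_commute_shiftMap {f : RatFun F (Idx r)} {k : Fin n} {i : Fin (r k)}
    (hf : shiftAut q ⟨k, i⟩ f = f) : Commute (ratMap ψ f) (shiftMap ψ k i) := by
  have := ratMap_mul_shiftMap ψ f k i
  rwa [hf] at this

theorem rowC_coeff_commute {k k' : Fin n} (h : k' ≠ k) (l l' : ℕ) :
    Commute ((rowC m ψ k).coeff l) ((rowC m ψ k').coeff l') := by
  rw [rowC, coeff_twistedInterpolant, rowC, coeff_twistedInterpolant]
  refine Commute.sum_left _ _ _ fun i _ => Commute.sum_right _ _ _ fun i' _ => ?_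
  refine Commute.mul_left (Commute.mul_right (shiftMap_commute ψ k k' i i') ?_)
    (Commute.mul_right ?_ (ratMap_commute ψ _ _))
  · exact (ratMap_commute_shiftMap ψ (shiftAut_basis_coeff_of_ne h i i' l')).symm
  · exact ratMap_commute_shiftMap ψ (shiftAut_basis_coeff_of_ne h.symm i' i l)

variable [CharZero F]

variable (m p) in
/-- In a division ring over the skew group algebra, each row has generators which satisfy the
relations of a quantum affine algebra, and the generators of different rows commute. -/
theorem exists_weyl_generators (hm : 0 < m) (hpm : p ∣ m) (hr : ∀ k, 0 < r k)
    (hq : ∀ k : ℕ, 0 < k → q ^ k ≠ 1) :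
    ∃ X Y : Idx r → D, (∀ t, X t ≠ 0) ∧ (∀ t, Y t ≠ 0) ∧ (∀ t t', Commute (X t) (X t')) ∧
      (∀ t t', Commute (Y t) (Y t')) ∧ (∀ t t', t ≠ t' → Commute (Y t) (X t')) ∧
      (∀ t, Y t * X t =
        (if (t.2 : ℕ) = 0 then (q : F) ^ (m / p) else (q : F) ^ m) • (X t * Y t)) ∧
      (∀ f k, (∀ i, shiftAut q ⟨k, i⟩ f = f) →
        ∀ i, Commute (ratMap ψ f) (X ⟨k, i⟩) ∧ Commute (ratMap ψ f) (Y ⟨k, i⟩)) ∧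
      ∀ (E : Subfield D) (k : Fin n), (ratMap ψ (rowProd m p r F k) ∈ E ∧
          (∀ l, ratMap ψ ((rowPoly m r F k).coeff l) ∈ E) ∧ ∀ l, (rowC m ψ k).coeff l ∈ E) ↔
        ∀ i, X ⟨k, i⟩ ∈ E ∧ Y ⟨k, i⟩ ∈ E := by
  have hQ : ((q : F) ^ m)⁻¹ ≠ 0 := inv_ne_zero (pow_ne_zero _ q.ne_zero)
  have hQ1 : ((q : F) ^ m)⁻¹ ≠ 1 := by rw [ne_eq, inv_eq_one]; exact pow_ne_one hq hm
  have hA : ∀ k l, (rowA m ψ k).coeff l = ratMap ψ ((rowPoly m r F k).coeff l) := fun k l => by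
    rw [rowA, coeff_map]; rfl
  choose c e hc0 he0 hcc hee hce hcsame he00 hclo ht using fun k : Fin n =>
    TodaPair.exists_generators hQ hQ1 _ _ _ (todaPair_row ψ hm k)
  let w : Fin n → D := fun k => ratMap ψ (rowProd m p r F k)
  have hw0 : ∀ k, w k ≠ 0 := fun k => by
    have := rowProd_ne_zero (F := F) (m := m) (p := p) (r := r) k
    exact (map_ne_zero (ratMap ψ)).mpr this
  have hcomm : ∀ k t, (∀ l, Commute t ((rowA m ψ k).coeff l)) →
      (∀ l, Commute t ((rowC m ψ k).coeff l)) →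
      ∀ i, Commute t (c k i) ∧ Commute t (e k i) := by
    intro k t h1 h2 i
    obtain ⟨h3, h4, h5⟩ := ht k t 1 one_ne_zero h1 fun l => by rw [one_smul]; exact h2 l
    refine ⟨?_, h3 i⟩
    by_cases hi : (i : ℕ) = 0
    · have := h5 i hi
      rwa [one_smul] at this
    · exact h4 i hi
  have hfix : ∀ f k, (∀ i, shiftAut q ⟨k, i⟩ f = f) →
      ∀ i, Commute (ratMap ψ f) (c k i) ∧ Commute (ratMap ψ f) (e k i) := by
    intro f k hf
    refine hcomm k _ (fun l => ?_) fun l => ?_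
    · rw [hA]; exact ratMap_commute ψ _ _
    · have := ratMap_mul_rowC_coeff (m := m) ψ (a := 1) (fun i => by rw [one_smul]; exact hf i) l
      rwa [one_smul] at this
  have hcross : ∀ k k', k' ≠ k → ∀ i i', (Commute (c k' i') (c k i) ∧ Commute (c k' i') (e k i)) ∧
      (Commute (e k' i') (c k i) ∧ Commute (e k' i') (e k i)) := by
    intro k k' h i i'
    have h1 : ∀ l, ∀ i, Commute ((rowA m ψ k).coeff l) (c k' i) ∧
        Commute ((rowA m ψ k).coeff l) (e k' i) := fun l => by
      rw [hA]
      exact hfix _ _ fun i => shiftAut_rowPoly_of_ne h.symm i l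
    have h2 : ∀ l, ∀ i, Commute ((rowC m ψ k).coeff l) (c k' i) ∧
        Commute ((rowC m ψ k).coeff l) (e k' i) := fun l => by
      refine hcomm k' _ (fun l' => ?_) fun l' => rowC_coeff_commute ψ h l l'
      rw [hA]
      have := ratMap_mul_rowC_coeff (m := m) (k := k) ψ (a := 1) (fun i => by
        rw [one_smul]; exact shiftAut_rowPoly_of_ne (m := m) h i l') l
      rw [one_smul] at this
      exact Commute.symm this
    exact ⟨hcomm k _ (fun l => (h1 l i').1.symm) (fun l => (h2 l i').1.symm) i,
      hcomm k _ (fun l => (h1 l i').2.symm) (fun l => (h2 l i').2.symm) i⟩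
  have hwne : ∀ k k', k' ≠ k → ∀ i, Commute (w k') (c k i) ∧ Commute (w k') (e k i) :=
    fun k k' h => hfix _ k fun i => shiftAut_rowProd_of_ne h i
  -- Every shift of row k scales `rowProd` by the same q^(m/p), so by the last clause of
  -- `exists_generators` the element `w k` scales the first c and commutes with the rest.
  have hwself := fun k => ht k (w k) ((q : F) ^ (m / p)) (pow_ne_zero _ q.ne_zero)
    (fun l => by rw [hA]; exact ratMap_commute ψ _ _)
    fun l => ratMap_mul_rowC_coeff ψ (fun i => shiftAut_rowProd_self k i) l
  have hww : ∀ k k', Commute (w k) (w k') := fun k k' => ratMap_commute ψ _ _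
  have hwe : ∀ k k' i, Commute (w k) (e k' i) := by
    intro k k' i
    by_cases h : k = k'
    · subst h; exact (hwself k).1 i
    · exact (hwne k' k h i).2
  have hX : ∀ t t' : Idx r, Commute (c t.1 t.2) (c t'.1 t'.2) := by
    rintro ⟨k, i⟩ ⟨k', i'⟩
    by_cases h : k = k'
    · subst h; exact hcc k i i'
    · exact (hcross k' k h i' i).1.1
  have hE : ∀ t t' : Idx r, Commute (e t.1 t.2) (e t'.1 t'.2) := by
    rintro ⟨k, i⟩ ⟨k', i'⟩
    by_cases h : k = k'
    · subst h; exact hee k i i'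
    · exact (hcross k' k h i' i).2.2
  -- `w` takes the place of the first e, which is ± its p-th power and so is still generated;
  -- conversely `w` may not be recoverable from that e.
  refine ⟨fun t => c t.1 t.2, fun t => if (t.2 : ℕ) = 0 then w t.1 else e t.1 t.2,
    fun t => hc0 _ _, fun t => ?_, hX, fun t t' => ?_, fun t t' htt' => ?_, fun t => ?_,
    fun f k hf i => ⟨(hfix f k hf i).1, ?_⟩, fun E k => ⟨fun ⟨h1, h2, h3⟩ i => ?_, fun h => ?_⟩⟩
  · dsimp only
    split_ifs
    exacts [hw0 _, he0 _ _]
  · dsimp only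
    split_ifs
    exacts [hww _ _, hwe _ _ _, (hwe _ _ _).symm, hE _ _]
  · obtain ⟨k, i⟩ := t
    obtain ⟨k', i'⟩ := t'
    dsimp only
    by_cases h : k = k'
    · subst h
      have hii' : i ≠ i' := fun h => htt' (by rw [h])
      split_ifs with hi
      · exact (hwself k).2.1 i' fun hi' => hii' (Fin.ext (hi.trans hi'.symm))
      · exact (hce k i' i hii'.symm).symm
    · split_ifs
      exacts [(hwne k' k h i').1, (hcross k' k h i' i).2.1]
  · dsimp only
    split_ifs with hi
    · exact (hwself t.1).2.2 t.2 hi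
    · rw [hcsame, smul_smul, mul_inv_cancel₀ (pow_ne_zero _ q.ne_zero), one_smul]
  · dsimp only
    split_ifs
    exacts [ratMap_commute ψ _ _, (hfix f k hf i).2]
  · obtain ⟨h4, h5⟩ := (hclo k E).mp ⟨fun l => by rw [hA]; exact h2 l, h3⟩
    refine ⟨h4 i, ?_⟩
    dsimp only
    split_ifs
    exacts [h1, h5 i]
  · have hw : ratMap ψ (rowProd m p r F k) ∈ E := by
      have := (h ⟨0, hr k⟩).2
      simpa using this
    obtain ⟨h4, h5⟩ := (hclo k E).mpr ⟨fun i => (h i).1, fun i => by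
      by_cases hi : (i : ℕ) = 0
      · rw [he00 k i hi, hA, rowPoly_coeff_zero hpm, map_mul, map_pow, map_pow, map_neg, map_one]
        exact mul_mem (pow_mem (neg_mem (one_mem _)) _) (pow_mem hw _)
      · have := (h i).2
        simp only [if_neg hi] at this
        exact this⟩
    exact ⟨hw, fun l => by rw [← hA]; exact h4 l, h5⟩

end Generators

/-! ### Comparison with the quantum Weyl field. -/

section Main

theorem isPurelyTranscendentalOn_range_xvar {F : Type u} [Field F] (I : Type) :
    IsPurelyTranscendentalOn F (RatFun F I) (Set.range (xvar F)) :=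
  ⟨isTranscendenceBasis_xvar.1.to_subtype_range, adjoin_range_xvar⟩

theorem encard_range_xvar {F : Type u} [Field F] (s : ℕ) :
    (Set.range (xvar F : Fin s → RatFun F (Fin s))).encard = s := by
  have hinj : Function.Injective (xvar F : Fin s → RatFun F (Fin s)) :=
    isTranscendenceBasis_xvar.1.injective
  rw [← Set.image_univ, hinj.encard_image, Set.encard_univ, ENat.card_eq_coe_fintype_card,
    Fintype.card_fin]

variable {F : Type u} [Field F] [CharZero F] {m p N : ℕ} {r : Fin (N + 1) → ℕ} {q : Fˣ}

theorem invGen_fixed (k : Fin N) (i : Fin (r k.castSucc)) (i' : Fin (r (Fin.last N))) :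
    shiftAut q ⟨k.castSucc, i⟩ (invGen m p r F ⟨Fin.last N, i'⟩) =
      invGen m p r F ⟨Fin.last N, i'⟩ := by
  rw [invGen]
  split_ifs
  · exact shiftAut_rowProd_of_ne (Fin.castSucc_lt_last k).ne' i
  · exact shiftAut_rowPoly_of_ne (Fin.castSucc_lt_last k).ne' i _

/-- The division ring of fractions of the quantum OGZ algebra is a quantum Weyl field. -/
theorem quantumOGZ_frac_equiv (hm : 0 < m) (hpm : p ∣ m) {ζ : F} (hζ : IsPrimitiveRoot ζ m)
    (hq : ∀ k : ℕ, 0 < k → q ^ k ≠ 1) (hr : ∀ k, 0 < r k) {ι : Type} [Fintype ι] [DecidableEq ι]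
    (φ : ι ≃ Σ k : Fin N, Fin (r k.castSucc)) (c : ι → RatFun F (Fin (r (Fin.last N))))
    (hc : ∀ i, c i = algebraMap F _
      (if ((φ i).2 : ℕ) = 0 then (q : F) ^ (m / p) else (q : F) ^ m)) :
    ∃ (_ : IsOreDomain (quantumOGZ (F := F) q m p r)) (_ : IsOreDomain (QuantumAffine c)),
      Nonempty (Frac (quantumOGZ (F := F) q m p r) ≃ₐ[F] Frac (QuantumAffine c)) := by
  have hOre := isOreDomain_quantumOGZ (F := F) hm hpm hr q
  obtain ⟨ψ, hψ⟩ : ∃ ψ : SkewAlg (Idx r) q →ₐ[F] Frac (SkewAlg (Idx r) q),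
      Function.Injective ψ :=
    ⟨{ (OreLocalization.numeratorRingHom : SkewAlg (Idx r) q →+* Frac (SkewAlg (Idx r) q)) with
        commutes' := fun _ => rfl }, OreLocalization.numeratorHom_inj inf_le_left⟩
  obtain ⟨X, Y, hX0, hY0, hXX, hYY, hYX, hYX', hfix, hclo⟩ :=
    exists_weyl_generators m p ψ hm hpm hr hq
  have hg : AlgebraicIndependent F fun i => invGen m p r F ⟨Fin.last N, i⟩ :=
    (isTranscendenceBasis_invGen hm hpm hr).1.comp _ sigma_mk_injective
  -- The ground field is realised as the invariants of the last row, which are algebraically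
  -- independent and fixed by the shifts of all earlier rows.
  let j : RatFun F (Fin (r (Fin.last N))) →ₐ[F] Frac (SkewAlg (Idx r) q) :=
    (ratMap ψ).comp ((IntermediateField.val _).comp hg.aevalEquivField.toAlgHom)
  have hj : ∀ a, ∃ f ∈ IntermediateField.adjoin F
      (Set.range fun i => invGen m p r F ⟨Fin.last N, i⟩), j a = ratMap ψ f := fun a =>
    ⟨_, (hg.aevalEquivField a).2, rfl⟩
  have hj' : ∀ f ∈ IntermediateField.adjoin F
      (Set.range fun i => invGen m p r F ⟨Fin.last N, i⟩), ∃ a, j a = ratMap ψ f := fun f hf =>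
    ⟨hg.aevalEquivField.symm ⟨f, hf⟩, by
      change ratMap ψ (hg.aevalEquivField (hg.aevalEquivField.symm ⟨f, hf⟩) : RatFun F (Idx r)) = _
      rw [AlgEquiv.apply_symm_apply]⟩
  have hjfix : ∀ a (k : Fin N) i, Commute (j a) (X ⟨k.castSucc, i⟩) ∧
      Commute (j a) (Y ⟨k.castSucc, i⟩) := by
    intro a k i
    obtain ⟨f, hf, hjf⟩ := hj a
    rw [hjf]
    refine hfix f k.castSucc (fun i => ?_) i
    clear hjf
    induction hf using IntermediateField.adjoin_induction with
    | mem x hx => obtain ⟨i', rfl⟩ := hx; exact invGen_fixed k i i'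
    | algebraMap a => exact AlgEquiv.commutes _ a
    | add x y _ _ hx hy => rw [map_add, hx, hy]
    | inv x _ hx => rw [map_inv₀, hx]
    | mul x y _ _ hx hy => rw [map_mul, hx, hy]
  let ρ : (Σ k : Fin N, Fin (r k.castSucc)) → Idx r := fun t => ⟨t.1.castSucc, t.2⟩
  have hρ : Function.Injective ρ := by
    rintro ⟨k, i⟩ ⟨k', i'⟩ h
    obtain rfl : k = k' := Fin.castSucc_injective _ (congrArg Sigma.fst h)
    have := eq_of_heq (Sigma.mk.inj h).2
    rw [show i = i' from this]
  let θ : ι → Idx r := fun i => ρ (φ i)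
  have hθ : ∀ i i', i ≠ i' → θ i ≠ θ i' := by
    intro i i' h h'
    exact h (φ.injective (hρ h'))
  have hcF : ∀ i, ∃ l : ℕ, 0 < l ∧ c i = algebraMap F _ ((q : F) ^ l) := by
    intro i
    rw [hc]
    split_ifs
    · exact ⟨m / p, Nat.div_pos (Nat.le_of_dvd hm hpm) (Nat.pos_of_dvd_of_pos hpm hm), rfl⟩
    · exact ⟨m, hm, rfl⟩
  obtain ⟨hOre', χ, hχ, hχE⟩ := QuantumAffine.exists_embedding (c := c) j
    (x := fun i => X (θ i)) (y := fun i => Y (θ i)) (fun a i => (hjfix a _ _).1)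
    (fun a i => (hjfix a _ _).2) (fun _ _ => hXX _ _) (fun _ _ => hYY _ _)
    (fun i => by
      rw [hYX', hc, AlgHom.commutes, ← Algebra.smul_def])
    (fun i i' h => hYX _ _ (hθ i i' h))
    (fun i => by
      obtain ⟨l, hl, h⟩ := hcF i
      rw [h, ne_eq, FaithfulSMul.algebraMap_eq_zero_iff]
      exact pow_ne_zero _ q.ne_zero)
    (fun i s hs => by
      obtain ⟨l, hl, h⟩ := hcF i
      rw [h, ← map_pow, ← pow_mul, ne_eq, FaithfulSMul.algebraMap_eq_one_iff]
      exact pow_ne_one hq (Nat.mul_pos hl hs))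
    (fun _ => hX0 _) (fun _ => hY0 _)
  refine ⟨hOre, hOre', nonempty_frac_equiv (ψ.comp (ogzHom F m p r q))
    (hψ.comp ogzHom_injective) χ hχ fun E => ?_⟩
  -- Both conditions on `E` are now about generators: rows before the last are matched by `hclo`,
  -- the last row by `j`.
  refine (map_ogzHom_mem_iff ψ hm hpm hr hζ hq E).trans (Iff.trans ?_ (hχE E).symm)
  have hθ' : ∀ (k : Fin N) (i : Fin (r k.castSucc)), ∃ s, θ s = ⟨k.castSucc, i⟩ := fun k i =>
    ⟨φ.symm ⟨k, i⟩, congrArg ρ (φ.apply_symm_apply ⟨k, i⟩)⟩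
  constructor
  · rintro ⟨h1, h2⟩
    have h3 : ∀ i, X (θ i) ∈ E ∧ Y (θ i) ∈ E := fun i =>
      (hclo E (φ i).1.castSucc).mp ⟨h1 _ (rowProd_mem hr _),
        fun l => h1 _ (rowPoly_coeff_mem hpm hr _ l), h2 _ (by simp)⟩ (φ i).2
    refine ⟨fun a => ?_, fun i => (h3 i).1, fun i => (h3 i).2⟩
    obtain ⟨f, hf, hjf⟩ := hj a
    rw [hjf]
    refine h1 f (IntermediateField.adjoin.mono F _ _ ?_ hf)
    rintro _ ⟨i, rfl⟩
    exact ⟨_, rfl⟩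
  · rintro ⟨h1, h2, h3⟩
    have hF : ∀ a : F, algebraMap F (Frac (SkewAlg (Idx r) q)) a ∈ E := fun a => by
      have := h1 (algebraMap F _ a)
      rwa [AlgHom.commutes] at this
    have h4 : ∀ k : Fin N, _ := fun k => (hclo E k.castSucc).mpr fun i => by
      obtain ⟨s, hs⟩ := hθ' k i
      rw [← hs]
      exact ⟨h2 s, h3 s⟩
    refine ⟨ratMap_mem_of_invGen_mem ψ hF ?_, ?_⟩
    · rintro ⟨k, i⟩
      induction k using Fin.lastCases with
      | last =>
        obtain ⟨a, ha⟩ := hj' _ (IntermediateField.subset_adjoin F _ ⟨i, rfl⟩)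
        rw [← ha]
        exact h1 a
      | cast k =>
        rw [invGen]
        split_ifs
        exacts [(h4 k).1, (h4 k).2.1 _]
    · intro k hk l
      induction k using Fin.lastCases with
      | last => simp at hk
      | cast k => exact (h4 k).2.2 l

end Main

end
end QuantumOGZ

/-! ### Ordering of the parameters and the theorem. -/

namespace QuantumOGZ

noncomputable section

/-- An enumeration of the pairs `(k, i)` which lists the pairs with `i = 0` first. -/
theorem exists_equiv_sigma (N : ℕ) (r : Fin N → ℕ) (hr : ∀ k, 0 < r k) :
    ∃ φ : Fin N ⊕ Fin ((∑ k, r k) - N) ≃ Σ k, Fin (r k),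
      (∀ k, ((φ (Sum.inl k)).2 : ℕ) = 0) ∧ ∀ k, ((φ (Sum.inr k)).2 : ℕ) ≠ 0 := by
  let P : (Σ k, Fin (r k)) → Prop := fun t => (t.2 : ℕ) = 0
  let φ₁ : Fin N ≃ {t // P t} :=
    { toFun := fun k => ⟨⟨k, ⟨0, hr k⟩⟩, rfl⟩
      invFun := fun t => t.1.1
      left_inv := fun _ => rfl
      right_inv := by
        rintro ⟨⟨k, i⟩, hi⟩
        exact Subtype.ext (congrArg (Sigma.mk k) (Fin.ext (Eq.symm hi))) }
  have hcard : Fintype.card {t // ¬ P t} = (∑ k, r k) - N := by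
    rw [Fintype.card_subtype_compl, ← Fintype.card_congr φ₁, Fintype.card_sigma]
    simp
  let φ₂ := (Fintype.equivFinOfCardEq hcard).symm
  refine ⟨(Equiv.sumCongr φ₁ φ₂).trans (Equiv.sumCompl P), fun k => ?_, fun k => ?_⟩
  · exact (φ₁ k).2
  · exact (φ₂ k).2

end
end QuantumOGZ

open QuantumOGZ in
theorem theorem3 {F : Type u} [Field F] [CharZero F] (m p : ℕ) (hm : 0 < m) (hpm : p ∣ m)
    (hroot : ∃ ζ : F, IsPrimitiveRoot ζ m)
    (q : Fˣ) (hq : ∀ k : ℕ, 0 < k → q ^ k ≠ 1)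
    (N : ℕ) (r : Fin (N + 1) → ℕ) (hr : ∀ k, 0 < r k) :
    SatisfiesQuantumGK q (quantumOGZ q m p r) ∧
    ∃ (K : Type u) (_ : Field K) (_ : Algebra F K) (S : Set K),
      IsPurelyTranscendentalOn F K S ∧ S.encard = (r (Fin.last N) : ℕ∞) ∧
      ∃ (_ : IsOreDomain (quantumOGZ q m p r))
        (_ : IsOreDomain (QuantumAffine (ι := Fin N ⊕ Fin ((∑ k : Fin N, r k.castSucc) - N))
          (Sum.elim (fun _ => algebraMap F K ((q : F) ^ (m / p)))
            (fun _ => algebraMap F K ((q : F) ^ m))))),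
        Nonempty (Frac (quantumOGZ q m p r) ≃ₐ[F]
          Frac (QuantumAffine (ι := Fin N ⊕ Fin ((∑ k : Fin N, r k.castSucc) - N))
            (Sum.elim (fun _ => algebraMap F K ((q : F) ^ (m / p)))
              (fun _ => algebraMap F K ((q : F) ^ m))))) := by
  obtain ⟨ζ, hζ⟩ := hroot
  constructor
  · let φ := (Fintype.equivFin (Σ k : Fin N, Fin (r k.castSucc))).symm
    refine ⟨RatFun F (Fin (r (Fin.last N))), inferInstance, inferInstance, Set.range (xvar F), _,
      fun i => if ((φ i).2 : ℕ) = 0 then ((m / p : ℕ) : ℤ) else (m : ℤ),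
      isPurelyTranscendentalOn_range_xvar _,
      quantumOGZ_frac_equiv hm hpm hζ hq hr φ _ fun i => ?_⟩
    by_cases h : ((φ i).2 : ℕ) = 0
    · simp only [if_pos h, zpow_natCast, Units.val_pow_eq_pow_val]
    · simp only [if_neg h, zpow_natCast, Units.val_pow_eq_pow_val]
  · obtain ⟨φ, hφ, hφ'⟩ := exists_equiv_sigma N (fun k => r k.castSucc) fun k => hr _
    refine ⟨RatFun F (Fin (r (Fin.last N))), inferInstance, inferInstance, Set.range (xvar F),
      isPurelyTranscendentalOn_range_xvar _, encard_range_xvar _,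
      quantumOGZ_frac_equiv hm hpm hζ hq hr φ _ ?_⟩
    rintro (k | k)
    · rw [if_pos (hφ k), Sum.elim_inl]
    · rw [if_neg (hφ' k), Sum.elim_inr]
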